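/- Notation. For $r>0$ let $\mathbb D_r=\{z\in\mathbb C: |z|<r\}$ and let $B_r$ be the Banach space of bounded holomorphic functions on $\mathbb D_r$ vanishing at $0$, with the supremum norm. For $q\in\mathbb C$ with $|q|\neq 1$ and $0<r<1$ let $f_\delta(q)\in B_r$ be the function $$f_\delta(q,z)=\sum_{n\ge 1}\frac{z^n}{q^n-1}\qquad(z\in\mathbb D_r).$$ Let $|\lambda|=1$, let $\{M_n\}_{n\ge0}$ be a sequence of positive numbers and $B$ a complex Banach space. The Carleman class $\mathcal C^-(\lambda,\{M_n\},B)$ (resp. $\mathcal C^+(\lambda,\{M_n\},B)$) consists of the $B$-valued functions $f$ for which there are an open disk $\Delta\subset\{|q|<1\}$ (resp. $\Delta\subset\{|q|>1\}$) tangent to the unit circle at $\lambda$, on which $f$ is holomorphic, a formal series $\sum_{n\ge0} a_nQ^n\in B[[Q]]$ and $c_0,c_1>0$ with $$\Big\|f(q)-\sum_{0\le n\le N-1}a_n(q-\lambda)^n\Big\|\le c_0c_1^NM_N|q-\lambda|^N\qquad (N\ge0,\ q\in\Delta).$$ The series $\sum a_nQ^n$ is called the asymptotic expansion of $f$ at $\lambda$.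 The class is quasianalytic at $\lambda$ if any two of its members with the same asymptotic expansion at $\lambda$ coincide (on some disk $\Delta$ as above). The Gevrey-2 class $\mathcal G_2(\lambda,B)$ consists of the functions that belong to both $\mathcal C^-(\lambda,\{M_n\},B)$ and $\mathcal C^+(\lambda,\{M_n\},B)$ for $M_n=\Gamma(1+2n)=(2n)!$, with the same asymptotic expansion on both sides; and $B[[Q]]_2$ is the set of formal series with $\|a_n\|\le c_0c_1^n(2n)!$ for all $n\ge 0$ and some $c_0,c_1>0$. For $\lambda=e^{2\pi i\alpha}$ with $\alpha$ a quadratic irrational (irrational and algebraic of degree $2$), define $\nu_\pm(\lambda)>0$ by $$\frac1{\nu_-(\lambda)}=-\liminf_{(D,N)}\ D^{-2}\Big(\frac ND-\alpha\Big)^{-1},\qquad \frac1{\nu_+(\lambda)}=\limsup_{(D,N)}\ D^{-2}\Big(\frac ND-\alpha\Big)^{-1},$$ where $(D,N)$ runs over $\mathbb N^*\times\mathbb Z$ (along the filter of complements of finite sets), and set $\kappa_\pm(\lambda)=\nu_\pm(\lambda)^{1/2}$. For $z\in\mathbb C$ with $0<|z|<1$ let $\mathrm{REC}_\lambda(z)$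 be the set of $\xi\in\mathbb C$ with $$\big|\Re\big((2\pi i\lambda)^{-1/2}\xi\big)\big|<\kappa_+(\lambda)\log\frac1{|z|}\quad\text{and}\quad \big|\Im\big((2\pi i\lambda)^{-1/2}\xi\big)\big|<\kappa_-(\lambda)\log\frac1{|z|},$$ and let $\mathrm{REC}_\lambda(0)=\mathbb C$. Theorem. Let $\lambda=e^{2\pi i\alpha}$ with $\alpha$ a quadratic irrational, and let $0<r<1$. Then $f_\delta\in\mathcal G_2(\lambda,B_r)$, its asymptotic expansion $\sum_{n\ge0}F_nQ^n$ at $\lambda$ is unique and belongs to $B_r[[Q]]_2$, and the Borel transform $$\hat F(\xi,z)=\sum_{n\ge0}F_n(z)\frac{\xi^{2n}}{(2n)!}$$ converges for all $z\in\mathbb D_r$ and $|\xi|<\varepsilon$, for some $\varepsilon>0$ independent of $z$. (a) $\hat F$ extends analytically to the set $\{(\xi,z)\in\mathbb C\times\mathbb D_r:\xi\in\mathrm{REC}_\lambda(z)\}$. (b) For each $z\in\mathbb D_r$, the boundary of $\mathrm{REC}_\lambda(z)$ is a natural boundary for the analytic function $\xi\mapsto\hat F(\xi,z)$ on $\mathrm{REC}_\lambda(z)$: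 it does not extend analytically to a neighbourhood of any boundary point. (For $z=0$ the boundary is empty.) (c) If $\{M_n\}$ is a non-decreasing sequence of positive numbers such that $f_\delta\in\mathcal C^-(\lambda,\{M_n\},B_r)$ or $f_\delta\in\mathcal C^+(\lambda,\{M_n\},B_r)$, then neither $\mathcal C^-(\lambda,\{M_n\},B_r)$ nor $\mathcal C^+(\lambda,\{M_n\},B_r)$ is quasianalytic at $\lambda$. -/

import Mathlib

open Filter Metric
open scoped BoundedContinuousFunction

noncomputable section

namespace Monogenic

/-! ### Carleman and Gevrey classes at a point of the unit circle -/

/-- The two sides of the unit circle: `minus` is the disk `|q| < 1`, `plus` is the exterior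
`|q| > 1`. -/
inductive Side
  | minus
  | plus

/-- For `‖lam‖ = 1`: the open disks tangent to the unit circle at `lam`, contained in `|q| < 1`
(side `minus`) or in `|q| > 1` (side `plus`). -/
def tangentDisks : Side → ℂ → Set (Set ℂ)
  | .minus, lam => {Δ | ∃ ρ : ℝ, 0 < ρ ∧ ρ < 1 ∧ Δ = ball ((1 - (ρ : ℂ)) * lam) ρ}
  | .plus, lam => {Δ | ∃ ρ : ℝ, 0 < ρ ∧ Δ = ball ((1 + (ρ : ℂ)) * lam) ρ}

section Classes

variable {B : Type*} [NormedAddCommGroup B] [NormedSpace ℂ B]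

/-- `f` is holomorphic in some disk tangent to the unit circle at `lam` (on the given side), where
it admits the formal series `∑ a n Q ^ n`, `Q = q - lam`, as asymptotic expansion at `lam`, with
remainders controlled by the sequence `M`. -/
def HasCarlemanExpansion (σ : Side) (lam : ℂ) (M : ℕ → ℝ) (f : ℂ → B) (a : ℕ → B) : Prop :=
  ∃ Δ ∈ tangentDisks σ lam, DifferentiableOn ℂ f Δ ∧
    ∃ c₀ c₁ : ℝ, 0 < c₀ ∧ 0 < c₁ ∧ ∀ N : ℕ, ∀ q ∈ Δ,
      ‖f q - ∑ n ∈ Finset.range N, (q - lam) ^ n • a n‖ ≤ c₀ * c₁ ^ N * M N * ‖q - lam‖ ^ N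

/-- The one-sided Carleman classes. -/
def CarlemanClass (σ : Side) (lam : ℂ) (M : ℕ → ℝ) (B : Type*) [NormedAddCommGroup B]
    [NormedSpace ℂ B] : Set (ℂ → B) :=
  {f | ∃ a : ℕ → B, HasCarlemanExpansion σ lam M f a}

/-- Quasianalyticity at `lam` of a one-sided Carleman class: members with the same asymptotic
expansion at `lam` coincide. Members matter only through their values in disks tangent to the unit
circle at `lam`, so that coincidence means equality in such a disk. -/
def IsQuasianalytic (σ : Side) (lam : ℂ) (M : ℕ → ℝ) (B : Type*) [NormedAddCommGroup B]
    [NormedSpace ℂ B] : Prop :=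
  ∀ (f g : ℂ → B) (a : ℕ → B),
    HasCarlemanExpansion σ lam M f a → HasCarlemanExpansion σ lam M g a →
      ∃ Δ ∈ tangentDisks σ lam, Set.EqOn f g Δ

/-- The sequence `Γ(1 + n τ)` which defines the Gevrey-`τ` classes. -/
def gevreySeq (τ : ℝ) (n : ℕ) : ℝ := Real.Gamma (1 + n * τ)

/-- `f` belongs to the two-sided Gevrey-`τ` class at `lam`, with the same asymptotic expansion
`∑ a n Q ^ n` inside and outside the unit circle. -/
def HasGevreyExpansion (τ : ℝ) (lam : ℂ) (f : ℂ → B) (a : ℕ → B) : Prop :=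
  HasCarlemanExpansion .minus lam (gevreySeq τ) f a ∧
    HasCarlemanExpansion .plus lam (gevreySeq τ) f a

/-- The formal series of Gevrey-`τ` type. -/
def IsFormalGevrey (τ : ℝ) (a : ℕ → B) : Prop :=
  ∃ c₀ c₁ : ℝ, 0 < c₀ ∧ 0 < c₁ ∧ ∀ n : ℕ, ‖a n‖ ≤ c₀ * c₁ ^ n * gevreySeq τ n

end Classes

/-! ### The Banach space `B_r = z H^∞(𝔻_r)` and the fundamental solution -/

/-- The space of bounded holomorphic functions in the disk `|z| < r` that vanish at `0`, with the
supremum norm. -/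
def Br (r : ℝ) : Submodule ℂ (ball (0 : ℂ) r →ᵇ ℂ) where
  carrier := {f | (∃ g : ℂ → ℂ, DifferentiableOn ℂ g (ball 0 r) ∧
      ∀ z : ball (0 : ℂ) r, f z = g z) ∧ ∀ z : ball (0 : ℂ) r, (z : ℂ) = 0 → f z = 0}
  zero_mem' := ⟨⟨0, differentiableOn_const 0, fun _ => rfl⟩, fun _ _ => rfl⟩
  add_mem' := by
    rintro f₁ f₂ ⟨⟨g₁, h₁, e₁⟩, v₁⟩ ⟨⟨g₂, h₂, e₂⟩, v₂⟩
    exact ⟨⟨g₁ + g₂, h₁.add h₂, fun z => by simp [e₁, e₂]⟩,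
      fun z hz => by simp [v₁ z hz, v₂ z hz]⟩
  smul_mem' := by
    rintro c f ⟨⟨g, h, e⟩, v⟩
    exact ⟨⟨c • g, h.const_smul c, fun z => by simp [e]⟩, fun z hz => by simp [v z hz]⟩

theorem isClosed_Br (r : ℝ) : IsClosed (Br r : Set (ball (0 : ℂ) r →ᵇ ℂ)) := by
  rw [← isSeqClosed_iff_isClosed]
  classical
  intro u f hu hf
  have hu' : ∀ n, (∃ g : ℂ → ℂ, DifferentiableOn ℂ g (ball 0 r) ∧
      ∀ z : ball (0 : ℂ) r, u n z = g z) ∧ ∀ z : ball (0 : ℂ) r, (z : ℂ) = 0 → u n z = 0 := hu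
  choose g hg e using fun n => (hu' n).1
  have hunif := BoundedContinuousFunction.tendsto_iff_tendstoUniformly.1 hf
  let G : ℂ → ℂ := fun z => if h : z ∈ ball (0 : ℂ) r then f ⟨z, h⟩ else 0
  refine ⟨⟨G, ?_, fun z => by simp only [G]; rw [dif_pos z.2]⟩, fun z hz => ?_⟩
  · refine TendstoLocallyUniformlyOn.differentiableOn (F := g) (φ := atTop) ?_
      (Eventually.of_forall hg) isOpen_ball
    refine TendstoUniformlyOn.tendstoLocallyUniformlyOn ?_
    rw [Metric.tendstoUniformlyOn_iff]
    intro ε hε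
    filter_upwards [Metric.tendstoUniformly_iff.1 hunif ε hε] with n hn z hz
    have := hn ⟨z, hz⟩
    rw [e n ⟨z, hz⟩] at this
    simpa only [G, dif_pos hz] using this
  · have := hunif.tendsto_at z
    simp only [(hu' _).2 z hz] at this
    exact (tendsto_nhds_unique this tendsto_const_nhds)

instance instCompleteSpaceBr (r : ℝ) : CompleteSpace (Br r) := (isClosed_Br r).completeSpace_coe

/-- The function `z ↦ z ^ (n + 1)` as an element of `B_r`. -/
def monomial (r : ℝ) (n : ℕ) : Br r :=
  ⟨BoundedContinuousFunction.ofNormedAddCommGroup (fun z : ball (0 : ℂ) r => (z : ℂ) ^ (n + 1))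
      (by fun_prop) (r ^ (n + 1)) (fun z => by
        rw [norm_pow]
        exact pow_le_pow_left₀ (norm_nonneg _) (mem_ball_zero_iff.1 z.2).le _),
    ⟨fun z => z ^ (n + 1), by fun_prop, fun _ => rfl⟩,
    fun z hz => by simp [hz]⟩

/-- The fundamental solution `f_δ(q, z) = ∑_{n ≥ 1} z ^ n / (q ^ n - 1)`, as a function of `q` with
values in `B_r`: for `0 < r < 1` and `‖q‖ ≠ 1` the series converges absolutely in `B_r`. -/
def fdelta (r : ℝ) (q : ℂ) : Br r :=
  ∑' n : ℕ, (q ^ (n + 1) - 1)⁻¹ • monomial r n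

theorem summable_fdelta {r : ℝ} (hr0 : 0 < r) (hr1 : r < 1) {q : ℂ} (hq : ‖q‖ ≠ 1) :
    Summable fun n : ℕ => (q ^ (n + 1) - 1)⁻¹ • monomial r n := by
  have hc : 0 < |‖q‖ - 1| := abs_pos.2 (sub_ne_zero.2 hq)
  refine Summable.of_norm_bounded (g := fun n : ℕ => |‖q‖ - 1|⁻¹ * r ^ (n + 1))
    (((summable_geometric_of_lt_one hr0.le hr1).comp_injective
      (add_left_injective 1)).mul_left _) fun n => ?_
  have h1 : ‖monomial r n‖ ≤ r ^ (n + 1) :=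
    BoundedContinuousFunction.norm_ofNormedAddCommGroup_le _ (by positivity) fun z => by
      rw [norm_pow]
      exact pow_le_pow_left₀ (norm_nonneg _) (mem_ball_zero_iff.1 z.2).le _
  have h2 : |‖q‖ - 1| ≤ ‖q ^ (n + 1) - 1‖ := by
    refine le_trans ?_ (abs_norm_sub_norm_le _ _)
    rw [norm_pow, norm_one]
    have hgeom := mul_geom_sum ‖q‖ (n + 1)
    rw [← hgeom, abs_mul]
    refine le_mul_of_one_le_right hc.le (le_trans ?_ (le_abs_self _))
    rw [Finset.sum_range_succ']
    simp only [pow_zero, le_add_iff_nonneg_left]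
    positivity
  rw [norm_smul, norm_inv]
  gcongr

/-- The value of `fdelta r q` at `z` is the sum of the defining series. -/
theorem hasSum_fdelta_apply {r : ℝ} (hr0 : 0 < r) (hr1 : r < 1) {q : ℂ} (hq : ‖q‖ ≠ 1)
    (z : ball (0 : ℂ) r) :
    HasSum (fun n : ℕ => (z : ℂ) ^ (n + 1) / (q ^ (n + 1) - 1))
      ((fdelta r q : ball (0 : ℂ) r →ᵇ ℂ) z) := by
  have h := ((BoundedContinuousFunction.evalCLM ℂ z).comp (Br r).subtypeL).hasSum
    (summable_fdelta hr0 hr1 hq).hasSum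
  have e : (fun n : ℕ => (z : ℂ) ^ (n + 1) / (q ^ (n + 1) - 1)) = fun n : ℕ =>
      ((BoundedContinuousFunction.evalCLM ℂ z).comp (Br r).subtypeL)
        ((q ^ (n + 1) - 1)⁻¹ • monomial r n) := by
    funext n
    simp [monomial, div_eq_inv_mul]
  rw [e]
  exact h

/-! ### Quadratic irrationals, Lagrange constants, and the rectangle -/

/-- `α` is irrational and algebraic of degree 2. -/
def IsQuadraticIrrational (α : ℝ) : Prop :=
  Irrational α ∧ IsAlgebraic ℚ α ∧ (minpoly ℚ α).natDegree = 2

/-- The point `e^{2πiα}` of the unit circle. -/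
def circlePt (α : ℝ) : ℂ := Complex.exp (2 * Real.pi * Complex.I * α)

/-- `(D, N) ↦ D⁻² (N / D - α)⁻¹`. -/
def approxQuot (α : ℝ) (p : ℕ+ × ℤ) : ℝ :=
  ((p.1 : ℝ) ^ 2)⁻¹ * ((p.2 : ℝ) / (p.1 : ℝ) - α)⁻¹

/-- Lagrange spectral constant for rational approximations from below. -/
def nuMinus (α : ℝ) : ℝ := (-liminf (approxQuot α) cofinite)⁻¹

/-- Lagrange spectral constant for rational approximations from above. -/
def nuPlus (α : ℝ) : ℝ := (limsup (approxQuot α) cofinite)⁻¹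

def kappaMinus (α : ℝ) : ℝ := √(nuMinus α)

def kappaPlus (α : ℝ) : ℝ := √(nuPlus α)

/-- The rectangle `REC_λ(z)`, `λ = e^{2πiα}`; it is the whole plane for `z = 0`, where
`log (1 / |z|) = +∞`. -/
def REC (α : ℝ) (z : ℂ) : Set ℂ :=
  {ξ | z = 0 ∨
    (|((2 * Real.pi * Complex.I * circlePt α) ^ (-(1 / 2) : ℂ) * ξ).re|
        < kappaPlus α * Real.log (1 / ‖z‖) ∧
      |((2 * Real.pi * Complex.I * circlePt α) ^ (-(1 / 2) : ℂ) * ξ).im|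
        < kappaMinus α * Real.log (1 / ‖z‖))}

/-- The set `{(ξ, z) | |z| < r, ξ ∈ REC_λ(z)}`. -/
def recDomain (α r : ℝ) : Set (ℂ × ℂ) := {p | p.2 ∈ ball (0 : ℂ) r ∧ p.1 ∈ REC α p.2}

/-- The function `Fhat` extends the germ at `ξ = 0` of the order-2 Borel transform
`∑ F n (z) ξ ^ (2 n) / (2 n)!`. -/
def ExtendsBorel {r : ℝ} (F : ℕ → Br r) (Fhat : ℂ × ℂ → ℂ) : Prop :=
  ∃ ε : ℝ, 0 < ε ∧ ∀ ξ ∈ ball (0 : ℂ) ε, ∀ z : ball (0 : ℂ) r,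
    HasSum (fun n : ℕ => (F n : ball (0 : ℂ) r →ᵇ ℂ) z * (ξ ^ (2 * n) / ((2 * n).factorial : ℂ)))
      (Fhat (ξ, z))

/-- The boundary of `Ω` is a natural boundary for `f`: `f` is analytic in `Ω` and extends
analytically to no neighbourhood of any boundary point. (The domains to which this is applied are
convex, so that their intersections with disks are connected.) -/
def HasNaturalBoundary (f : ℂ → ℂ) (Ω : Set ℂ) : Prop :=
  AnalyticOnNhd ℂ f Ω ∧ ∀ w ∈ frontier Ω, ∀ ε : ℝ, 0 < ε →
    ¬ ∃ g : ℂ → ℂ, AnalyticOnNhd ℂ g (ball w ε) ∧ Set.EqOn g f (ball w ε ∩ Ω)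

end Monogenic

end

open Filter Metric
open scoped BoundedContinuousFunction

noncomputable section

namespace Monogenic

/-! ### Rational approximation of quadratic irrationals -/

/-! Partial fractions give `1/(q^n - 1) = n⁻¹ ∑ Λ/(q - Λ)` over `Λ^n = 1`, so that `fdelta` becomes
a sum of simple poles indexed by the pairs `(n, Λ)` (`Idx`). Expanding each pole at `λ` produces the
candidate coefficients `F_m = -∑ n⁻¹ Λ (Λ - λ)^(-m-1) z^n` (`asympCoeff`). A quadratic irrational is
badly approximable, hence `|Λ - λ|⁻¹ = O(n²)`, and `∑ n^(2m+j) r^n` grows like `(2m)!` up to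
geometric factors. In a disk tangent at `λ` one has `|q - Λ| ≥ |Λ - λ|²/8`, which only costs a fixed
power of `n`. This is the Gevrey-2 expansion.

The Borel transform replaces `∑ (ξ²/(Λ - λ))^m / (2m)!` by `cosh (ξ (Λ - λ)^(-1/2))`. Write `Λ = λ
exp (2πix)` with `|x| ≤ 1/2`, and `ζ = (2πiλ)^(-1/2) ξ`. The argument of `cosh` is then `ζ
|x|^(-1/2)` for `x > 0` and `-iζ |x|^(-1/2)` for `x < 0`, up to `O(|ζ|)`. Now `|x|^(-1/2) = n
√quot`, and the upper limits of `quot` on the two sides are `1/ν_±`. Against the factor `z^n`,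
approximations from above limit `Re ζ` and those from below limit `Im ζ`: this is the rectangle.

The natural boundary rests on the integral form attached to `α`, which turns the approximation
quotient into `(β + a x)/f(N, D)` with `f(N, D)` a nonzero integer. Hence the quotients near their
upper limit `L` are nearly discrete: `L = β/m` for the least value `m` taken infinitely often by `f`
on good approximations from above, and all but finitely many pairs outside the extremal level set
stay below `θ L` with `θ < 1` (`exists_extremal_set`). The extremal denominators are lacunary.
Beyond an edge the non-extremal terms still converge. At the edge the extremal ones form a lacunary
sum of exponentials with frequencies `n √L + O(1)` and coefficients of exact order `n`. A smooth
Fourier localization (`lacunary_unbounded`) isolates one coefficient at a time and shows that such a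
sum cannot be bounded near the edge point (`edge_unbounded`). Evenness in `ζ` gives the opposite
edges, and corners are limits of other boundary points. The other side of `α` is handled by `-α`.

For quasianalyticity, Dirichlet's theorem gives, for each `m`, an order `n` comparable to `m` with
one root of unity so close to `λ` that it dominates the coefficient of `z^n` in `F_m`; Cauchy's
estimate then yields `‖F_m‖ ≥ A b^m (2m)!` for `m ≥ 1`. Any admissible `M` therefore dominates the
Gevrey-2 sequence up to geometric factors, and its classes on both sides contain the flat function
`exp (-(s (q - λ))^(-1/2))`. -/

/-- The binary quadratic form `a N² + b N D + c D²`. -/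
def binForm (a b c : ℤ) (p : ℕ+ × ℤ) : ℤ :=
  a * p.2 ^ 2 + b * p.2 * (p.1 : ℕ) + c * (p.1 : ℕ) ^ 2

/-- The error `N / D - α` of a rational approximation. -/
def approxErr (α : ℝ) (p : ℕ+ × ℤ) : ℝ := (p.2 : ℝ) / (p.1 : ℝ) - α

theorem approxQuot_eq (α : ℝ) (p : ℕ+ × ℤ) :
    approxQuot α p = (((p.1 : ℕ) : ℝ) ^ 2 * approxErr α p)⁻¹ := by
  rw [approxQuot, approxErr, mul_inv]

theorem pnat_pos (n : ℕ+) : (0 : ℝ) < ((n : ℕ) : ℝ) := by exact_mod_cast n.pos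

theorem one_le_pnat (n : ℕ+) : (1 : ℝ) ≤ ((n : ℕ) : ℝ) := by exact_mod_cast n.pos

theorem approxErr_ne_zero {α : ℝ} (hα : Irrational α) (p : ℕ+ × ℤ) : approxErr α p ≠ 0 := by
  intro h
  apply hα
  refine ⟨(p.2 : ℚ) / ((p.1 : ℕ) : ℚ), ?_⟩
  rw [approxErr, sub_eq_zero] at h
  push_cast
  exact h

/-- Taylor expansion at the root `α` of `a X² + b X + c`, multiplied by `D²`. Since the left side is
an integer, `(D² x)⁻¹` is almost confined to the discrete set `(2aα + b) / ℤ` when the error `x` is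
small. -/
theorem binForm_eq {α : ℝ} {a b c : ℤ} (h : (a : ℝ) * α ^ 2 + b * α + c = 0) (p : ℕ+ × ℤ) :
    (binForm a b c p : ℝ) =
      ((p.1 : ℕ) : ℝ) ^ 2 * approxErr α p * (2 * a * α + b + a * approxErr α p) := by
  have hD := (pnat_pos p.1).ne'
  have hx : (p.2 : ℝ) = (approxErr α p + α) * ((p.1 : ℕ) : ℝ) := by
    rw [approxErr]; field_simp; ring
  simp only [binForm]
  push_cast
  rw [hx]
  linear_combination ((p.1 : ℕ) : ℝ) ^ 2 * h

/-- Clear denominators in the minimal polynomial; the absence of rational roots makes the form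
nonvanishing. The overall sign is chosen so that the derivative at `α` is positive, which makes the
form positive on good approximations from above. -/
theorem IsQuadraticIrrational.exists_form {α : ℝ} (hα : IsQuadraticIrrational α) :
    ∃ a b c : ℤ, (a : ℝ) * α ^ 2 + b * α + c = 0 ∧ 0 < 2 * a * α + b ∧
      ∀ p, binForm a b c p ≠ 0 := by
  obtain ⟨hirr, halg, hdeg⟩ := hα
  have hintegral : IsIntegral ℚ α := halg.isIntegral
  set P := minpoly ℚ α with hP
  have hmonic : P.coeff 2 = 1 := by
    have := (minpoly.monic hintegral).coeff_natDegree
    rwa [← hP, hdeg] at this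
  have heval : ∀ x : ℝ, Polynomial.aeval x P = x ^ 2 + P.coeff 1 * x + P.coeff 0 := by
    intro x
    rw [Polynomial.aeval_eq_sum_range, hdeg]
    simp [Finset.sum_range_succ, hmonic, Algebra.smul_def]
    ring
  have hroot : α ^ 2 + P.coeff 1 * α + P.coeff 0 = 0 := by
    rw [← heval, hP, minpoly.aeval]
  set u := P.coeff 1
  set v := P.coeff 0
  have hnr : ∀ y : ℚ, y ^ 2 + u * y + v ≠ 0 := by
    intro y hy
    have hy' : P.IsRoot y := by
      have h1 : ((Polynomial.eval y P : ℚ) : ℝ) = 0 := by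
        have h2 := heval y
        have h3 : Polynomial.aeval (y : ℝ) P = ((Polynomial.eval y P : ℚ) : ℝ) := by
          have := Polynomial.aeval_algebraMap_apply ℝ y P
          simpa using this
        rw [← h3, h2]
        exact_mod_cast hy
      exact_mod_cast h1
    exact hirr ⟨y, minpoly.root hintegral hy'⟩
  have hud : (u.den : ℝ) ≠ 0 := by exact_mod_cast u.den_nz
  have hvd : (v.den : ℝ) ≠ 0 := by exact_mod_cast v.den_nz
  have hu : (u : ℝ) = u.num / u.den := by exact_mod_cast (Rat.num_div_den u).symm
  have hv : (v : ℝ) = v.num / v.den := by exact_mod_cast (Rat.num_div_den v).symm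
  have hβ : 2 * α + u ≠ 0 := by
    intro h
    apply hirr
    refine ⟨-u / 2, ?_⟩
    push_cast
    linarith
  have key : ∀ s : ℤ, s ≠ 0 → ∀ p, binForm (s * (u.den * v.den)) (s * (u.num * v.den))
      (s * (v.num * u.den)) p ≠ 0 := by
    intro s hs p h0
    apply hnr ((p.2 : ℚ) / (p.1 : ℕ))
    have hD : (((p.1 : ℕ)) : ℚ) ≠ 0 := by exact_mod_cast p.1.ne_zero
    have h1 : (binForm (s * (u.den * v.den)) (s * (u.num * v.den)) (s * (v.num * u.den)) p : ℚ)
      = s * (u.den * v.den) * (p.1 : ℕ) ^ 2 *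
        (((p.2 : ℚ) / (p.1 : ℕ)) ^ 2 + u * ((p.2 : ℚ) / (p.1 : ℕ)) + v) := by
      have e1 : (u.num : ℚ) = u * u.den := (Rat.mul_den_eq_num u).symm
      have e2 : (v.num : ℚ) = v * v.den := (Rat.mul_den_eq_num v).symm
      simp only [binForm]
      push_cast
      rw [e1, e2]
      field_simp
    rw [h0] at h1
    have h3 : (s : ℚ) * (u.den * v.den) * (p.1 : ℕ) ^ 2 ≠ 0 := by
      have : (s : ℚ) ≠ 0 := by exact_mod_cast hs
      have h5 : (u.den : ℚ) ≠ 0 := by exact_mod_cast u.den_nz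
      have h6 : (v.den : ℚ) ≠ 0 := by exact_mod_cast v.den_nz
      positivity
    rcases mul_eq_zero.1 h1.symm with h | h
    · exact absurd h h3
    · exact h
  have hpos : (0 : ℝ) < u.den * v.den := by
    have h5 : (0 : ℝ) < u.den := by exact_mod_cast u.den_pos
    have h6 : (0 : ℝ) < v.den := by exact_mod_cast v.den_pos
    positivity
  have hmain : ∀ s : ℤ, ((s * (u.den * v.den) : ℤ) : ℝ) * α ^ 2 +
      ((s * (u.num * v.den) : ℤ) : ℝ) * α + ((s * (v.num * u.den) : ℤ) : ℝ) = 0 ∧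
      2 * ((s * (u.den * v.den) : ℤ) : ℝ) * α + ((s * (u.num * v.den) : ℤ) : ℝ) =
        s * (u.den * v.den) * (2 * α + u) := by
    intro s
    have e1 : (u.num : ℝ) = u * u.den := by rw [hu]; field_simp
    have e2 : (v.num : ℝ) = v * v.den := by rw [hv]; field_simp
    push_cast
    rw [e1, e2]
    constructor
    · linear_combination (s * (u.den * v.den) : ℝ) * hroot
    · ring
  rcases lt_or_gt_of_ne hβ with h | h
  · refine ⟨_, _, _, (hmain (-1)).1, ?_, key (-1) (by norm_num)⟩
    rw [(hmain (-1)).2]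
    push_cast
    nlinarith
  · refine ⟨_, _, _, (hmain 1).1, ?_, key 1 (by norm_num)⟩
    rw [(hmain 1).2]
    push_cast
    nlinarith

theorem IsQuadraticIrrational.neg {α : ℝ} (hα : IsQuadraticIrrational α) :
    IsQuadraticIrrational (-α) := by
  obtain ⟨hirr, halg, hdeg⟩ := hα
  refine ⟨hirr.neg, halg.neg, ?_⟩
  rw [minpoly.neg, Polynomial.natDegree_mul']
  · simp [Polynomial.natDegree_comp, hdeg]
  · simp [Polynomial.leadingCoeff_comp, minpoly.ne_zero halg.isIntegral]

/-- Liouville's argument: a nonzero integer value of the form has modulus at least `1`, while its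
last factor in `binForm_eq` is bounded when the error is at most `1`. Larger errors are trivial. -/
theorem IsQuadraticIrrational.exists_abs_approxQuot_le {α : ℝ} (hα : IsQuadraticIrrational α) :
    ∃ C : ℝ, 0 < C ∧ ∀ p, |approxQuot α p| ≤ C := by
  obtain ⟨a, b, c, h0, hβ, hf⟩ := hα.exists_form
  refine ⟨2 * a * α + b + |(a : ℝ)| + 1, by positivity, fun p => ?_⟩
  have hx := approxErr_ne_zero hα.1 p
  have hD := one_le_pnat p.1
  have hfp := binForm_eq h0 p
  have h1 : (1 : ℝ) ≤ |(binForm a b c p : ℝ)| := by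
    exact_mod_cast Int.one_le_abs (hf p)
  rw [approxQuot_eq, abs_inv, inv_le_comm₀ (by positivity) (by positivity), abs_mul,
    abs_of_pos (by positivity : (0 : ℝ) < ((p.1 : ℕ) : ℝ) ^ 2)]
  rw [hfp, abs_mul, abs_mul, abs_of_pos (by positivity : (0 : ℝ) < ((p.1 : ℕ) : ℝ) ^ 2)] at h1
  set x := approxErr α p
  set D := ((p.1 : ℕ) : ℝ)
  by_cases hx1 : |x| ≤ 1
  · have h2 : |2 * a * α + b + a * x| ≤ 2 * a * α + b + |(a : ℝ)| + 1 := by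
      calc |2 * a * α + b + a * x| ≤ |2 * a * α + b| + |a * x| := abs_add_le _ _
        _ ≤ 2 * a * α + b + |(a : ℝ)| * 1 := by
          rw [abs_of_pos hβ, abs_mul]; gcongr
        _ ≤ _ := by linarith
    rw [inv_le_iff_one_le_mul₀ (by positivity)]
    calc (1 : ℝ) ≤ _ := h1
      _ ≤ _ := by gcongr
  · push Not at hx1
    have : (2 * a * α + b + |(a : ℝ)| + 1)⁻¹ ≤ 1 := inv_le_one_of_one_le₀ (by
      have := abs_nonneg (a : ℝ); linarith)
    nlinarith

theorem IsQuadraticIrrational.exists_le_abs_sub {α : ℝ} (hα : IsQuadraticIrrational α) :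
    ∃ c : ℝ, 0 < c ∧ c ≤ 1 ∧ ∀ (D : ℕ) (N : ℤ), 0 < D → c ≤ D * |(N : ℝ) - D * α| := by
  obtain ⟨C, hC, h⟩ := hα.exists_abs_approxQuot_le
  refine ⟨min C⁻¹ 1, by positivity, min_le_right _ _, fun D N hD => (min_le_left _ _).trans ?_⟩
  have h1 := h (⟨D, hD⟩, N)
  have hx := approxErr_ne_zero hα.1 (⟨D, hD⟩, N)
  have hD' : (0 : ℝ) < D := by exact_mod_cast hD
  rw [approxQuot_eq, abs_inv, inv_le_comm₀ (by simp only [PNat.mk_coe]; positivity) hC] at h1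
  refine h1.trans (le_of_eq ?_)
  simp only [approxErr, PNat.mk_coe]
  rw [← abs_of_pos hD', ← abs_mul, abs_of_pos hD']
  congr 1
  field_simp

set_option maxHeartbeats 1000000 in
/-- Good approximations from above, at every scale. -/
theorem exists_approx_above {α c : ℝ} (hc : 0 < c) (hc1 : c ≤ 1)
    (hbad : ∀ (D : ℕ) (N : ℤ), 0 < D → c ≤ D * |(N : ℝ) - D * α|) :
    ∃ K : ℝ, 0 < K ∧ ∀ Q : ℕ, 0 < Q → ∃ p : ℕ+ × ℤ, 0 < (p.2 : ℝ) - (p.1 : ℕ) * α ∧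
      (p.2 : ℝ) - (p.1 : ℕ) * α ≤ 1 / Q ∧
      ((p.1 : ℕ) : ℝ) * ((p.2 : ℝ) - (p.1 : ℕ) * α) ≤ K := by
  -- Two Dirichlet approximations, at scales `Q` and `K Q`. If one lies above `α` it serves
  -- directly. Otherwise `c K > 2` forces the second to have a strictly smaller error and a
  -- denominator more than twice as large.
  obtain ⟨K, hK⟩ := exists_nat_gt (2 / c)
  have hK0 : (0 : ℝ) < K := lt_trans (by positivity) hK
  have hK1 : (1 : ℝ) ≤ K := by
    have : (2 : ℝ) ≤ 2 / c := by rw [le_div_iff₀ hc]; linarith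
    linarith
  have hKc : 2 < c * K := by rw [div_lt_iff₀ hc] at hK; linarith
  refine ⟨K, hK0, ?_⟩
  intro Q hQ
  have hQ' : (1 : ℝ) ≤ Q := by exact_mod_cast hQ
  obtain ⟨N1, D1, hD1, hD1Q, h1⟩ := Real.exists_int_int_abs_mul_sub_le α hQ
  have hKQ : 0 < K * Q := Nat.mul_pos (by exact_mod_cast hK0) hQ
  obtain ⟨N2, D2, hD2, hD2Q, h2⟩ := Real.exists_int_int_abs_mul_sub_le α hKQ
  lift D1 to ℕ using hD1.le
  lift D2 to ℕ using hD2.le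
  have hD1' : 0 < D1 := by exact_mod_cast hD1
  have hD2' : 0 < D2 := by exact_mod_cast hD2
  have hD1Qr : (D1 : ℝ) ≤ Q := by exact_mod_cast hD1Q
  have hD2Qr : (D2 : ℝ) ≤ K * Q := by exact_mod_cast hD2Q
  have hD1r : (1 : ℝ) ≤ D1 := by exact_mod_cast hD1'
  have hD2r : (1 : ℝ) ≤ D2 := by exact_mod_cast hD2'
  have b1 := hbad D1 N1 hD1'
  have b2 := hbad D2 N2 hD2'
  push_cast at h1 h2
  rw [abs_sub_comm] at h1 h2
  have h1' : |(N1 : ℝ) - D1 * α| ≤ 1 / Q := h1.trans (by gcongr; linarith)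
  have h2' : |(N2 : ℝ) - D2 * α| ≤ 1 / (K * Q) := h2.trans (by gcongr; linarith)
  rcases le_or_gt 0 ((N1 : ℝ) - D1 * α) with s1 | s1
  · rw [abs_of_nonneg s1] at h1' b1
    refine ⟨(⟨D1, hD1'⟩, N1), ?_, by simpa using h1', ?_⟩
    · simp only [PNat.mk_coe]; by_contra hcon; nlinarith
    · simp only [PNat.mk_coe]
      calc (D1 : ℝ) * (N1 - D1 * α) ≤ Q * (1 / Q) := by gcongr
        _ = 1 := by field_simp
        _ ≤ K := hK1
  rcases le_or_gt 0 ((N2 : ℝ) - D2 * α) with s2 | s2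
  · rw [abs_of_nonneg s2] at h2' b2
    have h3 : (N2 : ℝ) - D2 * α ≤ 1 / Q := h2'.trans (by gcongr; nlinarith)
    refine ⟨(⟨D2, hD2'⟩, N2), ?_, by simpa using h3, ?_⟩
    · simp only [PNat.mk_coe]; by_contra hcon; nlinarith
    · simp only [PNat.mk_coe]
      calc (D2 : ℝ) * (N2 - D2 * α) ≤ (K * Q) * (1 / (K * Q)) := by gcongr
        _ = 1 := by field_simp
        _ ≤ K := hK1
  rw [abs_of_neg s1] at h1' b1
  rw [abs_of_neg s2] at h2' b2
  set e1 := -((N1 : ℝ) - D1 * α) with he1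
  set e2 := -((N2 : ℝ) - D2 * α) with he2
  have he1p : 0 < e1 := by linarith
  have he2p : 0 < e2 := by linarith
  have hlt : e2 < e1 := by
    have hA : c / Q ≤ e1 := by
      rw [div_le_iff₀ (by positivity)]; nlinarith
    have hB : 1 / (K * Q) < c / Q := by
      rw [div_lt_div_iff₀ (by positivity) (by positivity)]; nlinarith
    linarith
  have hDD : 2 * D1 < D2 := by
    have hA : c ≤ D2 * (1 / (K * Q)) := b2.trans (by gcongr)
    have hB : c * K * Q ≤ D2 := by
      rw [mul_one_div, le_div_iff₀ (by positivity)] at hA; linarith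
    have : (2 * D1 : ℝ) < D2 := by nlinarith
    exact_mod_cast this
  -- Both approximations lie below `α`. The combination `k (N2, D2) - (N1, D1)` has signed error `e1
  -- - k e2`, which lies in `(0, e2)`: the side is switched, and `k e2 ≤ e1` controls the product of
  -- denominator and error.
  set k := ⌊e1 / e2⌋₊ with hk
  have hk1 : 1 ≤ k := by
    rw [hk, Nat.le_floor_iff (by positivity), le_div_iff₀ he2p]; push_cast; linarith
  have hkl : (k : ℝ) * e2 ≤ e1 := by
    rw [← le_div_iff₀ he2p]; exact Nat.floor_le (by positivity)
  have hku : e1 < (k + 1) * e2 := by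
    rw [← div_lt_iff₀ he2p]; exact Nat.lt_floor_add_one _
  have hkD : D1 < k * D2 := by nlinarith
  have hval : ((k * N2 - N1 : ℤ) : ℝ) - ((k * D2 - D1 : ℕ) : ℝ) * α = e1 - k * e2 := by
    rw [Nat.cast_sub hkD.le]; push_cast; rw [he1, he2]; ring
  have hne : e1 - k * e2 ≠ 0 := by
    intro h0
    have := hbad (k * D2 - D1) (k * N2 - N1) (by omega)
    rw [hval, h0] at this
    simp at this; linarith
  refine ⟨(⟨k * D2 - D1, by omega⟩, k * N2 - N1), ?_, ?_, ?_⟩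
  · simp only [PNat.mk_coe]; rw [hval]
    exact lt_of_le_of_ne (by linarith) hne.symm
  · simp only [PNat.mk_coe]; rw [hval]
    have : 1 / ((K : ℝ) * Q) ≤ 1 / Q := by gcongr; nlinarith
    linarith
  · simp only [PNat.mk_coe]; rw [hval]
    have hX : ((k * D2 - D1 : ℕ) : ℝ) ≤ k * D2 := by
      rw [Nat.cast_sub hkD.le]; push_cast; linarith
    calc ((k * D2 - D1 : ℕ) : ℝ) * (e1 - k * e2) ≤ (k * D2) * e2 := by gcongr; linarith
      _ = D2 * (k * e2) := by ring
      _ ≤ (K * Q) * (1 / Q) := by gcongr; linarith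
      _ = K := by field_simp

/-- This makes the upper limit `approxLim` positive. Finitely many pairs would have their positive
errors `N - D α` bounded away from zero, against approximation from above at every scale. -/
theorem IsQuadraticIrrational.exists_infinite_le_approxQuot {α : ℝ}
    (hα : IsQuadraticIrrational α) :
    ∃ k : ℝ, 0 < k ∧ {p | k ≤ approxQuot α p}.Infinite := by
  obtain ⟨c, hc, hc1, hbad⟩ := hα.exists_le_abs_sub
  obtain ⟨K, hK0, main⟩ := exists_approx_above hc hc1 hbad
  refine ⟨1 / K, by positivity, fun hfin => ?_⟩
  have hmem : ∀ p : ℕ+ × ℤ, 0 < (p.2 : ℝ) - (p.1 : ℕ) * α →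
      ((p.1 : ℕ) : ℝ) * ((p.2 : ℝ) - (p.1 : ℕ) * α) ≤ K → 1 / K ≤ approxQuot α p := by
    intro p hp hp'
    have hD := pnat_pos p.1
    have e : ((p.1 : ℕ) : ℝ) ^ 2 * approxErr α p =
        ((p.1 : ℕ) : ℝ) * ((p.2 : ℝ) - (p.1 : ℕ) * α) := by
      rw [approxErr]; field_simp
    rw [approxQuot_eq, e, ← one_div]
    gcongr
  obtain ⟨m, hm0, hm⟩ : ∃ m : ℝ, 0 < m ∧ ∀ p ∈ {p | 1 / K ≤ approxQuot α p},
      0 < (p.2 : ℝ) - (p.1 : ℕ) * α → m ≤ (p.2 : ℝ) - (p.1 : ℕ) * α := by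
    have : ∀ s : Set (ℕ+ × ℤ), s.Finite → ∃ m : ℝ, 0 < m ∧ ∀ p ∈ s,
      0 < (p.2 : ℝ) - (p.1 : ℕ) * α → m ≤ (p.2 : ℝ) - (p.1 : ℕ) * α := by
      intro s hs
      induction s, hs using Set.Finite.induction_on with
      | empty => exact ⟨1, one_pos, by simp⟩
      | @insert q s _ _ ih =>
        obtain ⟨m, hm0, hm⟩ := ih
        by_cases hq : 0 < (q.2 : ℝ) - (q.1 : ℕ) * α
        · refine ⟨min m ((q.2 : ℝ) - (q.1 : ℕ) * α), lt_min hm0 hq, fun p hp hp' => ?_⟩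
          rcases hp with rfl | hp
          · exact min_le_right _ _
          · exact (min_le_left _ _).trans (hm p hp hp')
        · refine ⟨m, hm0, fun p hp hp' => ?_⟩
          rcases hp with rfl | hp
          · exact absurd hp' hq
          · exact hm p hp hp'
    exact this _ hfin
  obtain ⟨Q, hQ⟩ := exists_nat_gt (1 / m)
  have hQ0 : (0 : ℝ) < Q := lt_trans (by positivity) hQ
  obtain ⟨p, hp1, hp2, hp3⟩ := main Q (by exact_mod_cast hQ0)
  have := hm p (hmem p hp1 hp3) hp1
  rw [div_lt_iff₀ hm0] at hQ
  rw [le_div_iff₀ hQ0] at hp2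
  nlinarith

/-- A quotient at least `k` bounds the error by `1 / k`, so each denominator allows finitely many
numerators. Hence, along the cofinite filter, denominators tend to infinity on the good
approximations. -/
theorem finite_le_approxQuot (α : ℝ) {k : ℝ} (hk : 0 < k) (n : ℕ) :
    {p : ℕ+ × ℤ | k ≤ approxQuot α p ∧ (p.1 : ℕ) ≤ n}.Finite := by
  have hsub : {p : ℕ+ × ℤ | k ≤ approxQuot α p ∧ (p.1 : ℕ) ≤ n} ⊆
      (fun p : ℕ × ℤ => ((p.1.succPNat, p.2) : ℕ+ × ℤ)) ''
        ((Finset.range n : Set ℕ) ×ˢ (Finset.Icc (-⌈(n * (1 / k + |α|))⌉) ⌈(n * (1 / k + |α|))⌉ :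
          Set ℤ)) := by
    rintro ⟨D, N⟩ ⟨h1, h2⟩
    refine ⟨(D.natPred, N), ⟨?_, ?_⟩, by simp⟩
    · simp only [Finset.coe_range, Set.mem_Iio]
      have := D.natPred_add_one
      simp only at h2
      omega
    · have hD := one_le_pnat D
      rw [approxQuot_eq] at h1
      have hpos : 0 < ((D : ℕ) : ℝ) ^ 2 * approxErr α (D, N) := by
        by_contra hcon
        push Not at hcon
        have := inv_nonpos.2 hcon
        simp only at h1
        linarith
      simp only at h1
      rw [le_inv_comm₀ hk hpos] at h1
      have hx0 : 0 < approxErr α (D, N) := pos_of_mul_pos_right hpos (by positivity)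
      have hx : approxErr α (D, N) ≤ 1 / k := by
        rw [one_div]
        exact (le_mul_of_one_le_left hx0.le (one_le_pow₀ hD)).trans h1
      have hN : (N : ℝ) = (approxErr α (D, N) + α) * D := by
        simp only [approxErr]; field_simp; ring
      have habs : |(N : ℝ)| ≤ n * (1 / k + |α|) := by
        rw [hN, abs_mul, mul_comm, abs_of_pos (pnat_pos D)]
        have : ((D : ℕ) : ℝ) ≤ n := by exact_mod_cast h2
        gcongr
        refine (abs_add_le _ _).trans ?_
        rw [abs_of_pos hx0]
        gcongr
      rw [Finset.coe_Icc, Set.mem_Icc, ← abs_le]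
      have : ((|N| : ℤ) : ℝ) ≤ ⌈(n * (1 / k + |α|))⌉ := by
        push_cast
        exact habs.trans (Int.le_ceil _)
      exact_mod_cast this
  exact (Set.Finite.image _ ((Finset.finite_toSet _).prod (Finset.finite_toSet _))).subset hsub

/-! ### The constants `kappaPlus` and `kappaMinus` as upper limits for `α` and `-α` -/

/-- The upper limit of the approximation quotients. -/
def approxLim (α : ℝ) : ℝ := limsup (approxQuot α) cofinite

theorem kappaPlus_eq (α : ℝ) : kappaPlus α = (√(approxLim α))⁻¹ := by
  rw [kappaPlus, nuPlus, Real.sqrt_inv, approxLim]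

/-- No boundedness is needed: on the reals `sInf` is by definition minus the `sSup` of the negated
set. -/
theorem neg_liminf_eq_limsup_neg {ι : Type*} (u : ι → ℝ) (l : Filter ι) :
    -liminf u l = limsup (fun i => -u i) l := by
  rw [liminf_eq, limsup_eq, Real.sInf_def]
  congr 2
  ext a
  simp

theorem approxQuot_neg (α : ℝ) (p : ℕ+ × ℤ) :
    approxQuot (-α) p = -approxQuot α (p.1, -p.2) := by
  simp only [approxQuot]
  rw [← mul_neg, ← inv_neg]
  congr 2
  push_cast
  ring

/-- The substitution `N ↦ -N` exchanges the two sides, so only approximations from above have to be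
studied, for `α` and for `-α`. -/
theorem nuMinus_eq (α : ℝ) : nuMinus α = nuPlus (-α) := by
  rw [nuMinus, nuPlus, neg_liminf_eq_limsup_neg]
  congr 1
  let e : ℕ+ × ℤ ≃ ℕ+ × ℤ := Equiv.prodCongr (Equiv.refl _) (Equiv.neg ℤ)
  have he : map e cofinite = cofinite := by
    rw [← comap_equiv_symm, e.symm.injective.comap_cofinite_eq]
  have : approxQuot (-α) = (fun i => -approxQuot α i) ∘ e := by
    funext p
    rw [approxQuot_neg]
    rfl
  rw [this, limsup, limsup, ← map_map, he]

theorem kappaMinus_eq (α : ℝ) : kappaMinus α = (√(approxLim (-α)))⁻¹ := by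
  rw [kappaMinus, nuMinus_eq, nuPlus, Real.sqrt_inv, approxLim]

theorem IsQuadraticIrrational.isBoundedUnder {α : ℝ} (hα : IsQuadraticIrrational α) :
    IsBoundedUnder (· ≤ ·) cofinite (approxQuot α) := by
  obtain ⟨C, -, h⟩ := hα.exists_abs_approxQuot_le
  exact isBoundedUnder_of ⟨C, fun p => (le_abs_self _).trans (h p)⟩

theorem IsQuadraticIrrational.isCoboundedUnder {α : ℝ} (hα : IsQuadraticIrrational α) :
    IsCoboundedUnder (· ≤ ·) cofinite (approxQuot α) := by
  obtain ⟨C, -, h⟩ := hα.exists_abs_approxQuot_le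
  exact IsBoundedUnder.isCoboundedUnder_le
    (isBoundedUnder_of ⟨-C, fun p => (abs_le.1 (h p)).1⟩)

theorem IsQuadraticIrrational.approxLim_pos {α : ℝ} (hα : IsQuadraticIrrational α) :
    0 < approxLim α := by
  obtain ⟨k, hk, h⟩ := hα.exists_infinite_le_approxQuot
  exact hk.trans_le (le_limsup_of_frequently_le (frequently_cofinite_iff_infinite.2 h)
    hα.isBoundedUnder)

theorem IsQuadraticIrrational.eventually_approxQuot_lt {α : ℝ} (hα : IsQuadraticIrrational α)
    {k : ℝ} (hk : approxLim α < k) :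
    ∀ᶠ p in cofinite, approxQuot α p < k :=
  eventually_lt_of_limsup_lt hk hα.isBoundedUnder

theorem IsQuadraticIrrational.infinite_half_approxLim_le {α : ℝ} (hα : IsQuadraticIrrational α) :
    {p | approxLim α / 2 ≤ approxQuot α p}.Infinite := by
  have h : ∃ᶠ p in cofinite, approxLim α / 2 < approxQuot α p :=
    frequently_lt_of_lt_limsup hα.isCoboundedUnder (half_lt_self hα.approxLim_pos)
  exact frequently_cofinite_iff_infinite.1 (h.mono fun p hp => hp.le)

theorem approxErr_of_le_approxQuot {α k : ℝ} (hk : 0 < k) {p : ℕ+ × ℤ} (h : k ≤ approxQuot α p) :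
    0 < approxErr α p ∧ approxErr α p ≤ k⁻¹ / ((p.1 : ℕ) : ℝ) ^ 2 ∧
      approxErr α p = (((p.1 : ℕ) : ℝ) ^ 2 * approxQuot α p)⁻¹ := by
  have hD := pnat_pos p.1
  have hq : 0 < approxQuot α p := hk.trans_le h
  have e : approxErr α p = (((p.1 : ℕ) : ℝ) ^ 2 * approxQuot α p)⁻¹ := by
    rw [approxQuot_eq, mul_inv, mul_inv, mul_inv, inv_inv, inv_inv, ← mul_assoc,
      inv_mul_cancel₀ (by positivity), one_mul]
  refine ⟨by rw [e]; positivity, ?_, e⟩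
  rw [e, mul_inv, mul_comm, div_eq_mul_inv]
  gcongr

/-! ### The extremal approximations: discreteness of quality and lacunarity of denominators -/

/-- Two elements of a level set of an integral form which approximate `α` with almost the same
quality have well separated denominators. -/
theorem separation_of_form_eq {α L C : ℝ} {a b c m : ℤ} (hL : 0 < L) (hC : 0 ≤ C)
    (h0 : (a : ℝ) * α ^ 2 + b * α + c = 0) (hm : m ≠ 0) {p p' : ℕ+ × ℤ} (hne : p ≠ p')
    (hf : binForm a b c p = m) (hf' : binForm a b c p' = m)
    (hq : L / 2 ≤ approxQuot α p) (hq' : L / 2 ≤ approxQuot α p')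
    (hqL : |approxQuot α p - L| ≤ C / ((p.1 : ℕ) : ℝ) ^ 2)
    (hqL' : |approxQuot α p' - L| ≤ C / ((p'.1 : ℕ) : ℝ) ^ 2)
    (hle : (p.1 : ℕ) ≤ (p'.1 : ℕ)) (hbig : 16 * C / L ^ 2 ≤ ((p.1 : ℕ) : ℝ) ^ 2) :
    min (1 / 2) (L / 8) * ((p'.1 : ℕ) : ℝ) ≤ ((p'.1 : ℕ) : ℝ) - ((p.1 : ℕ) : ℝ) := by
  have hx := approxErr_of_le_approxQuot (half_pos hL) hq
  have hx' := approxErr_of_le_approxQuot (half_pos hL) hq'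
  have hD := pnat_pos p.1
  have hD' := pnat_pos p'.1
  have hle' : ((p.1 : ℕ) : ℝ) ≤ ((p'.1 : ℕ) : ℝ) := by exact_mod_cast hle
  -- Proportional pairs have the same error; on one nonzero level of the form, `binForm_eq` then
  -- forces equal denominators, hence equal pairs.
  have hint_ne : p.2 * (p'.1 : ℕ) - p'.2 * (p.1 : ℕ) ≠ 0 := by
    intro h
    have h1 : (p.2 : ℝ) * (p'.1 : ℕ) - p'.2 * (p.1 : ℕ) = 0 := by exact_mod_cast h
    have hxx : approxErr α p = approxErr α p' := by
      simp only [approxErr]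
      congr 1
      rw [div_eq_div_iff hD.ne' hD'.ne']
      linarith
    have e1 := binForm_eq h0 p
    have e2 := binForm_eq h0 p'
    rw [hf] at e1
    rw [hf', ← hxx] at e2
    have hmr : (m : ℝ) ≠ 0 := by exact_mod_cast hm
    have hnz : approxErr α p * (2 * a * α + b + a * approxErr α p) ≠ 0 := by
      intro hz
      apply hmr
      rw [e1, mul_assoc, hz, mul_zero]
    have h2 : ((p.1 : ℕ) : ℝ) ^ 2 = ((p'.1 : ℕ) : ℝ) ^ 2 := by
      apply mul_right_cancel₀ hnz
      rw [← mul_assoc, ← mul_assoc, ← e1, ← e2]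
    have h3 : ((p.1 : ℕ) : ℝ) = ((p'.1 : ℕ) : ℝ) := by
      rwa [sq_eq_sq₀ hD.le hD'.le] at h2
    have h4 : p.1 = p'.1 := PNat.coe_injective (by exact_mod_cast h3)
    have h5 : (p.2 : ℝ) = p'.2 := by
      rw [h4] at h1
      have : ((p.2 : ℝ) - p'.2) * (p'.1 : ℕ) = 0 := by linarith
      rcases mul_eq_zero.1 this with h | h
      · linarith
      · exact absurd h hD'.ne'
    exact hne (Prod.ext h4 (by exact_mod_cast h5))
  have hone : (1 : ℝ) ≤ |(p.2 : ℝ) * (p'.1 : ℕ) - p'.2 * (p.1 : ℕ)| := by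
    exact_mod_cast Int.one_le_abs hint_ne
  have hcross : (p.2 : ℝ) * (p'.1 : ℕ) - p'.2 * (p.1 : ℕ) =
      ((p.1 : ℕ) : ℝ) * ((p'.1 : ℕ) : ℝ) * (approxErr α p - approxErr α p') := by
    simp only [approxErr]
    field_simp
    ring
  have herr : ∀ p : ℕ+ × ℤ, L / 2 ≤ approxQuot α p →
      |approxQuot α p - L| ≤ C / ((p.1 : ℕ) : ℝ) ^ 2 →
      |approxErr α p - (((p.1 : ℕ) : ℝ) ^ 2 * L)⁻¹| ≤ 2 * C / L ^ 2 / ((p.1 : ℕ) : ℝ) ^ 4 := by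
    intro p hq hqL
    have hD := pnat_pos p.1
    have hqp : 0 < approxQuot α p := (half_pos hL).trans_le hq
    rw [(approxErr_of_le_approxQuot (half_pos hL) hq).2.2]
    have e : (((p.1 : ℕ) : ℝ) ^ 2 * approxQuot α p)⁻¹ - (((p.1 : ℕ) : ℝ) ^ 2 * L)⁻¹ =
        -(approxQuot α p - L) * (((p.1 : ℕ) : ℝ) ^ 2 * L * approxQuot α p)⁻¹ := by
      field_simp
      ring
    rw [e, abs_mul, abs_neg, abs_of_pos (by positivity : (0 : ℝ) < (_)⁻¹)]
    calc |approxQuot α p - L| * (((p.1 : ℕ) : ℝ) ^ 2 * L * approxQuot α p)⁻¹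
        ≤ C / ((p.1 : ℕ) : ℝ) ^ 2 * (((p.1 : ℕ) : ℝ) ^ 2 * L * (L / 2))⁻¹ := by gcongr
      _ = _ := by field_simp
  have e1 := herr p hq hqL
  have e2 := herr p' hq' hqL'
  rw [hcross, abs_mul, abs_of_pos (by positivity)] at hone
  set D := ((p.1 : ℕ) : ℝ)
  set D' := ((p'.1 : ℕ) : ℝ)
  rcases le_or_gt (2 * D) D' with h2 | h2
  · calc min (1 / 2) (L / 8) * D' ≤ 1 / 2 * D' := by gcongr; exact min_le_left _ _
      _ ≤ _ := by linarith
  have e2' : |approxErr α p' - (D' ^ 2 * L)⁻¹| ≤ 2 * C / L ^ 2 / D ^ 4 := e2.trans (by gcongr)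
  have hdiff : |approxErr α p - approxErr α p'| ≤
      ((D ^ 2 * L)⁻¹ - (D' ^ 2 * L)⁻¹) + 4 * C / L ^ 2 / D ^ 4 := by
    have hmono : (D' ^ 2 * L)⁻¹ ≤ (D ^ 2 * L)⁻¹ := by gcongr
    have : 4 * C / L ^ 2 / D ^ 4 = 2 * C / L ^ 2 / D ^ 4 + 2 * C / L ^ 2 / D ^ 4 := by ring
    rw [abs_le] at e1 e2' ⊢
    constructor <;> linarith [e1.1, e1.2, e2'.1, e2'.2]
  -- Distinct fractions satisfy `1 ≤ D D' |x - x'|`, while each error is `1/(D² L)` up to `O(D⁻⁴)`.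
  -- The lower bound `hbig` on `D`, with `D' < 2 D`, makes the total correction at most `1/2`.
  have h3 : 1 ≤ (D' ^ 2 - D ^ 2) / (L * D * D') + 1 / 2 := by
    calc (1 : ℝ) ≤ D * D' * |approxErr α p - approxErr α p'| := hone
      _ ≤ D * D' * (((D ^ 2 * L)⁻¹ - (D' ^ 2 * L)⁻¹) + 4 * C / L ^ 2 / D ^ 4) := by gcongr
      _ = (D' ^ 2 - D ^ 2) / (L * D * D') + D * D' * (4 * C / L ^ 2) / D ^ 4 := by field_simp
      _ ≤ (D' ^ 2 - D ^ 2) / (L * D * D') + D * (2 * D) * (4 * C / L ^ 2) / D ^ 4 := by gcongr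
      _ = (D' ^ 2 - D ^ 2) / (L * D * D') + (16 * C / L ^ 2) / D ^ 2 / 2 := by field_simp; ring
      _ ≤ _ := by
        have : (16 * C / L ^ 2) / D ^ 2 ≤ 1 := by rw [div_le_one (by positivity)]; exact hbig
        linarith
  have h4 : L * D * D' ≤ 2 * (D' ^ 2 - D ^ 2) := by
    have : 1 / 2 ≤ (D' ^ 2 - D ^ 2) / (L * D * D') := by linarith
    rw [le_div_iff₀ (by positivity)] at this
    linarith
  have h5 : L * D ≤ 4 * (D' - D) := by
    have : L * D * D' ≤ 4 * (D' - D) * D' := by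
      nlinarith [mul_nonneg (sub_nonneg.2 hle') (sub_nonneg.2 hle')]
    exact le_of_mul_le_mul_right this hD'
  calc min (1 / 2) (L / 8) * D' ≤ L / 8 * D' := by gcongr; exact min_le_right _ _
    _ ≤ _ := by nlinarith

/-- The product of form and quotient is `β + a x`, close to `β`. So on pairs with quotient at least
`L / 2` the form takes, for large denominators, only finitely many positive integer values, and `m`
is the least one taken infinitely often. -/
theorem IsQuadraticIrrational.exists_minimal_value {α : ℝ} (hα : IsQuadraticIrrational α)
    {a b c : ℤ} (h0 : (a : ℝ) * α ^ 2 + b * α + c = 0) (hβ : 0 < 2 * a * α + b)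
    (hf : ∀ p, binForm a b c p ≠ 0) :
    ∃ m : ℕ, 0 < m ∧ {p | approxLim α / 2 ≤ approxQuot α p ∧ binForm a b c p = m}.Infinite ∧
      ∀ᶠ p in cofinite, approxLim α / 2 ≤ approxQuot α p → (m : ℤ) ≤ binForm a b c p := by
  have hL := hα.approxLim_pos
  set L := approxLim α
  set β := 2 * a * α + b
  have hval : ∀ p, L / 2 ≤ approxQuot α p →
      binForm a b c p * approxQuot α p = β + a * approxErr α p := by
    intro p hp
    have hx := approxErr_of_le_approxQuot (half_pos hL) hp
    have hD := pnat_pos p.1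
    rw [binForm_eq h0, approxQuot_eq]
    have := hx.1
    field_simp
    rfl
  -- Beyond `D0` the correction `a x` is at most `β / 2`, whence the form lies between `1` and
  -- `(3β/2)/(L/2) = 3β/L`.
  obtain ⟨D0, hD0⟩ := exists_nat_gt (2 * |(a : ℝ)| * (L / 2)⁻¹ / β)
  have hbound : ∀ p : ℕ+ × ℤ, L / 2 ≤ approxQuot α p → D0 ≤ (p.1 : ℕ) →
      1 ≤ binForm a b c p ∧ binForm a b c p ≤ ⌊3 * β / L⌋₊ := by
    intro p hp hD
    have hx := approxErr_of_le_approxQuot (half_pos hL) hp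
    have hD1 := one_le_pnat p.1
    have hq : 0 < approxQuot α p := (half_pos hL).trans_le hp
    have hax : |a * approxErr α p| ≤ β / 2 := by
      rw [abs_mul, abs_of_pos hx.1]
      have h1 : 2 * |(a : ℝ)| * (L / 2)⁻¹ ≤ ((p.1 : ℕ) : ℝ) * β := by
        rw [div_lt_iff₀ hβ] at hD0
        have : (D0 : ℝ) ≤ (p.1 : ℕ) := by exact_mod_cast hD
        nlinarith
      calc |(a : ℝ)| * approxErr α p ≤ |(a : ℝ)| * ((L / 2)⁻¹ / ((p.1 : ℕ) : ℝ) ^ 2) := by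
            gcongr; exact hx.2.1
        _ = (2 * |(a : ℝ)| * (L / 2)⁻¹) / ((p.1 : ℕ) : ℝ) ^ 2 / 2 := by ring
        _ ≤ (((p.1 : ℕ) : ℝ) * β) / ((p.1 : ℕ) : ℝ) / 2 := by
            gcongr
            exact le_self_pow₀ hD1 two_ne_zero
        _ = β / 2 := by field_simp
    have hv := hval p hp
    have hax' := abs_le.1 hax
    constructor
    · have : (0 : ℝ) < binForm a b c p := by
        by_contra hcon
        push Not at hcon
        nlinarith
      have : 0 < binForm a b c p := by exact_mod_cast this
      omega
    · rw [Int.natCast_floor_eq_floor (by positivity), Int.le_floor, le_div_iff₀ hL]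
      have hfpos : (0 : ℝ) < binForm a b c p := by
        by_contra hcon
        push Not at hcon
        nlinarith
      nlinarith
  set A : Set (ℕ+ × ℤ) := {p | L / 2 ≤ approxQuot α p ∧ D0 ≤ (p.1 : ℕ)} with hA
  have hAinf : A.Infinite := by
    intro hfin
    refine hα.infinite_half_approxLim_le ((hfin.union (finite_le_approxQuot α (half_pos hL) D0)).subset
      fun p hp => ?_)
    rcases le_total D0 (p.1 : ℕ) with h | h
    · exact Or.inl ⟨hp, h⟩
    · exact Or.inr ⟨hp, h⟩
  have hex : ∃ m : ℕ, {p | L / 2 ≤ approxQuot α p ∧ binForm a b c p = m}.Infinite := by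
    by_contra hcon
    push Not at hcon
    refine hAinf (((Set.finite_Iic ⌊3 * β / L⌋₊).biUnion fun m _ => hcon m).subset fun p hp => ?_)
    have hb := hbound p hp.1 hp.2
    simp only [Set.mem_iUnion, Set.mem_Iic, Set.mem_ofPred_eq, exists_prop]
    refine ⟨(binForm a b c p).toNat, by omega, hp.1, by omega⟩
  classical
  refine ⟨Nat.find hex, ?_, Nat.find_spec hex, ?_⟩
  · rw [Nat.pos_iff_ne_zero]
    intro h
    have := Nat.find_spec hex
    rw [h] at this
    obtain ⟨p, hp⟩ := this.nonempty
    exact hf p (by exact_mod_cast hp.2)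
  · rw [eventually_cofinite]
    refine ((finite_le_approxQuot α (half_pos hL) D0).union
      ((Set.finite_Iio (Nat.find hex)).biUnion (t := fun m =>
        {p | L / 2 ≤ approxQuot α p ∧ binForm a b c p = m})
        fun m hm => Set.not_infinite.1 (Nat.find_min hex hm))).subset fun p hp => ?_
    simp only [Set.mem_ofPred_eq, Classical.not_imp, not_le] at hp
    rcases le_total D0 (p.1 : ℕ) with h | h
    · right
      have hb := hbound p hp.1 h
      simp only [Set.mem_iUnion, Set.mem_Iio, Set.mem_ofPred_eq, exists_prop]
      exact ⟨(binForm a b c p).toNat, by omega, hp.1, by omega⟩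
    · exact Or.inl ⟨hp.1, h⟩

/-- The extremal approximations of a quadratic irrational from above. -/
theorem IsQuadraticIrrational.exists_extremal_set {α : ℝ} (hα : IsQuadraticIrrational α) :
    ∃ (S : Set (ℕ+ × ℤ)) (C θ c : ℝ), S.Infinite ∧ 0 ≤ C ∧ 0 < θ ∧ θ < 1 ∧ 0 < c ∧
      (∀ p ∈ S, approxLim α / 2 ≤ approxQuot α p ∧
        |approxQuot α p - approxLim α| ≤ C / ((p.1 : ℕ) : ℝ) ^ 2) ∧
      (∀ᶠ p in cofinite, p ∉ S → approxQuot α p ≤ θ * approxLim α) ∧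
      ∀ p ∈ S, ∀ p' ∈ S, p ≠ p' →
        c * ((p.1 : ℕ) : ℝ) ≤ |((p.1 : ℕ) : ℝ) - ((p'.1 : ℕ) : ℝ)| := by
  obtain ⟨a, b, c, h0, hβ, hf⟩ := hα.exists_form
  have hL := hα.approxLim_pos
  obtain ⟨m, hm, hinf, hmin⟩ := hα.exists_minimal_value h0 hβ hf
  set L := approxLim α with hLdef
  set β := 2 * a * α + b
  have hmr : (1 : ℝ) ≤ m := by exact_mod_cast hm
  set C := |(a : ℝ)| * (L / 2)⁻¹ with hC
  have hC0 : 0 ≤ C := by positivity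
  have hval : ∀ p, L / 2 ≤ approxQuot α p → ∀ n : ℝ, 1 ≤ n → (n : ℝ) ≤ binForm a b c p →
      |approxQuot α p - β / binForm a b c p| ≤ C / ((p.1 : ℕ) : ℝ) ^ 2 := by
    intro p hp n hn hnf
    have hx := approxErr_of_le_approxQuot (half_pos hL) hp
    have hD := pnat_pos p.1
    have hf1 : (1 : ℝ) ≤ binForm a b c p := hn.trans hnf
    have hv : approxQuot α p - β / binForm a b c p = a * approxErr α p / binForm a b c p := by
      have : binForm a b c p * approxQuot α p = β + a * approxErr α p := by
        rw [binForm_eq h0, approxQuot_eq]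
        have := hx.1
        field_simp
        rfl
      field_simp
      linarith
    rw [hv, abs_div, abs_mul, abs_of_pos hx.1, abs_of_pos (by linarith : (0 : ℝ) < binForm a b c p)]
    calc |(a : ℝ)| * approxErr α p / binForm a b c p ≤ |(a : ℝ)| * approxErr α p :=
          div_le_self (by have := hx.1; positivity) hf1
      _ ≤ |(a : ℝ)| * ((L / 2)⁻¹ / ((p.1 : ℕ) : ℝ) ^ 2) := by gcongr; exact hx.2.1
      _ = _ := by rw [hC]; ring
  have hlarge : ∀ ε : ℝ, 0 < ε → ∀ᶠ p : ℕ+ × ℤ in cofinite,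
      L / 2 ≤ approxQuot α p → C / ((p.1 : ℕ) : ℝ) ^ 2 ≤ ε := by
    intro ε hε
    obtain ⟨n, hn⟩ := exists_nat_gt (C / ε)
    rw [eventually_cofinite]
    refine (finite_le_approxQuot α (half_pos hL) n).subset fun p hp => ?_
    simp only [Set.mem_ofPred_eq, Classical.not_imp, not_le] at hp
    refine ⟨hp.1, ?_⟩
    by_contra hcon
    push Not at hcon
    have hD := one_le_pnat p.1
    have h1 : (n : ℝ) ≤ (p.1 : ℕ) := by exact_mod_cast hcon.le
    have h2 := hp.2
    rw [lt_div_iff₀ (by positivity)] at h2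
    rw [div_lt_iff₀ hε] at hn
    have h3 : (p.1 : ℕ) ≤ ((p.1 : ℕ) : ℝ) ^ 2 := le_self_pow₀ hD two_ne_zero
    nlinarith
  -- Eventually the form is at least `m` on good pairs, so quotients do not exceed `β / m`
  -- asymptotically; the infinite level `m` attains this limit.
  have hLe : L = β / m := by
    apply le_antisymm
    · refine le_of_forall_pos_le_add fun ε hε => ?_
      have hev : ∀ᶠ p in cofinite, approxQuot α p ≤ max (L / 2) (β / m + ε) := by
        filter_upwards [hmin, hlarge ε hε] with p h1 h2
        by_cases hp : L / 2 ≤ approxQuot α p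
        · refine le_max_of_le_right ?_
          have h3 : (m : ℝ) ≤ binForm a b c p := by exact_mod_cast h1 hp
          have h4 := (abs_le.1 (hval p hp m hmr h3)).2
          have h5 : β / binForm a b c p ≤ β / m := by gcongr
          linarith [h2 hp]
        · exact le_max_of_le_left (not_le.1 hp).le
      have := limsup_le_of_le hα.isCoboundedUnder hev
      rcases le_max_iff.1 this with h | h
      · exact absurd h (not_le.2 (half_lt_self hL))
      · exact h
    · refine le_of_forall_sub_le fun ε hε => ?_
      refine le_limsup_of_frequently_le ?_ hα.isBoundedUnder
      have := (frequently_cofinite_iff_infinite.2 hinf).and_eventually (hlarge ε hε)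
      refine this.mono fun p hp => ?_
      have h3 : ((binForm a b c p : ℤ) : ℝ) = m := by exact_mod_cast hp.1.2
      have h4 := (abs_le.1 (hval p hp.1.1 m hmr h3.ge)).1
      rw [h3] at h4
      linarith [hp.2 hp.1.1]
  obtain ⟨D2, hD2⟩ := exists_nat_gt (16 * C / L ^ 2)
  set S : Set (ℕ+ × ℤ) := {p | (L / 2 ≤ approxQuot α p ∧ binForm a b c p = m) ∧ D2 ≤ (p.1 : ℕ)}
    with hS
  have hSval : ∀ p ∈ S, |approxQuot α p - L| ≤ C / ((p.1 : ℕ) : ℝ) ^ 2 := by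
    rintro p ⟨⟨hp, hp'⟩, -⟩
    have h3 : ((binForm a b c p : ℤ) : ℝ) = m := by exact_mod_cast hp'
    have := hval p hp m hmr h3.ge
    rwa [h3, ← hLe] at this
  -- The level after `m` gives quotients close to `β/(m+1) = (m/(m+1)) L`; `θ` is the midpoint of
  -- `m/(m+1)` and `1`, so that half of the gap absorbs the error term. The separation constant
  -- comes from `separation_of_form_eq`.
  refine ⟨S, C, (2 * m + 1) / (2 * m + 2), min (1 / 2) (L / 8), ?_, hC0, by positivity, ?_,
    by positivity, fun p hp => ⟨hp.1.1, hSval p hp⟩, ?_, ?_⟩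
  · intro hfin
    refine hinf ((hfin.union (finite_le_approxQuot α (half_pos hL) D2)).subset fun p hp => ?_)
    rcases le_total D2 (p.1 : ℕ) with h | h
    · exact Or.inl ⟨hp, h⟩
    · exact Or.inr ⟨hp.1, h⟩
  · rw [div_lt_one (by positivity)]; linarith
  · have hε : 0 < β / (2 * m * (m + 1)) := by positivity
    have hfin := finite_le_approxQuot α (half_pos hL) D2
    filter_upwards [hmin, hlarge _ hε, hfin.eventually_cofinite_notMem] with p h1 h2 h3 hpS
    by_cases hp : L / 2 ≤ approxQuot α p
    · have hD : D2 ≤ (p.1 : ℕ) := by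
        by_contra hcon
        exact h3 ⟨hp, (not_le.1 hcon).le⟩
      have h4 : binForm a b c p ≠ m := fun h => hpS ⟨⟨hp, h⟩, hD⟩
      have h5 : (m : ℤ) + 1 ≤ binForm a b c p := by have := h1 hp; omega
      have h5' : (m : ℝ) + 1 ≤ binForm a b c p := by exact_mod_cast h5
      have h6 := (abs_le.1 (hval p hp (m + 1) (by linarith) h5')).2
      have h7 : β / binForm a b c p ≤ β / (m + 1) := by gcongr
      have h8 : (2 * m + 1) / (2 * m + 2) * L = β / (m + 1) + β / (2 * m * (m + 1)) := by
        rw [hLe]; field_simp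
      rw [h8]
      linarith [h2 hp]
    · refine (not_le.1 hp).le.trans ?_
      rw [div_eq_inv_mul]
      gcongr
      rw [inv_eq_one_div, div_le_div_iff₀ (by norm_num) (by positivity)]
      linarith
  · have key : ∀ p ∈ S, ∀ p' ∈ S, p ≠ p' → (p.1 : ℕ) ≤ (p'.1 : ℕ) →
        min (1 / 2) (L / 8) * ((p'.1 : ℕ) : ℝ) ≤ ((p'.1 : ℕ) : ℝ) - ((p.1 : ℕ) : ℝ) := by
      intro p hp p' hp' hne hle
      refine separation_of_form_eq (m := m) hL hC0 h0 (by exact_mod_cast hm.ne') hne hp.1.2 hp'.1.2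
        hp.1.1 hp'.1.1 (hSval p hp) (hSval p' hp') hle ?_
      have h1 : (D2 : ℝ) ≤ (p.1 : ℕ) := by exact_mod_cast hp.2
      have h3 : (p.1 : ℕ) ≤ ((p.1 : ℕ) : ℝ) ^ 2 := le_self_pow₀ (one_le_pnat p.1) two_ne_zero
      linarith
    intro p hp p' hp' hne
    rcases le_total (p.1 : ℕ) (p'.1 : ℕ) with h | h
    · have := key p hp p' hp' hne h
      have hle : ((p.1 : ℕ) : ℝ) ≤ ((p'.1 : ℕ) : ℝ) := by exact_mod_cast h
      rw [abs_sub_comm]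
      refine le_trans ?_ (le_abs_self _)
      refine le_trans ?_ this
      gcongr
    · exact (key p' hp' p hp hne.symm h).trans (le_abs_self _)

/-! ### Roots of unity and partial fractions -/

/-- Indices for the pairs `(n, Λ)` with `n ≥ 1` and `Λ ^ n = 1`. -/
abbrev Idx := Σ n : ℕ, Fin (n + 1)

/-- The exponent `n ≥ 1` of an index. -/
def Idx.den (i : Idx) : ℕ := i.1 + 1

/-- The root of unity of an index. -/
def Idx.root (i : Idx) : ℂ := Complex.exp (2 * Real.pi * Complex.I * ((i.2 : ℕ) / (i.1 + 1)))

/-- The rational approximation of `α`, at distance at most `1 / 2`, of an index. -/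
def Idx.toPair (α : ℝ) (i : Idx) : ℕ+ × ℤ :=
  (i.1.succPNat, (i.2 : ℕ) - (i.1 + 1) * round (((i.2 : ℕ) : ℝ) / (i.1 + 1) - α))

/-- The angle from `α` to the root of unity of an index. -/
def Idx.err (α : ℝ) (i : Idx) : ℝ := approxErr α (i.toPair α)

theorem Idx.den_pos (i : Idx) : 0 < i.den := Nat.succ_pos _

theorem Idx.one_le_den (i : Idx) : (1 : ℝ) ≤ i.den := by exact_mod_cast i.den_pos

theorem Idx.toPair_fst (α : ℝ) (i : Idx) : ((i.toPair α).1 : ℕ) = i.den := rfl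

theorem Idx.err_eq (α : ℝ) (i : Idx) :
    i.err α = (((i.2 : ℕ) : ℝ) / (i.1 + 1) - α) -
      round (((i.2 : ℕ) : ℝ) / (i.1 + 1) - α) := by
  have : (i.1 : ℝ) + 1 ≠ 0 := by positivity
  simp only [Idx.err, approxErr, Idx.toPair, Nat.succPNat_coe]
  push_cast
  field_simp
  ring

theorem Idx.abs_err_le (α : ℝ) (i : Idx) : |i.err α| ≤ 1 / 2 := by
  rw [i.err_eq]
  exact abs_sub_round _

theorem Idx.err_ne_zero {α : ℝ} (hα : Irrational α) (i : Idx) : i.err α ≠ 0 :=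
  approxErr_ne_zero hα _

/-- Rounding only subtracts a multiple of the denominator, so the numerator is recovered as a
residue. -/
theorem Idx.toPair_injective (α : ℝ) : Function.Injective (Idx.toPair α) := by
  rintro ⟨n, k⟩ ⟨n', k'⟩ h
  simp only [Idx.toPair, Prod.mk.injEq] at h
  obtain ⟨h1, h2⟩ := h
  have hn : n = n' := Nat.succPNat_injective h1
  subst hn
  congr 1
  ext
  have h3 := congrArg (· % ((n : ℤ) + 1)) h2
  simp only [Int.sub_mul_emod_self_left] at h3
  rw [Int.emod_eq_of_lt (by positivity) (by have := k.2; omega),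
    Int.emod_eq_of_lt (by positivity) (by have := k'.2; omega)] at h3
  exact_mod_cast h3

/-- Reduce `N` modulo `D`: an error below `1/2` makes the rounding restore exactly the multiple that
was removed. Fractions need not be in lowest terms, in accordance with the index set, where a root
of unity occurs once for every multiple of its order. -/
theorem Idx.exists_toPair_eq {α : ℝ} {p : ℕ+ × ℤ} (hp : |approxErr α p| < 1 / 2) :
    ∃ i : Idx, i.toPair α = p := by
  obtain ⟨D, N⟩ := p
  obtain ⟨n, rfl⟩ : ∃ n : ℕ, D = n.succPNat := ⟨D.natPred, (PNat.succPNat_natPred D).symm⟩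
  have hpos : (0 : ℤ) < n + 1 := by positivity
  have hk0 := Int.emod_nonneg N hpos.ne'
  have hk1 := Int.emod_lt_of_pos N hpos
  refine ⟨⟨n, ⟨(N % (n + 1)).toNat, by omega⟩⟩, ?_⟩
  simp only [Idx.toPair]
  congr 1
  have hk : ((N % (n + 1)).toNat : ℤ) = N % (n + 1) := Int.toNat_of_nonneg hk0
  have hN : (N : ℝ) = (n + 1) * ((N / (n + 1) : ℤ) : ℝ) + (N % (n + 1) : ℤ) := by
    have := Int.mul_ediv_add_emod N (n + 1)
    exact_mod_cast this.symm
  have hround : round (((N % (n + 1)).toNat : ℝ) / (n + 1) - α) = -(N / (n + 1)) := by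
    have e : (((N % (n + 1)).toNat : ℝ) / (n + 1) - α) =
        approxErr α (n.succPNat, N) - (N / (n + 1) : ℤ) := by
      have h1 : ((N % (n + 1)).toNat : ℝ) = ((N % (n + 1) : ℤ) : ℝ) := by exact_mod_cast hk
      have h2 : (n : ℝ) + 1 ≠ 0 := by positivity
      rw [h1]
      simp only [approxErr, Nat.succPNat_coe]
      rw [hN]
      push_cast
      field_simp
      ring
    have h0 : round (approxErr α (n.succPNat, N)) = 0 := by
      rw [round_eq_zero_iff]
      have := abs_lt.1 hp
      exact ⟨this.1.le, this.2⟩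
    rw [e, round_sub_intCast, h0, zero_sub]
  rw [hround, hk]
  have := Int.mul_ediv_add_emod N (n + 1)
  linarith

/-! ### Distances from roots of unity to the point `circlePt α` -/

theorem norm_circlePt (α : ℝ) : ‖circlePt α‖ = 1 := by
  rw [circlePt, show (2 * Real.pi * Complex.I * α : ℂ) = ((2 * Real.pi * α : ℝ) : ℂ) * Complex.I by
    push_cast; ring, Complex.norm_exp_ofReal_mul_I]

theorem circlePt_ne_zero (α : ℝ) : circlePt α ≠ 0 := Complex.exp_ne_zero _

theorem Idx.norm_root (i : Idx) : ‖i.root‖ = 1 := by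
  rw [Idx.root, show (2 * Real.pi * Complex.I * ((i.2 : ℕ) / (i.1 + 1)) : ℂ) =
    ((2 * Real.pi * ((i.2 : ℕ) / (i.1 + 1)) : ℝ) : ℂ) * Complex.I by
    push_cast; ring, Complex.norm_exp_ofReal_mul_I]

theorem Idx.root_eq (α : ℝ) (i : Idx) :
    i.root = circlePt α * Complex.exp (2 * Real.pi * Complex.I * i.err α) := by
  rw [circlePt, ← Complex.exp_add, Idx.root, Complex.exp_eq_exp_iff_exists_int]
  refine ⟨round (((i.2 : ℕ) : ℝ) / (i.1 + 1) - α), ?_⟩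
  rw [i.err_eq]
  push_cast
  ring

theorem Idx.norm_root_sub (α : ℝ) (i : Idx) :
    ‖i.root - circlePt α‖ = 2 * |Real.sin (Real.pi * i.err α)| := by
  rw [i.root_eq α, ← mul_sub_one, norm_mul, norm_circlePt, one_mul,
    show (2 * Real.pi * Complex.I * i.err α : ℂ) = Complex.I * ((2 * Real.pi * i.err α : ℝ) : ℂ) by
      push_cast; ring, Complex.norm_exp_I_mul_ofReal_sub_one, norm_mul, Real.norm_eq_abs,
    Real.norm_eq_abs, abs_two]
  congr 3
  ring

theorem two_mul_abs_le_abs_sin_pi_mul {x : ℝ} (hx : |x| ≤ 1 / 2) :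
    2 * |x| ≤ |Real.sin (Real.pi * x)| := by
  have h : |Real.pi * x| ≤ Real.pi / 2 := by
    rw [abs_mul, abs_of_pos Real.pi_pos]
    nlinarith [Real.pi_pos]
  have := Real.mul_abs_le_abs_sin h
  rw [abs_mul, abs_of_pos Real.pi_pos] at this
  calc 2 * |x| = 2 / Real.pi * (Real.pi * |x|) := by field_simp
    _ ≤ _ := this

theorem Idx.le_norm_root_sub (α : ℝ) (i : Idx) : 4 * |i.err α| ≤ ‖i.root - circlePt α‖ := by
  rw [i.norm_root_sub]
  linarith [two_mul_abs_le_abs_sin_pi_mul (i.abs_err_le α)]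

theorem Idx.norm_root_sub_le (α : ℝ) (i : Idx) :
    ‖i.root - circlePt α‖ ≤ 2 * Real.pi * |i.err α| := by
  rw [i.norm_root_sub, mul_assoc]
  have : |Real.sin (Real.pi * i.err α)| ≤ |Real.pi * i.err α| := Real.abs_sin_le_abs
  rw [abs_mul, abs_of_pos Real.pi_pos] at this
  linarith

theorem Idx.root_sub_ne_zero {α : ℝ} (hα : Irrational α) (i : Idx) :
    i.root - circlePt α ≠ 0 := by
  have h := i.le_norm_root_sub α
  have h2 := abs_pos.2 (i.err_ne_zero hα)
  exact norm_pos_iff.1 (by linarith)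

theorem IsQuadraticIrrational.exists_le_norm_root_sub {α : ℝ} (hα : IsQuadraticIrrational α) :
    ∃ C : ℝ, 1 ≤ C ∧ ∀ i : Idx, ‖i.root - circlePt α‖⁻¹ ≤ C * (i.den : ℝ) ^ 2 := by
  obtain ⟨C, hC, h⟩ := hα.exists_abs_approxQuot_le
  refine ⟨max C 1, le_max_right _ _, fun i => ?_⟩
  have h1 := h (i.toPair α)
  have hx := abs_pos.2 (i.err_ne_zero hα.1)
  have hD := i.one_le_den
  rw [approxQuot_eq, abs_inv, abs_mul, Idx.toPair_fst, mul_inv,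
    abs_of_pos (by positivity : (0 : ℝ) < (i.den : ℝ) ^ 2), inv_mul_le_iff₀ (by positivity)] at h1
  calc ‖i.root - circlePt α‖⁻¹ ≤ |i.err α|⁻¹ := by
        gcongr
        linarith [i.le_norm_root_sub α]
    _ ≤ (i.den : ℝ) ^ 2 * C := h1
    _ ≤ (i.den : ℝ) ^ 2 * max C 1 := by gcongr; exact le_max_left _ _
    _ = _ := mul_comm _ _

/-! ### Distances from tangent disks to the unit circle -/

theorem norm_sub_smul_sq {u v : ℂ} (hu : ‖u‖ = 1) (hv : ‖v‖ = 1) (s : ℝ) :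
    ‖u - (1 - s) * v‖ ^ 2 = s ^ 2 + (1 - s) * ‖u - v‖ ^ 2 := by
  have h1 : u.re ^ 2 + u.im ^ 2 = 1 := by
    have := Complex.sq_norm u
    rw [hu, Complex.normSq_apply] at this
    linarith
  have h2 : v.re ^ 2 + v.im ^ 2 = 1 := by
    have := Complex.sq_norm v
    rw [hv, Complex.normSq_apply] at this
    linarith
  rw [Complex.sq_norm, Complex.sq_norm, Complex.normSq_apply, Complex.normSq_apply]
  simp
  linear_combination s * h1 + (s ^ 2 - s) * h2

/-- With `A` the distance from `u` to the centre, `(A - |s|)(A + |s|) = (1 - s) ‖u - v‖²`; here `A +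
|s| ≤ 4` and `1 - s ≥ 1/2`. Positive `s` describes an inner tangent disk, negative `s` an outer one.
-/
theorem sq_norm_sub_le_of_mem_ball {u v q : ℂ} (hu : ‖u‖ = 1) (hv : ‖v‖ = 1) {s : ℝ}
    (hs : s ≤ 1 / 2) (hs' : -1 ≤ s) (hq : q ∈ ball ((1 - (s : ℂ)) * v) |s|) :
    ‖u - v‖ ^ 2 / 8 ≤ ‖q - u‖ := by
  have h1 : ‖u - (1 - s) * v‖ - |s| ≤ ‖q - u‖ := by
    have := norm_sub_le_norm_sub_add_norm_sub u q ((1 - (s : ℂ)) * v)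
    rw [mem_ball, dist_eq_norm] at hq
    rw [norm_sub_rev u q] at this
    linarith
  refine le_trans ?_ h1
  have h2 := norm_sub_smul_sq hu hv s
  set A := ‖u - (1 - s) * v‖
  have hA0 : 0 ≤ A := norm_nonneg _
  have hs2 : |s| ≤ 1 := abs_le.2 ⟨hs', by linarith⟩
  have hA : A ≤ 3 := by
    calc A ≤ ‖u‖ + ‖(1 - (s : ℂ)) * v‖ := norm_sub_le _ _
      _ ≤ 1 + 2 := by
        rw [hu, norm_mul, hv, mul_one]
        gcongr
        calc ‖1 - (s : ℂ)‖ ≤ ‖(1 : ℂ)‖ + ‖(s : ℂ)‖ := norm_sub_le _ _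
          _ ≤ _ := by rw [norm_one, Complex.norm_real, Real.norm_eq_abs]; linarith
      _ = 3 := by norm_num
  have h3 : (A - |s|) * (A + |s|) = (1 - s) * ‖u - v‖ ^ 2 := by
    have := sq_abs s
    nlinarith
  have h4 : 0 ≤ A - |s| := by
    by_contra hcon
    push Not at hcon
    have h5 : 0 ≤ (1 - s) * ‖u - v‖ ^ 2 := by
      have : 0 ≤ 1 - s := by linarith
      positivity
    have h6 : A ^ 2 < |s| ^ 2 := by nlinarith
    rw [sq_abs] at h6
    linarith
  nlinarith [sq_nonneg ‖u - v‖]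

/-- On each side there is a tangent disk whose distance to a point `u` of the unit circle is
bounded below by a multiple of `‖u - lam‖ ^ 2`. -/
theorem exists_tangentDisk (σ : Side) {lam : ℂ} (hlam : ‖lam‖ = 1) :
    ∃ Δ ∈ tangentDisks σ lam, IsOpen Δ ∧ (∀ q ∈ Δ, ‖q‖ ≠ 1) ∧
      ∀ q ∈ Δ, ∀ u : ℂ, ‖u‖ = 1 → ‖u - lam‖ ^ 2 / 8 ≤ ‖q - u‖ := by
  cases σ with
  | minus =>
    refine ⟨_, ⟨1 / 2, by norm_num, by norm_num, rfl⟩, isOpen_ball, fun q hq h => ?_,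
      fun q hq u hu => sq_norm_sub_le_of_mem_ball hu hlam (s := 1 / 2) (by norm_num) (by norm_num)
        (by rwa [abs_of_pos (by norm_num)])⟩
    rw [mem_ball, dist_eq_norm] at hq
    have h1 := norm_sub_norm_le q ((1 - ((1 / 2 : ℝ) : ℂ)) * lam)
    rw [norm_mul, hlam, h] at h1
    norm_num at h1 hq
    linarith
  | plus =>
    refine ⟨_, ⟨1, by norm_num, rfl⟩, isOpen_ball, fun q hq h => ?_,
      fun q hq u hu => sq_norm_sub_le_of_mem_ball hu hlam (s := -1) (by norm_num) (by norm_num)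
        (by rw [abs_neg, abs_one]; push_cast at hq ⊢; rwa [sub_neg_eq_add])⟩
    rw [mem_ball, dist_eq_norm, norm_sub_rev] at hq
    have h1 := norm_sub_norm_le ((1 + ((1 : ℝ) : ℂ)) * lam) q
    rw [norm_mul, hlam, h] at h1
    norm_num at h1 hq
    linarith

/-- Since `Λ^(n+1) = 1`, the quotient `(q^(n+1) - 1)/(q - Λ)` is a geometric sum in `q` and `Λ`.
After multiplication by `Λ` and summation over all roots, orthogonality kills every power of `q`
except the zeroth. -/
theorem inv_pow_sub_one_eq_sum {q : ℂ} (hq : ‖q‖ ≠ 1) (n : ℕ) :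
    (q ^ (n + 1) - 1)⁻¹ = ∑ k : Fin (n + 1),
      ((n + 1 : ℕ) : ℂ)⁻¹ * (Idx.root ⟨n, k⟩ * (q - Idx.root ⟨n, k⟩)⁻¹) := by
  set w : ℂ := Complex.exp (2 * Real.pi * Complex.I / ((n + 1 : ℕ) : ℂ)) with hw
  have hprim : IsPrimitiveRoot w (n + 1) := Complex.isPrimitiveRoot_exp (n + 1) (Nat.succ_ne_zero n)
  have hroot : ∀ k : Fin (n + 1), Idx.root ⟨n, k⟩ = w ^ (k : ℕ) := by
    intro k
    rw [hw, ← Complex.exp_nat_mul, Idx.root]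
    congr 1
    push_cast
    ring
  have hne : q ^ (n + 1) - 1 ≠ 0 := by
    intro h
    apply hq
    have h1 : ‖q‖ ^ (n + 1) = 1 := by
      rw [← norm_pow, sub_eq_zero.1 h, norm_one]
    exact (pow_eq_one_iff_of_nonneg (norm_nonneg q) (Nat.succ_ne_zero n)).1 h1
  have hsub : ∀ k : Fin (n + 1), q - Idx.root ⟨n, k⟩ ≠ 0 := by
    intro k h
    apply hq
    rw [sub_eq_zero.1 h, Idx.norm_root]
  have hterm : ∀ k : Fin (n + 1), Idx.root ⟨n, k⟩ * (q - Idx.root ⟨n, k⟩)⁻¹ =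
      (q ^ (n + 1) - 1)⁻¹ * ∑ j ∈ Finset.range (n + 1), q ^ j * (w ^ (n + 1 - j)) ^ (k : ℕ) := by
    intro k
    have h1 := Commute.geom_sum₂_mul (Commute.all q (Idx.root ⟨n, k⟩)) (n + 1)
    have h2 : Idx.root ⟨n, k⟩ ^ (n + 1) = 1 := by
      rw [hroot, ← pow_mul, mul_comm, pow_mul, hprim.pow_eq_one, one_pow]
    rw [h2] at h1
    have h3 : ∑ j ∈ Finset.range (n + 1), q ^ j * (w ^ (n + 1 - j)) ^ (k : ℕ) =
        Idx.root ⟨n, k⟩ * ∑ j ∈ Finset.range (n + 1), q ^ j * Idx.root ⟨n, k⟩ ^ (n + 1 - 1 - j) := by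
      rw [Finset.mul_sum]
      refine Finset.sum_congr rfl fun j hj => ?_
      rw [Finset.mem_range] at hj
      rw [hroot, ← pow_mul, mul_comm (n + 1 - j), pow_mul,
        show n + 1 - j = (n + 1 - 1 - j) + 1 by omega, pow_succ (w ^ (k : ℕ))]
      ring
    rw [mul_inv_eq_iff_eq_mul₀ (hsub k), h3, mul_assoc, mul_assoc, h1]
    field_simp
  simp_rw [hterm]
  rw [← Finset.mul_sum, ← Finset.mul_sum, Finset.sum_comm]
  have hin : ∀ j ∈ Finset.range (n + 1), ∑ k : Fin (n + 1), q ^ j * (w ^ (n + 1 - j)) ^ (k : ℕ) =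
      if j = 0 then ((n + 1 : ℕ) : ℂ) else 0 := by
    intro j hj
    rw [Finset.mem_range] at hj
    rw [← Finset.mul_sum, Fin.sum_univ_eq_sum_range (fun k => (w ^ (n + 1 - j)) ^ k)]
    split_ifs with h0
    · subst h0
      simp [hprim.pow_eq_one]
    · have hne1 : w ^ (n + 1 - j) ≠ 1 := hprim.pow_ne_one_of_pos_of_lt (by omega) (by omega)
      have : ∑ k ∈ Finset.range (n + 1), (w ^ (n + 1 - j)) ^ k = 0 := by
        rw [geom_sum_eq hne1, ← pow_mul, mul_comm, pow_mul, hprim.pow_eq_one]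
        simp
      rw [this, mul_zero]
  rw [Finset.sum_congr rfl hin]
  simp only [Finset.sum_ite_eq', Finset.mem_range, Nat.succ_pos, if_true]
  have : ((n + 1 : ℕ) : ℂ) ≠ 0 := by exact_mod_cast Nat.succ_ne_zero n
  field_simp

/-! ### Summation over the roots of unity -/

theorem hasSum_idx {u : ℕ → ℝ} (hu : ∀ n, 0 ≤ u n) (h : Summable fun n : ℕ => ((n + 1 : ℕ) : ℝ) * u n) :
    HasSum (fun i : Idx => u i.1) (∑' n : ℕ, ((n + 1 : ℕ) : ℝ) * u n) := by
  have hf : ∀ n : ℕ, HasSum (fun _ : Fin (n + 1) => u n) (((n + 1 : ℕ) : ℝ) * u n) := by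
    intro n
    have := hasSum_fintype (fun _ : Fin (n + 1) => u n)
    simpa using this
  have hs : Summable (fun i : Idx => u i.1) := by
    refine (summable_sigma_of_nonneg fun i => hu i.1).2 ⟨fun n => (hf n).summable, ?_⟩
    exact h.congr fun n => ((hf n).tsum_eq).symm
  have := hs.hasSum.sigma hf
  rw [this.tsum_eq]
  exact hs.hasSum

theorem pow_le_factorial_mul_exp {t x : ℝ} (ht : 0 < t) (hx : 0 ≤ x) (p : ℕ) :
    x ^ p ≤ p.factorial / t ^ p * Real.exp (t * x) := by
  have := Real.pow_div_factorial_le_exp (t * x) (by positivity) p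
  rw [div_le_iff₀ (by positivity), mul_pow] at this
  rw [div_mul_eq_mul_div, le_div_iff₀ (by positivity)]
  linarith

/-- The source of all factorial growth: the `n` roots of order dividing `n` raise the power of `n`
by one, and `n^(p+1) ≤ (p+1)! t^(-p-1) exp (t n)` with `exp t * r < 1`. -/
theorem summable_idx_pow_and_exists_tsum_le {r : ℝ} (hr0 : 0 < r) (hr1 : r < 1) :
    (∀ p : ℕ, Summable fun i : Idx => (i.den : ℝ) ^ p * r ^ i.den) ∧
    ∃ K t : ℝ, 0 < K ∧ 0 < t ∧ ∀ p : ℕ,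
      ∑' i : Idx, (i.den : ℝ) ^ p * r ^ i.den ≤ K * (p + 1).factorial / t ^ (p + 1) := by
  -- Half of the available decay: `exp t * r` is then `√r`.
  set t := Real.log (1 / r) / 2 with ht
  have ht0 : 0 < t := by
    have : 0 < Real.log (1 / r) := Real.log_pos (by rw [lt_div_iff₀ hr0]; linarith)
    positivity
  set s := Real.exp t * r with hs
  have hs0 : 0 < s := by positivity
  have hs1 : s < 1 := by
    have : Real.exp t < 1 / r := by
      rw [← Real.exp_log (by positivity : 0 < 1 / r), Real.exp_lt_exp]
      have : 0 < Real.log (1 / r) := Real.log_pos (by rw [lt_div_iff₀ hr0]; linarith)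
      linarith
    calc s < 1 / r * r := by rw [hs]; gcongr
      _ = 1 := by field_simp
  have hgeo : Summable fun n : ℕ => s ^ (n + 1) :=
    (summable_geometric_of_lt_one hs0.le hs1).comp_injective (add_left_injective 1)
  have hle : ∀ p n : ℕ, ((n + 1 : ℕ) : ℝ) * (((n + 1 : ℕ) : ℝ) ^ p * r ^ (n + 1)) ≤
      (p + 1).factorial / t ^ (p + 1) * s ^ (n + 1) := by
    intro p n
    have h1 := pow_le_factorial_mul_exp ht0 (by positivity : (0 : ℝ) ≤ ((n + 1 : ℕ) : ℝ)) (p + 1)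
    rw [mul_comm t, Real.exp_nat_mul] at h1
    calc ((n + 1 : ℕ) : ℝ) * (((n + 1 : ℕ) : ℝ) ^ p * r ^ (n + 1))
        = ((n + 1 : ℕ) : ℝ) ^ (p + 1) * r ^ (n + 1) := by ring
      _ ≤ ((p + 1).factorial / t ^ (p + 1) * Real.exp t ^ (n + 1)) * r ^ (n + 1) := by gcongr
      _ = _ := by rw [hs]; ring
  have hsum : ∀ p : ℕ, Summable fun n : ℕ =>
      ((n + 1 : ℕ) : ℝ) * (((n + 1 : ℕ) : ℝ) ^ p * r ^ (n + 1)) := fun p =>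
    Summable.of_nonneg_of_le (fun n => by positivity) (hle p) (hgeo.mul_left _)
  refine ⟨fun p => (hasSum_idx (u := fun n => ((n + 1 : ℕ) : ℝ) ^ p * r ^ (n + 1))
    (fun n => by positivity) (hsum p)).summable, (∑' n : ℕ, s ^ (n + 1)), t,
    hgeo.tsum_pos (fun n => by positivity) 0 (by positivity), ht0, fun p => ?_⟩
  have h := (hasSum_idx (u := fun n => ((n + 1 : ℕ) : ℝ) ^ p * r ^ (n + 1))
    (fun n => by positivity) (hsum p)).tsum_eq
  calc ∑' i : Idx, (i.den : ℝ) ^ p * r ^ i.den = _ := h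
    _ ≤ ∑' n : ℕ, (p + 1).factorial / t ^ (p + 1) * s ^ (n + 1) :=
        (hsum p).tsum_le_tsum (hle p) (hgeo.mul_left _)
    _ = _ := by rw [tsum_mul_left]; ring

theorem summable_idx_pow {r : ℝ} (hr0 : 0 < r) (hr1 : r < 1) (p : ℕ) :
    Summable fun i : Idx => (i.den : ℝ) ^ p * r ^ i.den :=
  (summable_idx_pow_and_exists_tsum_le hr0 hr1).1 p

/-! ### Uniqueness and size of asymptotic expansions -/

/-- The point at distance `t` from `lam` on the normal to the unit circle, on the given side. -/
def normalPt : Side → ℂ → ℝ → ℂ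
  | .minus, lam, t => (1 - (t : ℂ)) * lam
  | .plus, lam, t => (1 + (t : ℂ)) * lam

theorem norm_normalPt_sub (σ : Side) {lam : ℂ} (hlam : ‖lam‖ = 1) {t : ℝ} (ht : 0 < t) :
    ‖normalPt σ lam t - lam‖ = t := by
  cases σ with
  | minus =>
    rw [normalPt, show (1 - (t : ℂ)) * lam - lam = -((t : ℂ) * lam) by ring, norm_neg, norm_mul,
      hlam, mul_one, Complex.norm_real, Real.norm_of_nonneg ht.le]
  | plus =>
    rw [normalPt, show (1 + (t : ℂ)) * lam - lam = (t : ℂ) * lam by ring, norm_mul,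
      hlam, mul_one, Complex.norm_real, Real.norm_of_nonneg ht.le]

theorem eventually_normalPt_mem {σ : Side} {lam : ℂ} (hlam : ‖lam‖ = 1) {Δ : Set ℂ}
    (hΔ : Δ ∈ tangentDisks σ lam) : ∀ᶠ t in nhdsWithin (0 : ℝ) (Set.Ioi 0), normalPt σ lam t ∈ Δ := by
  cases σ with
  | minus =>
    obtain ⟨ρ, hρ, -, rfl⟩ := hΔ
    filter_upwards [Ioo_mem_nhdsGT hρ] with t ht
    rw [mem_ball, dist_eq_norm, normalPt,
      show (1 - (t : ℂ)) * lam - (1 - (ρ : ℂ)) * lam = ((ρ - t : ℝ) : ℂ) * lam by push_cast; ring,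
      norm_mul, hlam, mul_one, Complex.norm_real, Real.norm_of_nonneg (by linarith [ht.2])]
    linarith [ht.1]
  | plus =>
    obtain ⟨ρ, hρ, rfl⟩ := hΔ
    filter_upwards [Ioo_mem_nhdsGT hρ] with t ht
    rw [mem_ball, dist_eq_norm, normalPt, norm_sub_rev,
      show (1 + (ρ : ℂ)) * lam - (1 + (t : ℂ)) * lam = ((ρ - t : ℝ) : ℂ) * lam by push_cast; ring,
      norm_mul, hlam, mul_one, Complex.norm_real, Real.norm_of_nonneg (by linarith [ht.2])]
    linarith [ht.1]

theorem le_of_eventually_le_add_mul {x A K : ℝ}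
    (h : ∀ᶠ t in nhdsWithin (0 : ℝ) (Set.Ioi 0), x ≤ A + K * t) : x ≤ A := by
  have ht : Tendsto (fun t : ℝ => A + K * t) (nhdsWithin (0 : ℝ) (Set.Ioi 0)) (nhds (A + K * 0)) :=
    ((continuous_const.add (continuous_const.mul continuous_id)).tendsto 0).mono_left
      nhdsWithin_le_nhds
  rw [mul_zero, add_zero] at ht
  exact ge_of_tendsto ht h

section

variable {B : Type*} [NormedAddCommGroup B] [NormedSpace ℂ B]

/-- Approach `lam` along the normal, which eventually enters every tangent disk. Once the lower
coefficients agree, comparing the remainders of order `n + 1` and dividing by `t^n` leaves `O(t)`.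
The two control sequences may differ, which lets an arbitrary Carleman expansion be identified with
the Gevrey one. -/
theorem HasCarlemanExpansion.unique {σ : Side} {lam : ℂ} (hlam : ‖lam‖ = 1) {M M' : ℕ → ℝ}
    {f : ℂ → B} {a b : ℕ → B} (ha : HasCarlemanExpansion σ lam M f a)
    (hb : HasCarlemanExpansion σ lam M' f b) : a = b := by
  obtain ⟨Δ, hΔ, -, c₀, c₁, -, -, h⟩ := ha
  obtain ⟨Δ', hΔ', -, c₀', c₁', -, -, h'⟩ := hb
  funext n
  induction n using Nat.strong_induction_on with
  | _ n ih =>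
  rw [← sub_eq_zero, ← norm_le_zero_iff]
  refine le_of_eventually_le_add_mul
    (K := c₀ * c₁ ^ (n + 1) * M (n + 1) + c₀' * c₁' ^ (n + 1) * M' (n + 1)) ?_
  filter_upwards [eventually_normalPt_mem hlam hΔ, eventually_normalPt_mem hlam hΔ',
    self_mem_nhdsWithin] with t h1 h2 ht
  have ht : 0 < t := ht
  set q := normalPt σ lam t
  have hq : ‖q - lam‖ = t := norm_normalPt_sub σ hlam ht
  have e : (q - lam) ^ n • (a n - b n) =
      (f q - ∑ k ∈ Finset.range (n + 1), (q - lam) ^ k • b k) -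
      (f q - ∑ k ∈ Finset.range (n + 1), (q - lam) ^ k • a k) := by
    have hsum : ∑ k ∈ Finset.range n, (q - lam) ^ k • a k =
        ∑ k ∈ Finset.range n, (q - lam) ^ k • b k :=
      Finset.sum_congr rfl fun k hk => by rw [ih k (Finset.mem_range.1 hk)]
    rw [Finset.sum_range_succ, Finset.sum_range_succ, hsum, smul_sub]
    abel
  have hn : t ^ n * ‖a n - b n‖ ≤
      t ^ n * (0 + (c₀ * c₁ ^ (n + 1) * M (n + 1) + c₀' * c₁' ^ (n + 1) * M' (n + 1)) * t) := by
    calc t ^ n * ‖a n - b n‖ = ‖(q - lam) ^ n • (a n - b n)‖ := by rw [norm_smul, norm_pow, hq]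
      _ ≤ c₀' * c₁' ^ (n + 1) * M' (n + 1) * ‖q - lam‖ ^ (n + 1) +
          c₀ * c₁ ^ (n + 1) * M (n + 1) * ‖q - lam‖ ^ (n + 1) := by
        rw [e]
        exact (norm_sub_le _ _).trans (add_le_add (h' _ q h2) (h _ q h1))
      _ = _ := by rw [hq]; ring
  exact le_of_mul_le_mul_left hn (by positivity)

/-- The `n`th term is the difference of two consecutive remainders; after division by `t^n` the
later one contributes `O(t)`. -/
theorem HasCarlemanExpansion.exists_norm_le {σ : Side} {lam : ℂ} (hlam : ‖lam‖ = 1) {M : ℕ → ℝ}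
    {f : ℂ → B} {a : ℕ → B} (ha : HasCarlemanExpansion σ lam M f a) :
    ∃ c₀ c₁ : ℝ, 0 < c₀ ∧ 0 < c₁ ∧ ∀ n, ‖a n‖ ≤ c₀ * c₁ ^ n * M n := by
  obtain ⟨Δ, hΔ, -, c₀, c₁, h0, h1, h⟩ := ha
  refine ⟨c₀, c₁, h0, h1, fun n => ?_⟩
  refine le_of_eventually_le_add_mul (K := c₀ * c₁ ^ (n + 1) * M (n + 1)) ?_
  filter_upwards [eventually_normalPt_mem hlam hΔ, self_mem_nhdsWithin] with t h1 ht
  have ht : 0 < t := ht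
  set q := normalPt σ lam t
  have hq : ‖q - lam‖ = t := norm_normalPt_sub σ hlam ht
  have e : (q - lam) ^ n • a n =
      (f q - ∑ k ∈ Finset.range n, (q - lam) ^ k • a k) -
      (f q - ∑ k ∈ Finset.range (n + 1), (q - lam) ^ k • a k) := by
    rw [Finset.sum_range_succ]
    abel
  have hn : t ^ n * ‖a n‖ ≤ t ^ n * (c₀ * c₁ ^ n * M n + c₀ * c₁ ^ (n + 1) * M (n + 1) * t) := by
    calc t ^ n * ‖a n‖ = ‖(q - lam) ^ n • a n‖ := by rw [norm_smul, norm_pow, hq]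
      _ ≤ c₀ * c₁ ^ n * M n * ‖q - lam‖ ^ n +
          c₀ * c₁ ^ (n + 1) * M (n + 1) * ‖q - lam‖ ^ (n + 1) := by
        rw [e]
        exact (norm_sub_le _ _).trans (add_le_add (h _ q h1) (h _ q h1))
      _ = _ := by rw [hq]; ring
  exact le_of_mul_le_mul_left hn (by positivity)

end

/-! ### The asymptotic expansion of the fundamental solution -/

theorem norm_monomial_le {r : ℝ} (hr0 : 0 ≤ r) (n : ℕ) : ‖monomial r n‖ ≤ r ^ (n + 1) :=
  BoundedContinuousFunction.norm_ofNormedAddCommGroup_le _ (by positivity) fun z => by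
    rw [norm_pow]
    exact pow_le_pow_left₀ (norm_nonneg _) (mem_ball_zero_iff.1 z.2).le _

/-- The coefficient of a polar part in the asymptotic expansion. -/
def expCoeff (α : ℝ) (m : ℕ) (i : Idx) : ℂ :=
  -((i.den : ℂ)⁻¹ * (i.root * ((i.root - circlePt α) ^ (m + 1))⁻¹))

/-- The coefficients of the asymptotic expansion of `fdelta`. -/
def asympCoeff (α r : ℝ) (m : ℕ) : Br r := ∑' i : Idx, expCoeff α m i • monomial r i.1

theorem gevreySeq_two (n : ℕ) : gevreySeq 2 n = (2 * n).factorial := by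
  rw [gevreySeq, ← Real.Gamma_nat_eq_factorial]
  push_cast
  ring_nf

theorem factorial_add_le (a b : ℕ) :
    ((a + b).factorial : ℝ) ≤ 2 ^ (a + b) * a.factorial * b.factorial := by
  have h := Nat.add_choose_mul_factorial_mul_factorial a b
  have h2 := Nat.choose_le_two_pow (a + b) b
  rw [← h]
  push_cast
  gcongr
  exact_mod_cast h2

/-- A fixed shift `j` of the exponent only costs geometric factors, because `(a + b)! ≤ 2^(a+b) a!
b!`. -/
theorem exists_gevrey_bound {r : ℝ} (hr0 : 0 < r) (hr1 : r < 1) {C A : ℝ} (hC : 0 < C) (hA : 0 < A)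
    (j : ℕ) : ∃ c₀ c₁ : ℝ, 0 < c₀ ∧ 0 < c₁ ∧ ∀ N : ℕ,
      A * C ^ N * ∑' i : Idx, (i.den : ℝ) ^ (2 * N + j) * r ^ i.den ≤
        c₀ * c₁ ^ N * gevreySeq 2 N := by
  obtain ⟨K, t, hK, ht, h⟩ := (summable_idx_pow_and_exists_tsum_le hr0 hr1).2
  refine ⟨A * K * 2 ^ (j + 1) * (j + 1).factorial / t ^ (j + 1), 4 * C / t ^ 2, by positivity,
    by positivity, fun N => ?_⟩
  calc A * C ^ N * ∑' i : Idx, (i.den : ℝ) ^ (2 * N + j) * r ^ i.den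
      ≤ A * C ^ N * (K * (2 * N + (j + 1)).factorial / t ^ (2 * N + (j + 1))) := by
        gcongr
        exact h (2 * N + j)
    _ ≤ A * C ^ N * (K * (2 ^ (2 * N + (j + 1)) * (2 * N).factorial * (j + 1).factorial) /
          t ^ (2 * N + (j + 1))) := by
        gcongr
        exact factorial_add_le _ _
    _ = _ := by
        rw [gevreySeq_two, div_pow, mul_pow, pow_add 2 (2 * N), pow_add t (2 * N), pow_mul, pow_mul,
          show (2 : ℝ) ^ 2 = 4 by norm_num]
        field_simp

section

variable {α : ℝ} {r : ℝ}

theorem norm_expCoeff_smul_le (hr0 : 0 < r) {C : ℝ} (hC : 1 ≤ C)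
    (h : ∀ i : Idx, ‖i.root - circlePt α‖⁻¹ ≤ C * (i.den : ℝ) ^ 2) (m : ℕ) (i : Idx) :
    ‖expCoeff α m i • monomial r i.1‖ ≤
      C * C ^ m * ((i.den : ℝ) ^ (2 * m + 2) * r ^ i.den) := by
  have hD := i.one_le_den
  rw [norm_smul, expCoeff, norm_neg, norm_mul, norm_mul, i.norm_root, norm_inv, norm_inv,
    norm_pow, Complex.norm_natCast, one_mul, ← inv_pow]
  calc (i.den : ℝ)⁻¹ * ‖i.root - circlePt α‖⁻¹ ^ (m + 1) * ‖monomial r i.1‖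
      ≤ 1 * (C * (i.den : ℝ) ^ 2) ^ (m + 1) * r ^ i.den := by
        gcongr
        · exact inv_le_one_of_one_le₀ hD
        · exact h i
        · exact norm_monomial_le hr0.le _
    _ = _ := by ring

theorem IsQuadraticIrrational.summable_expCoeff_smul (hα : IsQuadraticIrrational α) (hr0 : 0 < r)
    (hr1 : r < 1) (m : ℕ) : Summable fun i : Idx => expCoeff α m i • monomial r i.1 := by
  obtain ⟨C, hC, h⟩ := hα.exists_le_norm_root_sub
  exact Summable.of_norm_bounded ((summable_idx_pow hr0 hr1 _).mul_left _)
    (norm_expCoeff_smul_le hr0 hC h m)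

theorem IsQuadraticIrrational.isFormalGevrey (hα : IsQuadraticIrrational α) (hr0 : 0 < r)
    (hr1 : r < 1) : IsFormalGevrey 2 (asympCoeff α r) := by
  obtain ⟨C, hC, h⟩ := hα.exists_le_norm_root_sub
  obtain ⟨c₀, c₁, h0, h1, hb⟩ := exists_gevrey_bound hr0 hr1 (C := C) (A := C) (by linarith)
    (by linarith) 2
  refine ⟨c₀, c₁, h0, h1, fun m => le_trans ?_ (hb m)⟩
  rw [asympCoeff, ← tsum_mul_left]
  exact tsum_of_norm_bounded ((summable_idx_pow hr0 hr1 _).mul_left _).hasSum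
    (norm_expCoeff_smul_le hr0 hC h m)

theorem hasSum_fdelta (hr0 : 0 < r) (hr1 : r < 1) {q : ℂ} (hq : ‖q‖ ≠ 1) :
    HasSum (fun i : Idx => ((i.den : ℂ)⁻¹ * (i.root * (q - i.root)⁻¹)) • monomial r i.1)
      (fdelta r q) := by
  have hc : 0 < |‖q‖ - 1| := abs_pos.2 (sub_ne_zero.2 hq)
  have hs : Summable fun i : Idx =>
      ((i.den : ℂ)⁻¹ * (i.root * (q - i.root)⁻¹)) • monomial r i.1 := by
    refine Summable.of_norm_bounded (g := fun i : Idx => |‖q‖ - 1|⁻¹ * ((i.den : ℝ) ^ 0 * r ^ i.den))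
      ((summable_idx_pow hr0 hr1 0).mul_left _) fun i => ?_
    have hD := i.one_le_den
    rw [norm_smul, norm_mul, norm_mul, i.norm_root, norm_inv, norm_inv, Complex.norm_natCast,
      one_mul, pow_zero, one_mul]
    calc (i.den : ℝ)⁻¹ * ‖q - i.root‖⁻¹ * ‖monomial r i.1‖
        ≤ 1 * |‖q‖ - 1|⁻¹ * r ^ i.den := by
          gcongr
          · exact inv_le_one_of_one_le₀ hD
          · have := abs_norm_sub_norm_le q i.root
            rwa [i.norm_root] at this
          · exact norm_monomial_le hr0.le _
      _ = _ := by ring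
  have hfib : ∀ n : ℕ, HasSum (fun k : Fin (n + 1) => (((Idx.den ⟨n, k⟩ : ℕ) : ℂ)⁻¹ *
      (Idx.root ⟨n, k⟩ * (q - Idx.root ⟨n, k⟩)⁻¹)) • monomial r n)
      ((q ^ (n + 1) - 1)⁻¹ • monomial r n) := by
    intro n
    rw [inv_pow_sub_one_eq_sum hq n, Finset.sum_smul]
    exact hasSum_fintype _
  have := hs.hasSum.sigma hfib
  rw [fdelta, this.tsum_eq]
  exact hs.hasSum

/-- Finite geometric expansion, with exact remainder, of a single pole; here `u = q - λ` and `v = Λ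
- λ`. -/
theorem remainder_term (u v : ℂ) (hv : v ≠ 0) (huv : u - v ≠ 0) (N : ℕ) :
    (u - v)⁻¹ - ∑ n ∈ Finset.range N, u ^ n * -(v ^ (n + 1))⁻¹ = u ^ N * ((v ^ N)⁻¹ * (u - v)⁻¹) := by
  induction N with
  | zero => simp
  | succ N ih =>
    rw [Finset.sum_range_succ, ← sub_sub, ih]
    field_simp
    ring

theorem IsQuadraticIrrational.hasSum_remainder (hα : IsQuadraticIrrational α) (hr0 : 0 < r)
    (hr1 : r < 1) {q : ℂ} (hq : ‖q‖ ≠ 1) (N : ℕ) :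
    HasSum (fun i : Idx => ((q - circlePt α) ^ N * ((i.den : ℂ)⁻¹ * (i.root *
        (((i.root - circlePt α) ^ N)⁻¹ * (q - i.root)⁻¹)))) • monomial r i.1)
      (fdelta r q - ∑ n ∈ Finset.range N, (q - circlePt α) ^ n • asympCoeff α r n) := by
  have h := (hasSum_fdelta hr0 hr1 hq).sub (hasSum_sum (s := Finset.range N) fun n _ =>
    ((hα.summable_expCoeff_smul hr0 hr1 n).hasSum.const_smul ((q - circlePt α) ^ n)))
  refine (congrArg (fun u => HasSum u _) (funext fun i => ?_)).mp h
  have hv := i.root_sub_ne_zero hα.1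
  have huv : (q - circlePt α) - (i.root - circlePt α) ≠ 0 := by
    rw [sub_sub_sub_cancel_right]
    intro hz
    apply hq
    rw [sub_eq_zero.1 hz, i.norm_root]
  have key := remainder_term _ _ hv huv N
  rw [sub_sub_sub_cancel_right] at key
  simp only [expCoeff, smul_smul]
  rw [← Finset.sum_smul]
  refine (sub_smul _ _ _).symm.trans (congrArg (· • monomial r i.1) ?_)
  rw [show (q - circlePt α) ^ N * ((i.den : ℂ)⁻¹ * (i.root *
    (((i.root - circlePt α) ^ N)⁻¹ * (q - i.root)⁻¹))) = (i.den : ℂ)⁻¹ * i.root *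
    ((q - circlePt α) ^ N * (((i.root - circlePt α) ^ N)⁻¹ * (q - i.root)⁻¹)) by ring, ← key,
    mul_sub, Finset.mul_sum, mul_assoc]
  congr 1
  refine Finset.sum_congr rfl fun n _ => ?_
  ring

theorem IsQuadraticIrrational.hasCarlemanExpansion (hα : IsQuadraticIrrational α) (hr0 : 0 < r)
    (hr1 : r < 1) (σ : Side) :
    HasCarlemanExpansion σ (circlePt α) (gevreySeq 2) (fdelta r) (asympCoeff α r) := by
  obtain ⟨C, hC, h⟩ := hα.exists_le_norm_root_sub
  obtain ⟨Δ, hΔ, hopen, hΔ1, hdist⟩ := exists_tangentDisk σ (norm_circlePt α)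
  obtain ⟨c₀, c₁, h0, h1, hb⟩ := exists_gevrey_bound hr0 hr1 (C := C) (A := 8 * C ^ 2) (by linarith)
    (by positivity) 4
  -- Tangency squares the distance `|Λ - λ|`, so the bound `n²` becomes `n⁴`, uniformly in the disk.
  -- This fixes the shift `4` in `exists_gevrey_bound`, independent of the order `N`.
  have hinv : ∀ q ∈ Δ, ∀ i : Idx, ‖q - i.root‖⁻¹ ≤ 8 * C ^ 2 * (i.den : ℝ) ^ 4 := by
    intro q hq i
    have h2 := hdist q hq i.root i.norm_root
    have h3 := norm_pos_iff.2 (i.root_sub_ne_zero hα.1)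
    calc ‖q - i.root‖⁻¹ ≤ (‖i.root - circlePt α‖ ^ 2 / 8)⁻¹ := by gcongr
      _ = 8 * (‖i.root - circlePt α‖⁻¹) ^ 2 := by field_simp
      _ ≤ 8 * (C * (i.den : ℝ) ^ 2) ^ 2 := by gcongr; exact h i
      _ = _ := by ring
  refine ⟨Δ, hΔ, ?_, c₀, c₁, h0, h1, fun N q hq => ?_⟩
  · have hd := Complex.differentiableOn_tsum_of_summable_norm
      (F := fun (i : Idx) (q : ℂ) => ((i.den : ℂ)⁻¹ * (i.root * (q - i.root)⁻¹)) • monomial r i.1)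
      ((summable_idx_pow hr0 hr1 4).mul_left (8 * C ^ 2)) (U := Δ) ?_ hopen ?_
    · refine hd.congr fun q hq => ?_
      exact (hasSum_fdelta hr0 hr1 (hΔ1 q hq)).tsum_eq.symm
    · intro i
      have hne : ∀ q ∈ Δ, q - i.root ≠ 0 := by
        intro q hq hz
        apply hΔ1 q hq
        rw [sub_eq_zero.1 hz, i.norm_root]
      refine DifferentiableOn.smul_const ?_ _
      refine DifferentiableOn.const_mul (DifferentiableOn.const_mul ?_ _) _
      exact DifferentiableOn.inv (by fun_prop) hne
    · intro i q hq
      have hD := i.one_le_den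
      rw [norm_smul, norm_mul, norm_mul, i.norm_root, norm_inv, norm_inv, Complex.norm_natCast,
        one_mul]
      calc (i.den : ℝ)⁻¹ * ‖q - i.root‖⁻¹ * ‖monomial r i.1‖
          ≤ 1 * (8 * C ^ 2 * (i.den : ℝ) ^ 4) * r ^ i.den := by
            gcongr
            · exact inv_le_one_of_one_le₀ hD
            · exact hinv q hq i
            · exact norm_monomial_le hr0.le _
        _ = _ := by ring
  · have hs := hα.hasSum_remainder hr0 hr1 (hΔ1 q hq) N
    rw [← hs.tsum_eq]
    calc _ ≤ ∑' i : Idx, ‖q - circlePt α‖ ^ N * (8 * C ^ 2 * C ^ N) *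
          ((i.den : ℝ) ^ (2 * N + 4) * r ^ i.den) := by
          refine tsum_of_norm_bounded ((summable_idx_pow hr0 hr1 _).mul_left _).hasSum fun i => ?_
          have hD := i.one_le_den
          rw [norm_smul, norm_mul, norm_mul, norm_mul, norm_mul, i.norm_root, norm_inv, norm_inv,
            norm_inv, Complex.norm_natCast, one_mul, norm_pow, norm_pow, ← inv_pow]
          calc ‖q - circlePt α‖ ^ N * ((i.den : ℝ)⁻¹ * (‖i.root - circlePt α‖⁻¹ ^ N *
              ‖q - i.root‖⁻¹)) * ‖monomial r i.1‖
              ≤ ‖q - circlePt α‖ ^ N * (1 * ((C * (i.den : ℝ) ^ 2) ^ N *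
                (8 * C ^ 2 * (i.den : ℝ) ^ 4))) * r ^ i.den := by
                gcongr
                · exact inv_le_one_of_one_le₀ hD
                · exact h i
                · exact hinv q hq i
                · exact norm_monomial_le hr0.le _
            _ = _ := by ring
      _ = ‖q - circlePt α‖ ^ N * (8 * C ^ 2 * C ^ N *
          ∑' i : Idx, (i.den : ℝ) ^ (2 * N + 4) * r ^ i.den) := by
          rw [tsum_mul_left]; ring
      _ ≤ ‖q - circlePt α‖ ^ N * (c₀ * c₁ ^ N * gevreySeq 2 N) :=
          mul_le_mul_of_nonneg_left (hb N) (by positivity)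
      _ = _ := by ring

theorem IsQuadraticIrrational.hasGevreyExpansion (hα : IsQuadraticIrrational α) (hr0 : 0 < r)
    (hr1 : r < 1) : HasGevreyExpansion 2 (circlePt α) (fdelta r) (asympCoeff α r) :=
  ⟨hα.hasCarlemanExpansion hr0 hr1 .minus, hα.hasCarlemanExpansion hr0 hr1 .plus⟩

end

/-! ### Lacunary sums of exponentials -/

/-- The bump `(δ² - y²)³` on `[-δ, δ]`. -/
def bump (δ y : ℝ) : ℂ := ((δ : ℂ) ^ 2 - (y : ℂ) ^ 2) ^ 3

theorem integral_mul_exp_of_boundary_zero {u u' : ℝ → ℂ} {δ : ℝ} {ν : ℂ} (hν : ν ≠ 0)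
    (hu : ∀ y, HasDerivAt u (u' y) y) (hu' : Continuous u') (h1 : u δ = 0) (h2 : u (-δ) = 0) :
    ∫ y in -δ..δ, u y * Complex.exp (Complex.I * ν * y) =
      -((Complex.I * ν)⁻¹ * ∫ y in -δ..δ, u' y * Complex.exp (Complex.I * ν * y)) := by
  have hIν : Complex.I * ν ≠ 0 := mul_ne_zero Complex.I_ne_zero hν
  have hv : ∀ y : ℝ, HasDerivAt (fun y : ℝ => (Complex.I * ν)⁻¹ * Complex.exp (Complex.I * ν * y))
      (Complex.exp (Complex.I * ν * y)) y := by
    intro y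
    have h := ((((hasDerivAt_id (y : ℂ)).const_mul (Complex.I * ν)).cexp).const_mul
      (Complex.I * ν)⁻¹).comp_ofReal
    refine h.congr_deriv ?_
    simp only [id_eq, mul_one]
    field_simp
  rw [intervalIntegral.integral_mul_deriv_eq_deriv_mul (fun y _ => hu y) (fun y _ => hv y)
    (hu'.intervalIntegrable _ _) ((by fun_prop : Continuous fun y : ℝ =>
      Complex.exp (Complex.I * ν * y)).intervalIntegrable _ _), h1, h2]
  rw [← intervalIntegral.integral_const_mul]
  simp only [zero_mul, sub_zero, zero_sub]
  congr 2
  funext y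
  ring

/-- Three integrations by parts: the bump vanishes with its first two derivatives at `±δ`, so no
boundary term appears. The cubic decay later beats coefficients of linear growth, leaving a summable
`d⁻²`. -/
theorem norm_integral_bump_mul_exp_le {δ C : ℝ} (hδ : 0 < δ) {ν : ℂ} (hν : ν ≠ 0)
    (hC : |ν.im| ≤ C) :
    ‖∫ y in -δ..δ, bump δ y * Complex.exp (Complex.I * ν * y)‖ ≤
      384 * δ ^ 4 * Real.exp (C * δ) / ‖ν‖ ^ 3 := by
  have hid : ∀ y : ℝ, HasDerivAt (fun y : ℝ => (y : ℂ)) 1 y := fun y =>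
    (hasDerivAt_id (y : ℂ)).comp_ofReal
  have hg : ∀ y : ℝ, HasDerivAt (fun y : ℝ => (δ : ℂ) ^ 2 - (y : ℂ) ^ 2) (-(2 * (y : ℂ))) y := by
    intro y
    refine (((hid y).pow 2).const_sub ((δ : ℂ) ^ 2)).congr_deriv ?_
    simp
  have d1 : ∀ y : ℝ, HasDerivAt (bump δ) (-(6 * (y : ℂ) * ((δ : ℂ) ^ 2 - (y : ℂ) ^ 2) ^ 2)) y := by
    intro y
    refine ((hg y).pow 3).congr_deriv ?_
    push_cast
    ring
  have d2 : ∀ y : ℝ, HasDerivAt (fun y : ℝ => -(6 * (y : ℂ) * ((δ : ℂ) ^ 2 - (y : ℂ) ^ 2) ^ 2))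
      (-6 * ((δ : ℂ) ^ 2 - (y : ℂ) ^ 2) ^ 2 +
        24 * (y : ℂ) ^ 2 * ((δ : ℂ) ^ 2 - (y : ℂ) ^ 2)) y := by
    intro y
    refine ((((hid y).const_mul 6).mul ((hg y).pow 2)).neg).congr_deriv ?_
    push_cast
    simp only [Pi.pow_apply]
    ring
  have d3 : ∀ y : ℝ, HasDerivAt (fun y : ℝ => -6 * ((δ : ℂ) ^ 2 - (y : ℂ) ^ 2) ^ 2 +
        24 * (y : ℂ) ^ 2 * ((δ : ℂ) ^ 2 - (y : ℂ) ^ 2))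
      (72 * (δ : ℂ) ^ 2 * y - 120 * (y : ℂ) ^ 3) y := by
    intro y
    refine ((((hg y).pow 2).const_mul (-6)).add
      ((((hid y).pow 2).const_mul 24).mul (hg y))).congr_deriv ?_
    push_cast
    simp only [Pi.pow_apply]
    ring
  have hIν : Complex.I * ν ≠ 0 := mul_ne_zero Complex.I_ne_zero hν
  rw [integral_mul_exp_of_boundary_zero hν d1 (by fun_prop) (by simp [bump]) (by simp [bump]),
    integral_mul_exp_of_boundary_zero hν d2 (by fun_prop) (by simp) (by simp),
    integral_mul_exp_of_boundary_zero hν d3 (by fun_prop) (by simp) (by simp)]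
  have hbd : ‖∫ y in -δ..δ, (72 * (δ : ℂ) ^ 2 * y - 120 * (y : ℂ) ^ 3) *
      Complex.exp (Complex.I * ν * y)‖ ≤ (192 * δ ^ 3 * Real.exp (C * δ)) * |δ - -δ| := by
    refine intervalIntegral.norm_integral_le_of_norm_le_const fun y hy => ?_
    rw [Set.uIoc_of_le (by linarith)] at hy
    have hy' : |y| ≤ δ := abs_le.2 ⟨hy.1.le, hy.2⟩
    rw [norm_mul]
    gcongr
    · calc ‖72 * (δ : ℂ) ^ 2 * y - 120 * (y : ℂ) ^ 3‖
          ≤ ‖72 * (δ : ℂ) ^ 2 * y‖ + ‖120 * (y : ℂ) ^ 3‖ := norm_sub_le _ _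
        _ = 72 * δ ^ 2 * |y| + 120 * |y| ^ 3 := by
          simp [abs_of_pos hδ]
        _ ≤ 72 * δ ^ 2 * δ + 120 * δ ^ 3 := by gcongr
        _ = _ := by ring
    · rw [Complex.norm_exp, Real.exp_le_exp]
      have : (Complex.I * ν * y).re = -(ν.im * y) := by simp
      rw [this]
      calc -(ν.im * y) ≤ |ν.im * y| := neg_le_abs _
        _ = |ν.im| * |y| := abs_mul _ _
        _ ≤ C * δ := mul_le_mul hC hy' (abs_nonneg _) ((abs_nonneg _).trans hC)
  have hn : 0 < ‖ν‖ := norm_pos_iff.2 hν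
  simp only [norm_neg, norm_mul, norm_inv, Complex.norm_I, one_mul]
  rw [abs_of_pos (by linarith : 0 < δ - -δ)] at hbd
  calc ‖ν‖⁻¹ * (‖ν‖⁻¹ * (‖ν‖⁻¹ * _)) ≤ ‖ν‖⁻¹ * (‖ν‖⁻¹ * (‖ν‖⁻¹ *
        ((192 * δ ^ 3 * Real.exp (C * δ)) * (δ - -δ)))) := by gcongr
    _ = _ := by field_simp; ring

theorem norm_integral_bump_pos {δ : ℝ} (hδ : 0 < δ) : 0 < ‖∫ y in -δ..δ, bump δ y‖ := by
  have h : (∫ y in -δ..δ, bump δ y) = ((∫ y in -δ..δ, (δ ^ 2 - y ^ 2) ^ 3 : ℝ) : ℂ) := by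
    rw [← intervalIntegral.integral_ofReal]
    congr 1
    funext y
    simp [bump]
  have hpos : 0 < ∫ y in -δ..δ, (δ ^ 2 - y ^ 2) ^ 3 := by
    refine intervalIntegral.intervalIntegral_pos_of_pos_on
      ((by fun_prop : Continuous fun y : ℝ => (δ ^ 2 - y ^ 2) ^ 3).intervalIntegrable _ _)
      (fun y hy => ?_) (by linarith)
    have : 0 < δ ^ 2 - y ^ 2 := by nlinarith [hy.1, hy.2]
    positivity
  rw [h, Complex.norm_real, Real.norm_of_nonneg hpos.le]
  exact hpos

theorem norm_bump_le {δ y : ℝ} (hy : |y| ≤ δ) : ‖bump δ y‖ ≤ δ ^ 6 := by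
  have h : bump δ y = (((δ ^ 2 - y ^ 2) ^ 3 : ℝ) : ℂ) := by simp [bump]
  have h1 : y ^ 2 ≤ δ ^ 2 := by
    rw [← sq_abs y]
    gcongr
  rw [h, Complex.norm_real, Real.norm_of_nonneg (pow_nonneg (by linarith) 3)]
  calc (δ ^ 2 - y ^ 2) ^ 3 ≤ (δ ^ 2) ^ 3 := by
        gcongr
        · linarith [sq_nonneg y]
    _ = δ ^ 6 := by ring

theorem mul_exp_neg_le {s d : ℝ} (hs : 0 < s) (hd : 0 < d) :
    d * Real.exp (-(s * d)) ≤ 6 / s ^ 3 * (1 / d ^ 2) := by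
  have h := Real.pow_div_factorial_le_exp (s * d) (by positivity) 3
  rw [Real.exp_neg]
  have h2 : (s * d) ^ 3 / 6 ≤ Real.exp (s * d) := by
    simpa [Nat.factorial] using h
  calc d * (Real.exp (s * d))⁻¹ ≤ d * ((s * d) ^ 3 / 6)⁻¹ := by gcongr
    _ = _ := by field_simp

/-- A sum of exponentials whose frequencies are close to a lacunary sequence of reals, and whose
coefficients are unbounded on the line `re ζ = 0` (but have at most linear growth in the
frequencies), is unbounded near `0` in the half-plane `re ζ < 0`. -/
theorem lacunary_unbounded {ι : Type*} [Countable ι] {b w : ι → ℂ} {d : ι → ℝ} {C c K ε R : ℝ}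
    (hd : ∀ i, 0 < d i) (hC : ∀ i, ‖w i - d i‖ ≤ C) (hc : 0 < c) (hC0 : 0 ≤ C) (hK : 0 ≤ K)
    (hsep : ∀ i j, i ≠ j → c * d i ≤ ‖w i - w j‖) (hsum : Summable fun i => 1 / d i ^ 2)
    (hb : ∀ i, ‖b i‖ ≤ K * d i) (hunb : ∀ T : ℝ, ∃ i, T < ‖b i‖) (hε : 0 < ε)
    (hR : ∀ ζ : ℂ, ζ.re < 0 → ‖ζ‖ < ε → ‖∑' i, b i * Complex.exp (ζ * w i)‖ ≤ R) : False := by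
  classical
  set δ := ε / 2 with hδ
  have hδ0 : 0 < δ := by positivity
  have hR0 : 0 ≤ R := by
    refine (norm_nonneg _).trans (hR (-(ε / 2 : ℝ)) (by simp [hε]) ?_)
    rw [norm_neg, Complex.norm_real, Real.norm_of_nonneg (by positivity)]
    linarith
  set J := ‖∫ y in -δ..δ, bump δ y‖ with hJ
  have hJ0 : 0 < J := norm_integral_bump_pos hδ0
  set K0 := 384 * δ ^ 4 * Real.exp (2 * C * δ) with hK0
  set Sd := ∑' i, 1 / d i ^ 2 with hSd
  set T := Real.exp 1 * (δ ^ 6 * (R * Real.exp (C * ε)) * (2 * δ) +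
    K * Real.exp (2 * C * ε) * K0 / c ^ 3 * Sd) with hT
  obtain ⟨k, hk⟩ := hunb (T / J)
  rw [div_lt_iff₀ hJ0] at hk
  -- The bound `s d_k ≤ 1` keeps `exp (-Z w_k)` bounded on the segment uniformly in `k`, so that `T`
  -- does not depend on `k`. The cap `ε / 4` keeps the vertical segment `Z`, of half-length `ε / 2`,
  -- inside the disk.
  set s := min (ε / 4) (1 / d k) with hs
  have hdk := hd k
  have hs0 : 0 < s := by positivity
  have hsε : s ≤ ε / 4 := min_le_left _ _
  have hsd : s * d k ≤ 1 := by
    calc s * d k ≤ 1 / d k * d k := by gcongr; exact min_le_right _ _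
      _ = 1 := by field_simp
  set Z : ℝ → ℂ := fun y => -(s : ℂ) + Complex.I * y with hZ
  have hZre : ∀ y, (Z y).re = -s := fun y => by simp [hZ]
  have hZn : ∀ y, |y| ≤ δ → ‖Z y‖ < ε := by
    intro y hy
    calc ‖Z y‖ ≤ ‖-(s : ℂ)‖ + ‖Complex.I * y‖ := norm_add_le _ _
      _ = s + |y| := by simp [abs_of_pos hs0]
      _ < ε := by linarith
  have hwre : ∀ (i : ι) (y : ℝ), |y| ≤ δ → |(Z y * w i).re + s * d i| ≤ C * ε := by
    intro i y hy
    have e : (Z y * w i).re + s * d i = (Z y * (w i - d i)).re := by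
      simp [hZ]
      ring
    rw [e]
    calc |(Z y * (w i - d i)).re| ≤ ‖Z y * (w i - d i)‖ := Complex.abs_re_le_norm _
      _ = ‖Z y‖ * ‖w i - d i‖ := norm_mul _ _
      _ ≤ ε * C := by gcongr; exacts [(hZn y hy).le, hC i]
      _ = _ := mul_comm _ _
  have hcontZ : Continuous Z := by fun_prop
  have hexpk : ∀ y, |y| ≤ δ → ‖Complex.exp (-(Z y * w k))‖ ≤ Real.exp 1 * Real.exp (C * ε) := by
    intro y hy
    rw [Complex.norm_exp, ← Real.exp_add, Real.exp_le_exp, Complex.neg_re]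
    have := (abs_le.1 (hwre k y hy)).1
    linarith
  have hbexp : ∀ i y, |y| ≤ δ → ‖b i * Complex.exp (Z y * w i)‖ ≤
      K * (6 / s ^ 3) * Real.exp (C * ε) * (1 / d i ^ 2) := by
    intro i y hy
    rw [norm_mul, Complex.norm_exp]
    have h1 : Real.exp (Z y * w i).re ≤ Real.exp (-(s * d i)) * Real.exp (C * ε) := by
      rw [← Real.exp_add, Real.exp_le_exp]
      have := (abs_le.1 (hwre i y hy)).2
      linarith
    calc ‖b i‖ * Real.exp (Z y * w i).re
        ≤ (K * d i) * (Real.exp (-(s * d i)) * Real.exp (C * ε)) := by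
          gcongr
          · exact mul_nonneg hK (hd i).le
          · exact hb i
      _ = K * (d i * Real.exp (-(s * d i))) * Real.exp (C * ε) := by ring
      _ ≤ K * (6 / s ^ 3 * (1 / d i ^ 2)) * Real.exp (C * ε) := by
          gcongr K * ?_ * _
          exact mul_exp_neg_le hs0 (hd i)
      _ = _ := by ring
  have hsummable : ∀ y, |y| ≤ δ → Summable fun i => b i * Complex.exp (Z y * w i) := fun y hy =>
    Summable.of_norm_bounded (hsum.mul_left _) fun i => hbexp i y hy
  have hintegral : HasSum
      (fun i => ∫ y in -δ..δ, bump δ y * (b i * Complex.exp (Z y * w i)) *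
        Complex.exp (-(Z y * w k)))
      (∫ y in -δ..δ, bump δ y * (∑' i, b i * Complex.exp (Z y * w i)) *
        Complex.exp (-(Z y * w k))) := by
    refine intervalIntegral.hasSum_integral_of_dominated_convergence
      (fun i _ => δ ^ 6 * (K * (6 / s ^ 3) * Real.exp (C * ε) * (1 / d i ^ 2)) *
        (Real.exp 1 * Real.exp (C * ε))) (fun i => ?_) (fun i => ?_) ?_ ?_ ?_
    · refine Continuous.aestronglyMeasurable ?_
      unfold bump
      fun_prop
    · refine Eventually.of_forall fun y hy => ?_
      rw [Set.uIoc_of_le (by linarith)] at hy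
      have hy' : |y| ≤ δ := abs_le.2 ⟨hy.1.le, hy.2⟩
      rw [norm_mul, norm_mul]
      gcongr
      · exact norm_bump_le hy'
      · exact hbexp i y hy'
      · exact hexpk y hy'
    · refine Eventually.of_forall fun y _ => ?_
      exact ((hsum.mul_left _).mul_left _).mul_right _
    · exact intervalIntegrable_const
    · refine Eventually.of_forall fun y hy => ?_
      rw [Set.uIoc_of_le (by linarith)] at hy
      have hy' : |y| ≤ δ := abs_le.2 ⟨hy.1.le, hy.2⟩
      exact ((hsummable y hy').hasSum.mul_left _).mul_right _
  have hterm : ∀ i, ∫ y in -δ..δ, bump δ y * (b i * Complex.exp (Z y * w i)) *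
        Complex.exp (-(Z y * w k)) = b i * (Complex.exp (-(s : ℂ) * (w i - w k)) *
          ∫ y in -δ..δ, bump δ y * Complex.exp (Complex.I * (w i - w k) * y)) := by
    intro i
    rw [← intervalIntegral.integral_const_mul, ← intervalIntegral.integral_const_mul]
    congr 1
    funext y
    have : Complex.exp (Z y * w i) * Complex.exp (-(Z y * w k)) =
        Complex.exp (-(s : ℂ) * (w i - w k)) * Complex.exp (Complex.I * (w i - w k) * y) := by
      rw [← Complex.exp_add, ← Complex.exp_add]
      congr 1
      simp only [hZ]
      ring
    calc _ = bump δ y * b i * (Complex.exp (Z y * w i) * Complex.exp (-(Z y * w k))) := by ring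
      _ = _ := by rw [this]; ring
  simp only [hterm] at hintegral
  -- The diagonal term is `b k` times the integral of the bump. Every other term is `O(d_i ‖w_i -
  -- w_k‖⁻³) = O(d_i⁻²)` by separation, with a constant independent of `k`.
  have hdiff := hintegral.sub (hasSum_ite_eq k (b k * ∫ y in -δ..δ, bump δ y))
  have hbound : ∀ i, ‖b i * (Complex.exp (-(s : ℂ) * (w i - w k)) *
      ∫ y in -δ..δ, bump δ y * Complex.exp (Complex.I * (w i - w k) * y)) -
      (if i = k then b k * ∫ y in -δ..δ, bump δ y else 0)‖ ≤
      Real.exp 1 * (K * Real.exp (2 * C * ε) * K0 / c ^ 3) * (1 / d i ^ 2) := by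
    intro i
    have hdi := hd i
    by_cases hik : i = k
    · subst hik
      simp only [sub_self, mul_zero, Complex.exp_zero, one_mul, zero_mul, mul_one, if_true,
        norm_zero]
      positivity
    · rw [if_neg hik, sub_zero, norm_mul, norm_mul]
      have hν := hsep i k hik
      have hν0 : 0 < ‖w i - w k‖ := lt_of_lt_of_le (by positivity) hν
      have hre : |(w i - w k).re - (d i - d k)| ≤ 2 * C ∧ |(w i - w k).im| ≤ 2 * C := by
        have e1 : (w i - w k).re - (d i - d k) = ((w i - d i) - (w k - d k)).re := by simp; ring
        have e2 : (w i - w k).im = ((w i - d i) - (w k - d k)).im := by simp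
        have h2 : ‖(w i - d i) - (w k - d k)‖ ≤ 2 * C := by
          refine (norm_sub_le _ _).trans ?_
          linarith [hC i, hC k]
        rw [e1, e2]
        exact ⟨(Complex.abs_re_le_norm _).trans h2, (Complex.abs_im_le_norm _).trans h2⟩
      have h1 : ‖Complex.exp (-(s : ℂ) * (w i - w k))‖ ≤ Real.exp 1 * Real.exp (2 * C * ε) := by
        rw [Complex.norm_exp, ← Real.exp_add, Real.exp_le_exp]
        have e : (-(s : ℂ) * (w i - w k)).re = -(s * (w i - w k).re) := by simp
        rw [e]
        have h3 := (abs_le.1 hre.1).1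
        have h4 : s * (d i - d k - 2 * C) ≤ s * (w i - w k).re := by gcongr; linarith
        have h5 : 0 < s * d i := by positivity
        have h6 : s * (2 * C) ≤ ε * (2 * C) := by gcongr; linarith
        nlinarith
      have h2 := norm_integral_bump_mul_exp_le hδ0 (norm_pos_iff.1 hν0) hre.2
      calc ‖b i‖ * (‖Complex.exp (-(s : ℂ) * (w i - w k))‖ * _)
          ≤ (K * d i) * ((Real.exp 1 * Real.exp (2 * C * ε)) * (K0 / ‖w i - w k‖ ^ 3)) := by
            gcongr
            exact hb i
        _ ≤ (K * d i) * ((Real.exp 1 * Real.exp (2 * C * ε)) * (K0 / (c * d i) ^ 3)) := by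
            gcongr
        _ = _ := by field_simp
  have hres := tsum_of_norm_bounded (hsum.mul_left _).hasSum hbound
  rw [hdiff.tsum_eq, tsum_mul_left] at hres
  have hI : ‖∫ y in -δ..δ, bump δ y * (∑' i, b i * Complex.exp (Z y * w i)) *
        Complex.exp (-(Z y * w k))‖ ≤
      δ ^ 6 * R * (Real.exp 1 * Real.exp (C * ε)) * |δ - -δ| := by
    refine intervalIntegral.norm_integral_le_of_norm_le_const fun y hy => ?_
    rw [Set.uIoc_of_le (by linarith)] at hy
    have hy' : |y| ≤ δ := abs_le.2 ⟨hy.1.le, hy.2⟩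
    rw [norm_mul, norm_mul]
    gcongr
    · exact norm_bump_le hy'
    · exact hR _ (by rw [hZre]; linarith) (hZn y hy')
    · exact hexpk y hy'
  rw [abs_of_pos (by linarith : 0 < δ - -δ)] at hI
  have hfin : ‖b k * ∫ y in -δ..δ, bump δ y‖ ≤ T := by
    set A := ∫ y in -δ..δ, bump δ y * (∑' i, b i * Complex.exp (Z y * w i)) *
        Complex.exp (-(Z y * w k))
    calc ‖b k * ∫ y in -δ..δ, bump δ y‖ = ‖A - (A - b k * ∫ y in -δ..δ, bump δ y)‖ := by
          congr 1; ring
      _ ≤ ‖A‖ + ‖A - b k * ∫ y in -δ..δ, bump δ y‖ := norm_sub_le _ _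
      _ ≤ _ := add_le_add hI hres
      _ = T := by rw [hT]; ring
  rw [norm_mul] at hfin
  linarith

/-! ### The exponents of the Borel transform -/

/-- A square root of `π exp (-iπx) / sin (π|x|)`. -/
def sqrtPole (x : ℝ) : ℂ :=
  (√(Real.pi / Real.sin (Real.pi * |x|)) : ℝ) * Complex.exp (-(Complex.I * (Real.pi * x / 2 : ℝ)))

theorem sin_pi_abs_pos {x : ℝ} (hx : x ≠ 0) (hx2 : |x| ≤ 1 / 2) :
    0 < Real.sin (Real.pi * |x|) := by
  have h := abs_pos.2 hx
  refine Real.sin_pos_of_pos_of_lt_pi (by positivity) ?_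
  nlinarith [Real.pi_pos]

theorem sqrtPole_sq {x : ℝ} (hx : x ≠ 0) (hx2 : |x| ≤ 1 / 2) :
    sqrtPole x ^ 2 * (2 * Complex.I * Real.sin (Real.pi * |x|)) =
      2 * Real.pi * Complex.I * Complex.exp (-(Complex.I * Real.pi * x)) := by
  have hs := sin_pi_abs_pos hx hx2
  have hsc : (Real.sin (Real.pi * |x|) : ℂ) ≠ 0 := by exact_mod_cast hs.ne'
  have h1 : ((√(Real.pi / Real.sin (Real.pi * |x|)) : ℝ) : ℂ) ^ 2 =
      Real.pi / Real.sin (Real.pi * |x|) := by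
    rw [← Complex.ofReal_pow, Real.sq_sqrt (div_nonneg Real.pi_pos.le hs.le), Complex.ofReal_div]
  rw [sqrtPole, mul_pow, h1, ← Complex.exp_nat_mul]
  have h2 : ((2 : ℕ) : ℂ) * -(Complex.I * ((Real.pi * x / 2 : ℝ) : ℂ)) =
      -(Complex.I * Real.pi * x) := by push_cast; ring
  rw [h2]
  field_simp

theorem exp_sub_one_eq (x : ℝ) : Complex.exp (2 * Real.pi * Complex.I * x) - 1 =
    2 * Complex.I * Real.sin (Real.pi * x) * Complex.exp (Complex.I * Real.pi * x) := by
  rw [Complex.ofReal_sin, Complex.sin]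
  push_cast
  have h1 : Complex.exp (2 * Real.pi * Complex.I * x) =
      Complex.exp (Complex.I * Real.pi * x) * Complex.exp (Complex.I * Real.pi * x) := by
    rw [← Complex.exp_add]; congr 1; ring
  have h2 : Complex.exp (-(Real.pi * x) * Complex.I) * Complex.exp (Complex.I * Real.pi * x) = 1 := by
    rw [← Complex.exp_add, ← Complex.exp_zero]; congr 1; ring
  have h3 : Complex.exp (Real.pi * x * Complex.I) = Complex.exp (Complex.I * Real.pi * x) := by
    congr 1; ring
  rw [h1, h3]
  linear_combination h2 -
    ((Complex.exp (-(Real.pi * x) * Complex.I) - Complex.exp (Complex.I * Real.pi * x)) *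
      Complex.exp (Complex.I * Real.pi * x)) * Complex.I_sq

/-- A square root of `2πi / (exp (2πix) - 1)`. -/
def freq (x : ℝ) : ℂ := if 0 < x then sqrtPole x else -Complex.I * sqrtPole x

theorem freq_sq {x : ℝ} (hx : x ≠ 0) (hx2 : |x| ≤ 1 / 2) :
    freq x ^ 2 * (Complex.exp (2 * Real.pi * Complex.I * x) - 1) = 2 * Real.pi * Complex.I := by
  have h := sqrtPole_sq hx hx2
  have he : Complex.exp (-(Complex.I * Real.pi * x)) * Complex.exp (Complex.I * Real.pi * x) = 1 := by
    rw [← Complex.exp_add, neg_add_cancel, Complex.exp_zero]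
  rw [exp_sub_one_eq, freq]
  split_ifs with h0
  · rw [abs_of_pos h0] at h
    linear_combination Complex.exp (Complex.I * Real.pi * x) * h + 2 * Real.pi * Complex.I * he
  · have h1 : x < 0 := lt_of_le_of_ne (not_lt.1 h0) hx
    rw [abs_of_neg h1, mul_neg, Real.sin_neg, Complex.ofReal_neg] at h
    rw [mul_pow, neg_sq, Complex.I_sq]
    linear_combination Complex.exp (Complex.I * Real.pi * x) * h + 2 * Real.pi * Complex.I * he

/-- Replacing `sin (π|x|)` by `π|x|` changes the modulus by at most `2`, and the phase `exp
(-iπx/2)` costs at most `|x|^(-1/2) · O(|x|) = O(1)`, again at most `2`. Being bounded, the error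
only multiplies exponentials by factors bounded for bounded `ζ`. -/
theorem norm_sqrtPole_sub_le {x : ℝ} (hx : x ≠ 0) (hx2 : |x| ≤ 1 / 2) :
    ‖sqrtPole x - ((√|x|)⁻¹ : ℝ)‖ ≤ 4 := by
  have hs := sin_pi_abs_pos hx hx2
  have hy := abs_pos.2 hx
  set y := |x| with hydef
  set s := Real.sin (Real.pi * y) with hsdef
  set S := √(Real.pi / s) with hS
  have hS2 : S ^ 2 = Real.pi / s := Real.sq_sqrt (by positivity)
  have hS0 : 0 < S := Real.sqrt_pos.2 (by positivity)
  set g := (√y)⁻¹ with hg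
  have hg0 : 0 < g := by positivity
  have hg2 : g ^ 2 = 1 / y := by rw [hg, inv_pow, Real.sq_sqrt hy.le, one_div]
  have hs2 : 2 * y ≤ s := by
    have := two_mul_abs_le_abs_sin_pi_mul (x := y) (by rwa [abs_of_pos hy])
    rwa [abs_of_pos hy, abs_of_pos hs] at this
  have hpi := Real.pi_lt_d2
  have hpi0 := Real.pi_pos
  have hsle : s ≤ Real.pi * y := Real.sin_le (by positivity)
  have hsge : Real.pi * y - (Real.pi * y) ^ 3 / 6 ≤ s := Real.sin_ge_sub_cube (by positivity)
  have hSle : S ^ 2 * y ≤ 1.6 := by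
    rw [hS2, div_mul_eq_mul_div, div_le_iff₀ hs]
    nlinarith
  have hpi3 : Real.pi ^ 3 ≤ 36 := by
    calc Real.pi ^ 3 ≤ 3.15 ^ 3 := by gcongr
      _ ≤ 36 := by norm_num
  have hgS : g ≤ S := by
    rw [← sq_le_sq₀ hg0.le hS0.le, hS2, hg2, div_le_div_iff₀ hy hs]
    linarith
  have hdiff : S - g ≤ 2 := by
    have h1 : S ^ 2 - g ^ 2 ≤ 3 * y := by
      rw [hS2, hg2, div_sub_div _ _ hs.ne' hy.ne', div_le_iff₀ (by positivity)]
      have h2 : Real.pi * y - s ≤ Real.pi ^ 3 * y ^ 3 / 6 := by nlinarith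
      have h3 : Real.pi ^ 3 * y ^ 3 / 6 ≤ 36 * y ^ 3 / 6 := by gcongr
      have h4 : 3 * y * (2 * y * y) ≤ 3 * y * (s * y) := by gcongr
      nlinarith
    have hg1 : 1 ≤ g := by
      rw [← sq_le_sq₀ zero_le_one hg0.le, hg2, one_pow, le_div_iff₀ hy]
      linarith
    nlinarith
  have hexp : ‖Complex.exp (-(Complex.I * (Real.pi * x / 2 : ℝ))) - 1‖ ≤ Real.pi * y / 2 := by
    have := Real.norm_exp_I_mul_ofReal_sub_one_le (x := -(Real.pi * x / 2))
    rw [Complex.ofReal_neg, mul_neg] at this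
    refine this.trans (le_of_eq ?_)
    rw [Real.norm_eq_abs, abs_neg, abs_div, abs_mul, abs_of_pos hpi0, abs_two]
  have e : sqrtPole x - ((g : ℝ) : ℂ) =
      (S : ℂ) * (Complex.exp (-(Complex.I * (Real.pi * x / 2 : ℝ))) - 1) + ((S - g : ℝ) : ℂ) := by
    rw [sqrtPole]
    push_cast
    ring
  rw [e]
  have hSy : S * (Real.pi * y / 2) ≤ 2 := by
    have hSy2 : (S * (Real.pi * y / 2)) ^ 2 ≤ 2 ^ 2 := by
      calc (S * (Real.pi * y / 2)) ^ 2 = (S ^ 2 * y) * (Real.pi ^ 2 * y / 4) := by ring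
        _ ≤ 1.6 * (3.15 ^ 2 * (1 / 2) / 4) := by gcongr
        _ ≤ 2 ^ 2 := by norm_num
    exact le_of_sq_le_sq hSy2 (by norm_num)
  calc _ ≤ ‖(S : ℂ) * (Complex.exp (-(Complex.I * (Real.pi * x / 2 : ℝ))) - 1)‖ +
        ‖((S - g : ℝ) : ℂ)‖ := norm_add_le _ _
    _ ≤ S * (Real.pi * y / 2) + 2 := by
        rw [norm_mul, Complex.norm_real, Real.norm_of_nonneg hS0.le, Complex.norm_real,
          Real.norm_of_nonneg (by linarith)]
        gcongr
    _ ≤ 4 := by linarith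

theorem norm_cosh_le (z : ℂ) : ‖Complex.cosh z‖ ≤ Real.exp |z.re| := by
  rw [Complex.cosh, norm_div, Complex.norm_two]
  have h1 : ‖Complex.exp z‖ ≤ Real.exp |z.re| := by
    rw [Complex.norm_exp, Real.exp_le_exp]
    exact le_abs_self _
  have h2 : ‖Complex.exp (-z)‖ ≤ Real.exp |z.re| := by
    rw [Complex.norm_exp, Real.exp_le_exp]
    exact neg_le_abs _
  rw [div_le_iff₀ two_pos]
  linarith [norm_add_le (Complex.exp z) (Complex.exp (-z))]

theorem abs_re_mul_sqrtPole_sub_le {x : ℝ} (hx : x ≠ 0) (hx2 : |x| ≤ 1 / 2) (ζ : ℂ) :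
    |(ζ * sqrtPole x).re - ζ.re * (√|x|)⁻¹| ≤ 4 * ‖ζ‖ := by
  have e : (ζ * sqrtPole x).re - ζ.re * (√|x|)⁻¹ = (ζ * (sqrtPole x - ((√|x|)⁻¹ : ℝ))).re := by
    rw [mul_sub, Complex.sub_re, mul_comm ζ (((√|x|)⁻¹ : ℝ) : ℂ), Complex.re_ofReal_mul, mul_comm ζ.re]
  rw [e]
  calc _ ≤ ‖ζ * (sqrtPole x - ((√|x|)⁻¹ : ℝ))‖ := Complex.abs_re_le_norm _
    _ = ‖ζ‖ * _ := norm_mul _ _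
    _ ≤ ‖ζ‖ * 4 := by gcongr; exact norm_sqrtPole_sub_le hx hx2
    _ = _ := mul_comm _ _

theorem norm_cosh_mul_sqrtPole_le {x : ℝ} (hx : x ≠ 0) (hx2 : |x| ≤ 1 / 2) (ζ : ℂ) :
    ‖Complex.cosh (ζ * sqrtPole x)‖ ≤ Real.exp (4 * ‖ζ‖) * Real.exp (|ζ.re| * (√|x|)⁻¹) := by
  refine (norm_cosh_le _).trans ?_
  rw [← Real.exp_add, Real.exp_le_exp]
  have h1 := abs_re_mul_sqrtPole_sub_le hx hx2 ζ
  have h2 : |ζ.re * (√|x|)⁻¹| = |ζ.re| * (√|x|)⁻¹ := by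
    rw [abs_mul, abs_of_nonneg (by positivity : 0 ≤ (√|x|)⁻¹)]
  have h3 := abs_sub_abs_le_abs_sub (ζ * sqrtPole x).re (ζ.re * (√|x|)⁻¹)
  linarith

/-- The extra factor `-i` in `freq` for negative `x` exchanges real and imaginary parts: the two
pairs of sides of the rectangle come from the two sides of `α`. -/
theorem norm_cosh_mul_freq_le {x : ℝ} (hx : x ≠ 0) (hx2 : |x| ≤ 1 / 2) (ζ : ℂ) :
    ‖Complex.cosh (ζ * freq x)‖ ≤
      Real.exp (4 * ‖ζ‖) * Real.exp ((if 0 < x then |ζ.re| else |ζ.im|) * (√|x|)⁻¹) := by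
  rw [freq]
  split_ifs with h
  · exact norm_cosh_mul_sqrtPole_le hx hx2 ζ
  · have := norm_cosh_mul_sqrtPole_le hx hx2 (ζ * -Complex.I)
    rw [mul_assoc, norm_mul, norm_neg, Complex.norm_I, mul_one] at this
    simpa using this

/-! ### Exponential growth rates of the terms -/

/-- The quality `1 / (D² |N / D - α|)` of the approximation of an index. -/
def Idx.quot (α : ℝ) (i : Idx) : ℝ := ((i.den : ℝ) ^ 2 * |i.err α|)⁻¹

theorem Idx.inv_sqrt_abs_err (α : ℝ) (i : Idx) :
    (√|i.err α|)⁻¹ = i.den * √(i.quot α) := by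
  have hD := i.one_le_den
  rw [Idx.quot, Real.sqrt_inv, Real.sqrt_mul (by positivity), Real.sqrt_sq (by positivity), mul_inv,
    ← mul_assoc, mul_inv_cancel₀ (by positivity), one_mul]

theorem Idx.quot_of_pos {α : ℝ} {i : Idx} (h : 0 < i.err α) :
    i.quot α = approxQuot α (i.toPair α) := by
  rw [Idx.quot, abs_of_pos h, approxQuot_eq]
  rfl

/-- The rational approximation of `-α` of an index. -/
def Idx.toPairNeg (α : ℝ) (i : Idx) : ℕ+ × ℤ := ((i.toPair α).1, -(i.toPair α).2)

theorem Idx.toPairNeg_injective (α : ℝ) : Function.Injective (Idx.toPairNeg α) := by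
  intro i j h
  simp only [Idx.toPairNeg, Prod.mk.injEq, neg_inj] at h
  exact Idx.toPair_injective α (Prod.ext h.1 h.2)

theorem Idx.quot_of_neg {α : ℝ} {i : Idx} (h : i.err α < 0) :
    i.quot α = approxQuot (-α) (i.toPairNeg α) := by
  rw [Idx.quot, abs_of_neg h, approxQuot_neg, approxQuot_eq, ← inv_neg, ← mul_neg]
  simp only [Idx.toPairNeg, neg_neg]
  rfl

theorem exists_const_of_eventually_le {ι : Type*} {P : ι → Prop} {a b : ι → ℝ} (hb : ∀ i, 0 < b i)
    (h : ∀ᶠ i in cofinite, P i → a i ≤ b i) : ∃ K : ℝ, 0 < K ∧ ∀ i, P i → a i ≤ K * b i := by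
  rw [eventually_cofinite] at h
  obtain ⟨K, hK⟩ := (h.image fun i => a i / b i).bddAbove
  refine ⟨max K 1, by positivity, fun i hi => ?_⟩
  by_cases h1 : a i ≤ b i
  · exact h1.trans (le_mul_of_one_le_left (hb i).le (le_max_right _ _))
  · have : a i / b i ≤ K := hK ⟨i, fun hcon => h1 (hcon hi), rfl⟩
    rw [div_le_iff₀ (hb i)] at this
    exact this.trans (mul_le_mul_of_nonneg_right (le_max_left _ _) (hb i).le)

/-- Both sides of `α` yield growth `exp (h' n)` with one rate `h' < h`; finitely many exceptional
indices are absorbed in `K`. The predicate `P` allows the extremal indices to be left out, so that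
the estimate also holds slightly beyond an edge. -/
theorem exists_norm_cosh_le {α : ℝ} (hα : Irrational α) {P : Idx → Prop} {k₁ k₂ A B h : ℝ}
    (hA : 0 ≤ A) (hB : 0 ≤ B) (hAh : A * √k₁ < h) (hBh : B * √k₂ < h)
    (e₁ : ∀ᶠ i : Idx in cofinite, P i → 0 < i.err α → i.quot α ≤ k₁)
    (e₂ : ∀ᶠ i : Idx in cofinite, P i → i.err α < 0 → i.quot α ≤ k₂) :
    ∃ K h' : ℝ, 0 < K ∧ h' < h ∧ ∀ i, P i → ∀ ζ : ℂ, |ζ.re| ≤ A → |ζ.im| ≤ B →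
      ‖Complex.cosh (ζ * freq (i.err α))‖ ≤ K * Real.exp (h' * i.den) := by
  set h' := max (A * √k₁) (B * √k₂) with hh'
  have hev : ∀ᶠ i : Idx in cofinite, P i →
      Real.exp ((if 0 < i.err α then A else B) * (√|i.err α|)⁻¹) ≤ Real.exp (h' * i.den) := by
    filter_upwards [e₁, e₂] with i h1 h2 hP
    rw [Real.exp_le_exp, i.inv_sqrt_abs_err]
    have hD := i.one_le_den
    split_ifs with h0
    · calc A * (i.den * √(i.quot α)) ≤ A * (i.den * √k₁) := by gcongr; exact h1 hP h0
        _ = (A * √k₁) * i.den := by ring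
        _ ≤ h' * i.den := by gcongr; exact le_max_left _ _
    · have h3 : i.err α < 0 := lt_of_le_of_ne (not_lt.1 h0) (i.err_ne_zero hα)
      calc B * (i.den * √(i.quot α)) ≤ B * (i.den * √k₂) := by gcongr; exact h2 hP h3
        _ = (B * √k₂) * i.den := by ring
        _ ≤ h' * i.den := by gcongr; exact le_max_right _ _
  obtain ⟨K, hK, hKi⟩ := exists_const_of_eventually_le (fun i => Real.exp_pos _) hev
  refine ⟨Real.exp (4 * (A + B)) * K, h', by positivity, max_lt hAh hBh, fun i hP ζ hre him => ?_⟩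
  refine (norm_cosh_mul_freq_le (i.err_ne_zero hα) (i.abs_err_le α) ζ).trans ?_
  rw [mul_assoc]
  gcongr
  · exact (Complex.norm_le_abs_re_add_abs_im ζ).trans (add_le_add hre him)
  · refine le_trans ?_ (hKi i hP)
    rw [Real.exp_le_exp]
    gcongr
    split_ifs
    · exact hre
    · exact him

theorem IsQuadraticIrrational.eventually_quot_le_of_pos {α k : ℝ} (hα : IsQuadraticIrrational α)
    (hk : approxLim α < k) : ∀ᶠ i : Idx in cofinite, 0 < i.err α → i.quot α ≤ k := by
  filter_upwards [(Idx.toPair_injective α).tendsto_cofinite.eventually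
    (hα.eventually_approxQuot_lt hk)] with i hi h0
  rw [Idx.quot_of_pos h0]
  exact hi.le

theorem IsQuadraticIrrational.eventually_quot_le_of_neg {α k : ℝ} (hα : IsQuadraticIrrational α)
    (hk : approxLim (-α) < k) : ∀ᶠ i : Idx in cofinite, i.err α < 0 → i.quot α ≤ k := by
  filter_upwards [(Idx.toPairNeg_injective α).tendsto_cofinite.eventually
    (hα.neg.eventually_approxQuot_lt hk)] with i hi h0
  rw [Idx.quot_of_neg h0]
  exact hi.le

theorem exists_gt_mul_sqrt_lt {A L h : ℝ} (hL : 0 < L) (hA : A < (√L)⁻¹ * h) :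
    ∃ k, L < k ∧ A * √k < h := by
  have hs := Real.sqrt_pos.2 hL
  have h1 : A * √L < h := by
    calc A * √L < (√L)⁻¹ * h * √L := by gcongr
      _ = h := by field_simp
  have hc : ContinuousAt (fun k => A * √k) L := by fun_prop
  have hev := hc.eventually (gt_mem_nhds h1)
  obtain ⟨k, hk1, hk2⟩ := ((hev.filter_mono nhdsWithin_le_nhds).and
    (self_mem_nhdsWithin : Set.Ioi L ∈ nhdsWithin L (Set.Ioi L))).exists
  exact ⟨k, hk2, hk1⟩

/-! ### Analyticity of sums of products of functions of one variable -/

/-- A sum of products of holomorphic functions of two separate variables, with summable bounds for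
both families, is jointly analytic. -/
theorem analyticAt_tsum_mul {ι : Type*} {a c : ι → ℂ → ℂ} {u v : ι → ℝ} {U V : Set ℂ}
    (hU : IsOpen U) (hV : IsOpen V) (hc : ∀ i, DifferentiableOn ℂ (c i) U)
    (ha : ∀ i, DifferentiableOn ℂ (a i) V) (hv : Summable v) (hu : Summable u)
    (hcv : ∀ i, ∀ x ∈ U, ‖c i x‖ ≤ v i) (hau : ∀ i, ∀ z ∈ V, ‖a i z‖ ≤ u i) {p : ℂ × ℂ}
    (hp : p.1 ∈ U ∧ p.2 ∈ V) : AnalyticAt ℂ (fun p : ℂ × ℂ => ∑' i, a i p.2 * c i p.1) p := by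
  classical
  -- The sum is the evaluation pairing of a functional-valued holomorphic function of one variable
  -- with an `ℓ¹`-valued holomorphic function of the other. Evaluation is continuous and bilinear,
  -- so joint analyticity follows.
  let W := lp (fun _ : ι => ℂ) 1
  let e : ι → W := fun i => lp.single 1 i (1 : ℂ)
  let ev : ι → W →L[ℂ] ℂ := fun i => lp.evalCLM ℂ (fun _ : ι => ℂ) 1 i
  have he : ∀ i, ‖e i‖ = 1 := fun i => by
    simp only [e]
    rw [lp.norm_single zero_lt_one, norm_one]
  have hev : ∀ i, ‖ev i‖ ≤ 1 := fun i => LinearMap.mkContinuous_norm_le _ zero_le_one _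
  have heve : ∀ i j, ev j (e i) = if i = j then 1 else 0 := by
    intro i j
    change (lp.single 1 i (1 : ℂ) : W) j = _
    rw [lp.single_apply, Pi.single_apply]
    simp only [eq_comm]
  let A : ℂ → W := fun z => ∑' i, a i z • e i
  let G : ℂ → W →L[ℂ] ℂ := fun x => ∑' i, c i x • ev i
  have hAb : ∀ i, ∀ z ∈ V, ‖a i z • e i‖ ≤ u i := by
    intro i z hz
    rw [norm_smul, he, mul_one]
    exact hau i z hz
  have hGb : ∀ i, ∀ x ∈ U, ‖c i x • ev i‖ ≤ v i := by
    intro i x hx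
    rw [norm_smul]
    exact (mul_le_of_le_one_right (norm_nonneg _) (hev i)).trans (hcv i x hx)
  have hA : DifferentiableOn ℂ A V :=
    Complex.differentiableOn_tsum_of_summable_norm hu (fun i => (ha i).smul_const _) hV hAb
  have hG : DifferentiableOn ℂ G U :=
    Complex.differentiableOn_tsum_of_summable_norm hv (fun i => (hc i).smul_const _) hU hGb
  have hA' : AnalyticAt ℂ A p.2 := hA.analyticAt (hV.mem_nhds hp.2)
  have hG' : AnalyticAt ℂ G p.1 := hG.analyticAt (hU.mem_nhds hp.1)
  have hpair : AnalyticAt ℂ (fun p : ℂ × ℂ => (G p.1) (A p.2)) p := by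
    have h1 : AnalyticAt ℂ (fun p : ℂ × ℂ => (G p.1, A p.2)) p :=
      AnalyticAt.prod (hG'.fun_comp analyticAt_fst) (hA'.fun_comp analyticAt_snd)
    have h2 := (ContinuousLinearMap.id ℂ (W →L[ℂ] ℂ)).analyticAt_bilinear (G p.1, A p.2)
    exact AnalyticAt.fun_comp (g := fun q : (W →L[ℂ] ℂ) × W => q.1 q.2)
      (f := fun p : ℂ × ℂ => (G p.1, A p.2)) h2 h1
  refine hpair.congr ?_
  filter_upwards [(hU.prod hV).mem_nhds hp] with q hq
  have sA : Summable fun i => a i q.2 • e i :=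
    Summable.of_norm_bounded hu fun i => hAb i q.2 hq.2
  have sG : Summable fun i => c i q.1 • ev i :=
    Summable.of_norm_bounded hv fun i => hGb i q.1 hq.1
  have hevA : ∀ j, ev j (A q.2) = a j q.2 := by
    intro j
    simp only [A]
    rw [(ev j).map_tsum sA]
    simp only [map_smul, heve, smul_eq_mul]
    rw [tsum_eq_single j]
    · simp
    · intro i hi
      simp [hi]
  have h := (ContinuousLinearMap.apply ℂ ℂ (A q.2)).map_tsum sG
  simp only [ContinuousLinearMap.apply_apply] at h
  change (∑' i, c i q.1 • ev i) (A q.2) = _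
  rw [h]
  refine tsum_congr fun i => ?_
  rw [smul_apply, hevA, smul_eq_mul, mul_comm]

/-! ### The Borel transform -/

/-- The factor `(2πiλ) ^ (-1/2)`. -/
def rotFactor (α : ℝ) : ℂ := (2 * Real.pi * Complex.I * circlePt α) ^ (-(1 / 2) : ℂ)

theorem rotFactor_sq (α : ℝ) : rotFactor α ^ 2 * (2 * Real.pi * Complex.I * circlePt α) = 1 := by
  have h0 : (2 * Real.pi * Complex.I * circlePt α : ℂ) ≠ 0 := by
    have : (Real.pi : ℂ) ≠ 0 := by exact_mod_cast Real.pi_ne_zero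
    simp [this, circlePt_ne_zero]
  rw [rotFactor, ← Complex.cpow_nat_mul]
  norm_num
  rw [Complex.cpow_neg_one, inv_mul_cancel₀ h0]

theorem rotFactor_ne_zero (α : ℝ) : rotFactor α ≠ 0 := by
  intro h
  have := rotFactor_sq α
  rw [h] at this
  norm_num at this

/-- In the rotated variable, `freq` provides a square root of `1/(Λ - λ)`; only its square enters
the power series of `cosh`, so the choice of branch is harmless. -/
theorem sq_rotFactor_mul_freq {α : ℝ} (hα : Irrational α) (i : Idx) :
    (rotFactor α * freq (i.err α)) ^ 2 = (i.root - circlePt α)⁻¹ := by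
  have h1 := rotFactor_sq α
  have h2 := freq_sq (i.err_ne_zero hα) (i.abs_err_le α)
  have h4 : i.root - circlePt α =
      circlePt α * (Complex.exp (2 * Real.pi * Complex.I * i.err α) - 1) := by
    rw [i.root_eq α]; ring
  apply eq_inv_of_mul_eq_one_left
  rw [h4]
  linear_combination rotFactor α ^ 2 * circlePt α * h2 + h1

/-- The residue of an index. -/
def Idx.coeff (α : ℝ) (i : Idx) : ℂ := -((i.den : ℂ)⁻¹ * (i.root * (i.root - circlePt α)⁻¹))

/-- A term of the Borel transform. -/
def borelTerm (α : ℝ) (i : Idx) (p : ℂ × ℂ) : ℂ :=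
  i.coeff α * p.2 ^ i.den * Complex.cosh (rotFactor α * p.1 * freq (i.err α))

/-- The Borel transform. -/
def borelSum (α : ℝ) (p : ℂ × ℂ) : ℂ := ∑' i : Idx, borelTerm α i p

theorem Idx.norm_coeff (α : ℝ) (i : Idx) :
    ‖i.coeff α‖ = (i.den : ℝ)⁻¹ * ‖i.root - circlePt α‖⁻¹ := by
  rw [Idx.coeff, norm_neg, norm_mul, norm_mul, i.norm_root, norm_inv, norm_inv,
    Complex.norm_natCast, one_mul]

theorem IsQuadraticIrrational.exists_norm_coeff_le {α : ℝ} (hα : IsQuadraticIrrational α) :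
    ∃ C : ℝ, 1 ≤ C ∧ ∀ i : Idx, ‖i.coeff α‖ ≤ C * i.den := by
  obtain ⟨C, hC, h⟩ := hα.exists_le_norm_root_sub
  refine ⟨C, hC, fun i => ?_⟩
  have hD := i.one_le_den
  rw [i.norm_coeff, inv_mul_le_iff₀ (by positivity)]
  calc _ ≤ C * (i.den : ℝ) ^ 2 := h i
    _ = _ := by ring

theorem summable_exp_mul_den {a : ℝ} (ha : a < 0) (p : ℕ) :
    Summable fun i : Idx => (i.den : ℝ) ^ p * Real.exp (a * i.den) := by
  refine (summable_idx_pow (Real.exp_pos a) (Real.exp_lt_one_iff.2 ha) p).congr fun i => ?_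
  rw [← Real.exp_nat_mul, mul_comm a]

/-- The parameters of a polydisk around a point of the domain of the Borel transform. -/
theorem exists_of_mem_REC {α : ℝ} (hα : IsQuadraticIrrational α) {ξ z : ℂ} (hξ : ξ ∈ REC α z) :
    ∃ h : ℝ, |(rotFactor α * ξ).re| < kappaPlus α * h ∧ |(rotFactor α * ξ).im| < kappaMinus α * h ∧
      ‖z‖ < Real.exp (-h) := by
  have hκ : 0 < kappaPlus α := by
    rw [kappaPlus_eq]; exact inv_pos.2 (Real.sqrt_pos.2 hα.approxLim_pos)
  have hκ' : 0 < kappaMinus α := by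
    rw [kappaMinus_eq]; exact inv_pos.2 (Real.sqrt_pos.2 hα.neg.approxLim_pos)
  by_cases h0 : z = 0
  · obtain ⟨h, hh⟩ := exists_gt (max (|(rotFactor α * ξ).re| / kappaPlus α)
      (|(rotFactor α * ξ).im| / kappaMinus α))
    refine ⟨h, ?_, ?_, by rw [h0, norm_zero]; exact Real.exp_pos _⟩
    · have := (le_max_left _ _).trans_lt hh
      rwa [div_lt_iff₀' hκ] at this
    · have := (le_max_right _ _).trans_lt hh
      rwa [div_lt_iff₀' hκ'] at this
  · have hξ' : |(rotFactor α * ξ).re| < kappaPlus α * Real.log (1 / ‖z‖) ∧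
        |(rotFactor α * ξ).im| < kappaMinus α * Real.log (1 / ‖z‖) := hξ.resolve_left h0
    obtain ⟨h, hh1, hh2⟩ := exists_between (a₁ := max (|(rotFactor α * ξ).re| / kappaPlus α)
      (|(rotFactor α * ξ).im| / kappaMinus α)) (a₂ := Real.log (1 / ‖z‖))
      (max_lt (by rw [div_lt_iff₀' hκ]; exact hξ'.1) (by rw [div_lt_iff₀' hκ']; exact hξ'.2))
    refine ⟨h, ?_, ?_, ?_⟩
    · have := (le_max_left _ _).trans_lt hh1
      rwa [div_lt_iff₀' hκ] at this
    · have := (le_max_right _ _).trans_lt hh1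
      rwa [div_lt_iff₀' hκ'] at this
    · have hzp := norm_pos_iff.2 h0
      rw [one_div, Real.log_inv] at hh2
      rw [← Real.log_lt_iff_lt_exp hzp]
      linarith

theorem IsQuadraticIrrational.analyticAt_borelSum {α : ℝ} (hα : IsQuadraticIrrational α) {p : ℂ × ℂ}
    (hp : p.1 ∈ REC α p.2) : AnalyticAt ℂ (borelSum α) p := by
  obtain ⟨h, h1, h2, h3⟩ := exists_of_mem_REC hα hp
  obtain ⟨A, hA1, hA2⟩ := exists_between h1
  obtain ⟨B, hB1, hB2⟩ := exists_between h2
  rw [kappaPlus_eq] at hA2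
  rw [kappaMinus_eq] at hB2
  obtain ⟨k₁, hk₁, hAk⟩ := exists_gt_mul_sqrt_lt hα.approxLim_pos hA2
  obtain ⟨k₂, hk₂, hBk⟩ := exists_gt_mul_sqrt_lt hα.neg.approxLim_pos hB2
  obtain ⟨K, h', hK, hh', hcosh⟩ := exists_norm_cosh_le hα.1 (P := fun _ => True)
    ((abs_nonneg _).trans hA1.le) ((abs_nonneg _).trans hB1.le) hAk hBk
    ((hα.eventually_quot_le_of_pos hk₁).mono fun i hi _ => hi)
    ((hα.eventually_quot_le_of_neg hk₂).mono fun i hi _ => hi)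
  obtain ⟨C, hC, hcoeff⟩ := hα.exists_norm_coeff_le
  obtain ⟨h'', hh1, hh2⟩ := exists_between hh'
  set U : Set ℂ := {ξ | |(rotFactor α * ξ).re| < A ∧ |(rotFactor α * ξ).im| < B} with hUdef
  have hU : IsOpen U := by
    have c1 : Continuous fun ξ : ℂ => |(rotFactor α * ξ).re| := by fun_prop
    have c2 : Continuous fun ξ : ℂ => |(rotFactor α * ξ).im| := by fun_prop
    exact (isOpen_lt c1 continuous_const).inter (isOpen_lt c2 continuous_const)
  -- The weight `exp (h'' n)` is moved from one factor to the other, with `h' < h'' < h`, so that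
  -- both families have exponentially decreasing bounds.
  have key := analyticAt_tsum_mul (U := U) (V := ball 0 (Real.exp (-h))) (p := p)
    (a := fun (i : Idx) z => i.coeff α * z ^ i.den * (Real.exp (h'' * i.den) : ℝ))
    (c := fun (i : Idx) ξ => (Real.exp (-h'' * i.den) : ℝ) *
      Complex.cosh (rotFactor α * ξ * freq (i.err α)))
    (v := fun i => K * ((i.den : ℝ) ^ 0 * Real.exp ((h' - h'') * i.den)))
    (u := fun i => C * ((i.den : ℝ) ^ 1 * Real.exp ((h'' - h) * i.den)))
    hU isOpen_ball
    (fun i => ((((differentiable_id.const_mul _).mul_const _).ccosh).const_mul _).differentiableOn)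
    (fun i => (((differentiable_pow _).const_mul _).mul_const _).differentiableOn)
    ((summable_exp_mul_den (by linarith) 0).mul_left _)
    ((summable_exp_mul_den (by linarith) 1).mul_left _) ?_ ?_
    ⟨⟨hA1, hB1⟩, by rwa [mem_ball_zero_iff]⟩
  · refine key.congr (Eventually.of_forall fun q => ?_)
    refine tsum_congr fun i => ?_
    have e : ((Real.exp (h'' * i.den) : ℝ) : ℂ) * ((Real.exp (-h'' * i.den) : ℝ) : ℂ) = 1 := by
      rw [← Complex.ofReal_mul, ← Real.exp_add, neg_mul, add_neg_cancel, Real.exp_zero,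
        Complex.ofReal_one]
    rw [borelTerm]
    linear_combination (i.coeff α * q.2 ^ i.den *
      Complex.cosh (rotFactor α * q.1 * freq (i.err α))) * e
  · intro i x hx
    rw [norm_mul, Complex.norm_real, Real.norm_of_nonneg (Real.exp_pos _).le]
    calc Real.exp (-h'' * i.den) * _ ≤ Real.exp (-h'' * i.den) * (K * Real.exp (h' * i.den)) := by
          gcongr
          exact hcosh i trivial _ hx.1.le hx.2.le
      _ = K * (Real.exp (-h'' * i.den) * Real.exp (h' * i.den)) := by ring
      _ = _ := by rw [← Real.exp_add, pow_zero, one_mul]; ring_nf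
  · intro i z hz
    rw [mem_ball_zero_iff] at hz
    rw [norm_mul, norm_mul, norm_pow, Complex.norm_real, Real.norm_of_nonneg (Real.exp_pos _).le]
    calc ‖i.coeff α‖ * ‖z‖ ^ i.den * Real.exp (h'' * i.den)
        ≤ C * i.den * Real.exp (-h) ^ i.den * Real.exp (h'' * i.den) := by
          gcongr
          exact hcoeff i
      _ = C * (i.den * (Real.exp (i.den * -h) * Real.exp (h'' * i.den))) := by
          rw [← Real.exp_nat_mul]; ring
      _ = _ := by rw [← Real.exp_add, pow_one]; ring_nf

theorem _root_.HasSum.congr_fun_eq {ι E : Type*} [NormedAddCommGroup E] {f g : ι → E} {a : E}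
    (h : HasSum f a) (e : ∀ i, f i = g i) : HasSum g a := by
  rwa [← funext e]

theorem expCoeff_eq {α : ℝ} (n : ℕ) (i : Idx) :
    expCoeff α n i = i.coeff α * ((i.root - circlePt α)⁻¹) ^ n := by
  rw [expCoeff, Idx.coeff, pow_succ, mul_inv, inv_pow]
  ring

theorem IsQuadraticIrrational.hasSum_asympCoeff_apply {α r : ℝ} (hα : IsQuadraticIrrational α)
    (hr0 : 0 < r) (hr1 : r < 1) (n : ℕ) (z : ball (0 : ℂ) r) :
    HasSum (fun i : Idx => expCoeff α n i * (z : ℂ) ^ i.den)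
      ((asympCoeff α r n : ball (0 : ℂ) r →ᵇ ℂ) z) := by
  have h := ((BoundedContinuousFunction.evalCLM ℂ z).comp (Br r).subtypeL).hasSum
    (hα.summable_expCoeff_smul hr0 hr1 n).hasSum
  have e : (fun i : Idx => expCoeff α n i * (z : ℂ) ^ i.den) = fun i : Idx =>
      ((BoundedContinuousFunction.evalCLM ℂ z).comp (Br r).subtypeL)
        (expCoeff α n i • monomial r i.1) := by
    funext i
    simp [monomial, Idx.den]
  rw [e]
  exact h

/-- A double series summed in two ways: over `n` it gives the `cosh` terms, over the indices it
gives the Borel series of the coefficients. Absolute summability for small `ξ` permits the exchange.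
-/
theorem IsQuadraticIrrational.extendsBorel {α r : ℝ} (hα : IsQuadraticIrrational α)
    (hr0 : 0 < r) (hr1 : r < 1) : ExtendsBorel (asympCoeff α r) (borelSum α) := by
  obtain ⟨C, hC, hinv⟩ := hα.exists_le_norm_root_sub
  obtain ⟨C', hC', hcoeff⟩ := hα.exists_norm_coeff_le
  have hlog : Real.log r < 0 := Real.log_neg hr0 hr1
  have hsC : 0 < √C := Real.sqrt_pos.2 (by linarith)
  -- With this radius the hyperbolic cosine is at most `r^(-n/2)`, which leaves half of the decay of
  -- `r^n`.
  refine ⟨-Real.log r / 2 / √C, div_pos (by linarith) hsC, fun ξ hξ z => ?_⟩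
  rw [mem_ball_zero_iff, lt_div_iff₀ hsC] at hξ
  have hz : ‖(z : ℂ)‖ < r := mem_ball_zero_iff.1 z.2
  set f : Idx × ℕ → ℂ := fun p =>
    expCoeff α p.2 p.1 * (z : ℂ) ^ p.1.den * (ξ ^ (2 * p.2) / ((2 * p.2).factorial : ℂ)) with hf
  have hrow : ∀ i : Idx, HasSum (fun n => f (i, n)) (borelTerm α i (ξ, z)) := by
    intro i
    have h := (Complex.hasSum_cosh (rotFactor α * ξ * freq (i.err α))).mul_left
      (i.coeff α * (z : ℂ) ^ i.den)
    simp only [borelTerm]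
    refine h.congr_fun_eq fun n => ?_
    rw [show rotFactor α * ξ * freq (i.err α) = ξ * (rotFactor α * freq (i.err α)) by ring,
      mul_pow ξ, pow_mul (rotFactor α * freq (i.err α)), sq_rotFactor_mul_freq hα.1]
    simp only [hf]
    rw [expCoeff_eq]
    ring
  have hnorm : ∀ i : Idx, HasSum (fun n => ‖f (i, n)‖)
      (‖i.coeff α‖ * ‖(z : ℂ)‖ ^ i.den * Real.cosh (‖ξ‖ * √(‖i.root - circlePt α‖⁻¹))) := by
    intro i
    have h := (Real.hasSum_cosh (‖ξ‖ * √(‖i.root - circlePt α‖⁻¹))).mul_left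
      (‖i.coeff α‖ * ‖(z : ℂ)‖ ^ i.den)
    refine h.congr_fun_eq fun n => ?_
    simp only [hf]
    rw [expCoeff_eq, norm_mul, norm_mul, norm_mul, norm_div, norm_pow, norm_pow, norm_pow, norm_inv,
      Complex.norm_natCast, mul_pow, pow_mul (√_), Real.sq_sqrt (by positivity)]
    ring
  have hsummable : Summable f := by
    refine Summable.of_norm ?_
    rw [summable_prod_of_nonneg fun p => norm_nonneg _]
    refine ⟨fun i => (hnorm i).summable, ?_⟩
    refine Summable.of_nonneg_of_le (fun i => tsum_nonneg fun n => norm_nonneg _) (fun i => ?_)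
      ((summable_exp_mul_den (a := Real.log r / 2) (by linarith) 1).mul_left C')
    have hD := i.one_le_den
    rw [(hnorm i).tsum_eq]
    have hb : √(‖i.root - circlePt α‖⁻¹) ≤ √C * i.den := by
      calc _ ≤ √(C * (i.den : ℝ) ^ 2) := Real.sqrt_le_sqrt (hinv i)
        _ = _ := by rw [Real.sqrt_mul (by linarith), Real.sqrt_sq (by positivity)]
    have hch : Real.cosh (‖ξ‖ * √(‖i.root - circlePt α‖⁻¹)) ≤
        Real.exp (-Real.log r / 2 * i.den) := by
      have h0 : 0 ≤ ‖ξ‖ * √(‖i.root - circlePt α‖⁻¹) := by positivity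
      have h1 : Real.cosh (‖ξ‖ * √(‖i.root - circlePt α‖⁻¹)) ≤
          Real.exp (‖ξ‖ * √(‖i.root - circlePt α‖⁻¹)) := by
        rw [Real.cosh_eq]
        have : Real.exp (-(‖ξ‖ * √(‖i.root - circlePt α‖⁻¹))) ≤
            Real.exp (‖ξ‖ * √(‖i.root - circlePt α‖⁻¹)) := Real.exp_le_exp.2 (by linarith)
        linarith
      refine h1.trans (Real.exp_le_exp.2 ?_)
      calc ‖ξ‖ * √(‖i.root - circlePt α‖⁻¹) ≤ ‖ξ‖ * (√C * i.den) := by gcongr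
        _ = (‖ξ‖ * √C) * i.den := by ring
        _ ≤ _ := by gcongr
    calc ‖i.coeff α‖ * ‖(z : ℂ)‖ ^ i.den * Real.cosh (‖ξ‖ * √(‖i.root - circlePt α‖⁻¹))
        ≤ (C' * i.den) * r ^ i.den * Real.exp (-Real.log r / 2 * i.den) := by
          gcongr
          exact hcoeff i
      _ = (C' * i.den) * (Real.exp (i.den * Real.log r) * Real.exp (-Real.log r / 2 * i.den)) := by
          rw [Real.exp_nat_mul, Real.exp_log hr0]; ring
      _ = _ := by rw [← Real.exp_add, pow_one]; ring_nf
  have h1 : borelSum α (ξ, z) = ∑' p, f p := (hsummable.hasSum.prod_fiberwise hrow).tsum_eq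
  have hcol : ∀ n : ℕ, HasSum (fun i : Idx => f (i, n))
      ((asympCoeff α r n : ball (0 : ℂ) r →ᵇ ℂ) z * (ξ ^ (2 * n) / ((2 * n).factorial : ℂ))) := by
    intro n
    have h := (hα.hasSum_asympCoeff_apply hr0 hr1 n z).mul_right
      (ξ ^ (2 * n) / ((2 * n).factorial : ℂ))
    exact h.congr_fun_eq fun i => by simp only [hf]
  have hswap : HasSum (fun p : ℕ × Idx => f (p.2, p.1)) (∑' p, f p) :=
    (Equiv.prodComm ℕ Idx).hasSum_iff.2 hsummable.hasSum
  rw [h1]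
  exact hswap.prod_fiberwise hcol

/-! ### Natural boundaries -/

/-- A term of the Borel transform, in the rotated variable. -/
def rotTerm (α : ℝ) (z ζ : ℂ) (i : Idx) : ℂ :=
  i.coeff α * z ^ i.den * Complex.cosh (ζ * freq (i.err α))

theorem borelSum_eq_tsum_rotTerm (α : ℝ) (ξ z : ℂ) :
    borelSum α (ξ, z) = ∑' i, rotTerm α z (rotFactor α * ξ) i := rfl

theorem rotTerm_neg (α : ℝ) (z ζ : ℂ) : rotTerm α z (-ζ) = rotTerm α z ζ := by
  funext i
  rw [rotTerm, rotTerm, neg_mul, Complex.cosh_neg]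

/-- Good approximations have residues of order at least `n`; this is what makes the lacunary
coefficients unbounded at the edge. -/
theorem Idx.le_norm_coeff {α L : ℝ} {i : Idx} (hq : L / 2 ≤ i.quot α) :
    L / (4 * Real.pi) * i.den ≤ ‖i.coeff α‖ := by
  have hD := i.one_le_den
  have hpi := Real.pi_pos
  rcases (abs_nonneg (i.err α)).eq_or_lt with h0 | hx
  · have : i.quot α = 0 := by rw [Idx.quot, ← h0, mul_zero, inv_zero]
    have hL : L ≤ 0 := by linarith
    refine le_trans ?_ (norm_nonneg _)
    refine mul_nonpos_of_nonpos_of_nonneg (div_nonpos_of_nonpos_of_nonneg hL (by positivity))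
      (by positivity)
  have hpos : 0 < ‖i.root - circlePt α‖ := lt_of_lt_of_le (by linarith) (i.le_norm_root_sub α)
  rw [i.norm_coeff]
  calc L / (4 * Real.pi) * i.den = (L / 2) * (i.den / (2 * Real.pi)) := by field_simp; ring
    _ ≤ i.quot α * (i.den / (2 * Real.pi)) := by gcongr
    _ = (i.den : ℝ)⁻¹ * (2 * Real.pi * |i.err α|)⁻¹ := by rw [Idx.quot]; field_simp
    _ ≤ (i.den : ℝ)⁻¹ * ‖i.root - circlePt α‖⁻¹ := by
        gcongr
        exact i.norm_root_sub_le α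

/-- The unit `v` turns the edge into `Re (v ζ) = const` (`v = 1` for the right edge, `v = -i` for
the upper one). On `T` only the growing half of each `cosh` matters; the decaying half and the terms
off `T` are dominated by a fixed summable family. What remains is a lacunary sum of exponentials
centred at `ζ₀`, to which `lacunary_unbounded` applies. -/
theorem edge_unbounded {α L c C₁ h ε R : ℝ} {z v ζ₀ : ℂ} {T : Set Idx} {ρ : Idx → ℝ}
    (hα : IsQuadraticIrrational α) (hT : T.Infinite) (hL : 0 < L) (hc : 0 < c) (hC₁ : 0 ≤ C₁)
    (hh : 0 < h) (hz : ‖z‖ = Real.exp (-h)) (hv : ‖v‖ = 1)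
    (hfreq : ∀ i ∈ T, freq (i.err α) = v * sqrtPole (i.err α))
    (hquot : ∀ i ∈ T, L / 2 ≤ i.quot α)
    (hd : ∀ i ∈ T, |(√|i.err α|)⁻¹ - i.den * √L| ≤ C₁)
    (hsep : ∀ i ∈ T, ∀ j ∈ T, i ≠ j → c * i.den ≤ |(i.den : ℝ) - j.den|)
    (hbig : ∀ i ∈ T, 4 * (4 + C₁) ≤ c * √L * i.den)
    (hζ₀ : (v * ζ₀).re * √L = h) (hε : 0 < ε) (hρ : Summable ρ)
    (hrest : ∀ ζ, ‖ζ - ζ₀‖ < ε → ∀ i ∉ T, ‖rotTerm α z ζ i‖ ≤ ρ i)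
    (hsum : ∀ ζ, ‖ζ - ζ₀‖ < ε → (v * ζ).re < (v * ζ₀).re → Summable (rotTerm α z ζ))
    (hR : ∀ ζ, ‖ζ - ζ₀‖ < ε → (v * ζ).re < (v * ζ₀).re → ‖∑' i, rotTerm α z ζ i‖ ≤ R) : False := by
  classical
  obtain ⟨C₂, hC₂, hcoeff⟩ := hα.exists_norm_coeff_le
  have hsL : 0 < √L := Real.sqrt_pos.2 hL
  set σ₀ := (v * ζ₀).re with hσ₀
  have hσ₀pos : 0 < σ₀ := by
    by_contra hcon
    push Not at hcon
    nlinarith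
  set C := 4 + C₁ with hC
  set w : Idx → ℂ := fun i => sqrtPole (i.err α) with hw
  have hv0 : v ≠ 0 := norm_pos_iff.1 (by rw [hv]; exact one_pos)
  have hwd : ∀ i ∈ T, ‖w i - ((i.den * √L : ℝ) : ℂ)‖ ≤ C := by
    intro i hi
    calc ‖w i - ((i.den * √L : ℝ) : ℂ)‖
        = ‖(w i - ((√|i.err α|)⁻¹ : ℝ)) + (((√|i.err α|)⁻¹ - i.den * √L : ℝ) : ℂ)‖ := by
          congr 1; push_cast; ring
      _ ≤ 4 + C₁ := by
          refine (norm_add_le _ _).trans (add_le_add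
            (norm_sqrtPole_sub_le (i.err_ne_zero hα.1) (i.abs_err_le α)) ?_)
          rw [Complex.norm_real]
          exact hd i hi
  have hre : ∀ i ∈ T, ∀ ζ : ℂ, |(ζ * w i).re - ζ.re * (i.den * √L)| ≤ C * ‖ζ‖ := by
    intro i hi ζ
    have e : (ζ * w i).re - ζ.re * (i.den * √L) = (ζ * (w i - ((i.den * √L : ℝ) : ℂ))).re := by
      rw [mul_sub, Complex.sub_re, mul_comm ζ ((i.den * √L : ℝ) : ℂ), Complex.re_ofReal_mul]
      ring
    rw [e]
    calc _ ≤ ‖ζ * (w i - ((i.den * √L : ℝ) : ℂ))‖ := Complex.abs_re_le_norm _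
      _ = ‖ζ‖ * _ := norm_mul _ _
      _ ≤ ‖ζ‖ * C := by gcongr; exact hwd i hi
      _ = _ := mul_comm _ _
  have hzD : ∀ i : Idx, ‖z‖ ^ i.den = Real.exp (-h * i.den) := by
    intro i
    rw [hz, ← Real.exp_nat_mul, mul_comm]
  -- the neighbourhood on which everything is controlled
  set ε' := min ε σ₀ with hε'
  have hε'0 : 0 < ε' := lt_min hε hσ₀pos
  have hnn : ∀ ζ, ‖ζ - ζ₀‖ < ε' → 0 < (v * ζ).re ∧ ‖v * ζ‖ ≤ ‖ζ₀‖ + ε := by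
    intro ζ hζ
    have h1 : |(v * ζ).re - σ₀| ≤ ‖ζ - ζ₀‖ := by
      rw [hσ₀, ← Complex.sub_re, ← mul_sub]
      refine (Complex.abs_re_le_norm _).trans ?_
      rw [norm_mul, hv, one_mul]
    have h2 := (abs_le.1 h1).1
    have h3 : ε' ≤ σ₀ := min_le_right _ _
    have h4 : ε' ≤ ε := min_le_left _ _
    refine ⟨by linarith, ?_⟩
    rw [norm_mul, hv, one_mul]
    have := norm_sub_norm_le ζ ζ₀
    linarith
  set g : ℂ → Idx → ℂ := fun ζ i => T.indicator
    (fun i => i.coeff α * z ^ i.den / 2 * Complex.exp (v * ζ * w i)) i with hg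
  set ρ' : Idx → ℝ := fun i => |ρ i| + C₂ * Real.exp (C * (‖ζ₀‖ + ε)) *
    ((i.den : ℝ) ^ 1 * Real.exp (-h * i.den)) with hρ'
  have hρ's : Summable ρ' := hρ.abs.add ((summable_exp_mul_den (by linarith) 1).mul_left _)
  have hdiff : ∀ ζ, ‖ζ - ζ₀‖ < ε' → ∀ i, ‖rotTerm α z ζ i - g ζ i‖ ≤ ρ' i := by
    intro ζ hζ i
    have hD := i.one_le_den
    obtain ⟨hpos, hnb⟩ := hnn ζ hζ
    by_cases hi : i ∈ T
    · have e : rotTerm α z ζ i - g ζ i =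
          i.coeff α * z ^ i.den * (Complex.exp (-(v * ζ * w i)) / 2) := by
        simp only [hg, Set.indicator_of_mem hi, rotTerm]
        rw [hfreq i hi, Complex.cosh, show ζ * (v * sqrtPole (i.err α)) = v * ζ * w i by
          simp only [hw]; ring]
        ring
      rw [e, norm_mul, norm_mul, norm_pow, hzD, norm_div, Complex.norm_two, Complex.norm_exp]
      have h1 := (abs_le.1 (hre i hi (v * ζ))).1
      have h2 : 0 ≤ (v * ζ).re * (i.den * √L) := by positivity
      have h3 : C * ‖v * ζ‖ ≤ C * (‖ζ₀‖ + ε) := by gcongr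
      have h4 : Real.exp (-(v * ζ * w i)).re / 2 ≤ Real.exp (C * (‖ζ₀‖ + ε)) := by
        refine (half_le_self (Real.exp_pos _).le).trans (Real.exp_le_exp.2 ?_)
        rw [Complex.neg_re]
        linarith
      calc ‖i.coeff α‖ * Real.exp (-h * i.den) * (Real.exp (-(v * ζ * w i)).re / 2)
          ≤ (C₂ * i.den) * Real.exp (-h * i.den) * Real.exp (C * (‖ζ₀‖ + ε)) := by
            gcongr
            exact hcoeff i
        _ ≤ _ := by
            simp only [hρ', pow_one]
            have := abs_nonneg (ρ i)
            nlinarith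
    · simp only [hg, Set.indicator_of_notMem hi, sub_zero]
      refine (hrest ζ (hζ.trans_le (min_le_left _ _)) i hi).trans ((le_abs_self _).trans ?_)
      simp only [hρ']
      have : 0 ≤ C₂ * Real.exp (C * (‖ζ₀‖ + ε)) * ((i.den : ℝ) ^ 1 * Real.exp (-h * i.den)) := by
        positivity
      linarith
  have hgR : ∀ ζ, ‖ζ - ζ₀‖ < ε' → (v * ζ).re < σ₀ → ‖∑' i, g ζ i‖ ≤ R + ∑' i, ρ' i := by
    intro ζ hζ hlt
    have hζε := hζ.trans_le (min_le_left ε σ₀)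
    have s1 := hsum ζ hζε hlt
    have s2 : Summable fun i => rotTerm α z ζ i - g ζ i := Summable.of_norm_bounded hρ's (hdiff ζ hζ)
    have e : ∑' i, g ζ i = ∑' i, rotTerm α z ζ i - ∑' i, (rotTerm α z ζ i - g ζ i) := by
      rw [← s1.tsum_sub s2]
      refine tsum_congr fun i => ?_
      ring
    rw [e]
    exact (norm_sub_le _ _).trans (add_le_add (hR ζ hζε hlt)
      (tsum_of_norm_bounded hρ's.hasSum (hdiff ζ hζ)))
  -- At `ζ₀` the decay `exp (-h n)` of `z^n` is cancelled by the exponential up to bounded factors,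
  -- since `Re (v ζ₀) √L = h`; hence `b i` has the exact order of the denominator.
  set b : T → ℂ := fun i => (i : Idx).coeff α * z ^ (i : Idx).den / 2 *
    Complex.exp (v * ζ₀ * w i) with hb
  have hinj : ∀ i ∈ T, ∀ j ∈ T, i.den = j.den → i = j := by
    intro i hi j hj hij
    by_contra hne
    have := hsep i hi j hj hne
    rw [hij, sub_self, abs_zero] at this
    have := j.one_le_den
    nlinarith
  have hbnorm : ∀ i : T, ‖b i‖ = ‖(i : Idx).coeff α‖ / 2 *
      Real.exp ((v * ζ₀ * w i).re - σ₀ * ((i : Idx).den * √L)) := by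
    intro i
    simp only [hb]
    rw [norm_mul, norm_div, norm_mul, norm_pow, hzD, Complex.norm_two, Complex.norm_exp]
    have : (v * ζ₀ * w i).re - σ₀ * ((i : Idx).den * √L) =
        -h * (i : Idx).den + (v * ζ₀ * w i).re := by rw [← hζ₀]; ring
    rw [this, Real.exp_add]
    ring
  refine lacunary_unbounded (b := b) (w := fun i : T => w i)
    (d := fun i : T => (i : Idx).den * √L) (C := C) (c := c / 2)
    (K := C₂ / 2 * Real.exp (C * ‖v * ζ₀‖) / √L) (ε := ε')
    (R := R + ∑' i, ρ' i) ?_ (fun i => hwd i i.2) (by positivity) (by positivity) (by positivity)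
    ?_ ?_ ?_ ?_ hε'0 ?_
  · intro i
    have := (i : Idx).one_le_den
    positivity
  -- Replacing frequencies by `n √L` costs `2 C`, and `hbig` makes this at most half of the
  -- separation: hence the constant `c / 2`.
  · rintro ⟨i, hi⟩ ⟨j, hj⟩ hne
    have hne' : i ≠ j := fun h => hne (Subtype.ext h)
    have h1 := hsep i hi j hj hne'
    have h2 := hbig i hi
    have e : ((i.den * √L : ℝ) : ℂ) - ((j.den * √L : ℝ) : ℂ) =
        (w i - w j) - (w i - ((i.den * √L : ℝ) : ℂ)) + (w j - ((j.den * √L : ℝ) : ℂ)) := by ring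
    have h3 : ‖((i.den * √L : ℝ) : ℂ) - ((j.den * √L : ℝ) : ℂ)‖ ≤ ‖w i - w j‖ + C + C := by
      rw [e]
      refine (norm_add_le _ _).trans (add_le_add ((norm_sub_le _ _).trans
        (add_le_add le_rfl (hwd i hi))) (hwd j hj))
    rw [← Complex.ofReal_sub, Complex.norm_real, Real.norm_eq_abs, ← sub_mul, abs_mul,
      abs_of_pos hsL] at h3
    have h4 : c * i.den * √L ≤ |(i.den : ℝ) - j.den| * √L := by gcongr
    simp only
    nlinarith
  · have h1 : Summable fun n : ℕ => 1 / (n : ℝ) ^ 2 := Real.summable_one_div_nat_pow.2 one_lt_two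
    have h2 : Function.Injective fun i : T => (i : Idx).den := by
      rintro ⟨i, hi⟩ ⟨j, hj⟩ hij
      exact Subtype.ext (hinj i hi j hj hij)
    refine ((h1.comp_injective h2).mul_left (1 / L)).congr fun i => ?_
    simp only [Function.comp]
    rw [mul_pow, Real.sq_sqrt hL.le]
    field_simp
  · intro i
    have hD := (i : Idx).one_le_den
    rw [hbnorm]
    have h1 := (abs_le.1 (hre i i.2 (v * ζ₀))).2
    calc ‖(i : Idx).coeff α‖ / 2 * Real.exp ((v * ζ₀ * w i).re - σ₀ * ((i : Idx).den * √L))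
        ≤ (C₂ * (i : Idx).den) / 2 * Real.exp (C * ‖v * ζ₀‖) := by
          gcongr
          exact hcoeff i
      _ = _ := by field_simp
  · intro M
    have himg : ((fun i : Idx => i.den) '' T).Infinite :=
      hT.image fun i hi j hj hij => hinj i hi j hj hij
    set k := L / (4 * Real.pi) / 2 * Real.exp (-(C * ‖v * ζ₀‖)) with hk
    have hk0 : 0 < k := by have := Real.pi_pos; positivity
    obtain ⟨n, hn⟩ := exists_nat_gt (M / k)
    obtain ⟨_, ⟨i, hi, rfl⟩, hni⟩ := himg.exists_gt n
    refine ⟨⟨i, hi⟩, ?_⟩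
    rw [hbnorm]
    have h1 := (abs_le.1 (hre i hi (v * ζ₀))).1
    have hni' : (n : ℝ) < i.den := by exact_mod_cast hni
    rw [div_lt_iff₀ hk0] at hn
    calc M < n * k := hn
      _ ≤ i.den * k := by gcongr
      _ = L / (4 * Real.pi) * i.den / 2 * Real.exp (-(C * ‖v * ζ₀‖)) := by rw [hk]; ring
      _ ≤ _ := by
        gcongr
        exact Idx.le_norm_coeff (hquot i hi)
  · intro ζ' hre' hn'
    have hvv : v * (ζ₀ + v⁻¹ * ζ') = v * ζ₀ + ζ' := by field_simp
    have h1 := hgR (ζ₀ + v⁻¹ * ζ')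
      (by rw [add_sub_cancel_left, norm_mul, norm_inv, hv, inv_one, one_mul]; exact hn')
      (by rw [hvv, Complex.add_re]; linarith)
    refine le_trans (le_of_eq ?_) h1
    congr 1
    simp only [hg]
    rw [← tsum_subtype]
    refine tsum_congr fun i => ?_
    rw [hvv, add_mul, Complex.exp_add, ← mul_assoc]

theorem abs_sqrt_sub_sqrt_le {a b : ℝ} (ha : 0 ≤ a) (hb : 0 < b) :
    |√a - √b| ≤ |a - b| / √b := by
  have hs := Real.sqrt_pos.2 hb
  rw [le_div_iff₀ hs]
  have e : a - b = (√a - √b) * (√a + √b) := by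
    have h1 := Real.sq_sqrt ha
    have h2 := Real.sq_sqrt hb.le
    linear_combination -h1 + h2
  rw [e, abs_mul, abs_of_pos (by positivity : 0 < √a + √b)]
  gcongr
  linarith [Real.sqrt_nonneg a]

/-- The extremal approximations, in terms of indices. -/
theorem IsQuadraticIrrational.exists_extremal_idx {α β : ℝ} (hβ : IsQuadraticIrrational β)
    {f : Idx → ℕ+ × ℤ} (hinj : Function.Injective f) (hden : ∀ i, ((f i).1 : ℕ) = i.den)
    (hrange : ∀ p, |approxErr β p| < 1 / 2 → ∃ i, f i = p)
    (herr : ∀ i, |approxErr β (f i)| = |i.err α|) :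
    ∃ (T : Set Idx) (C₁ θ c : ℝ), T.Infinite ∧ 0 ≤ C₁ ∧ 0 < θ ∧ θ < 1 ∧ 0 < c ∧
      (∀ i ∈ T, 0 < approxErr β (f i) ∧ approxLim β / 2 ≤ i.quot α ∧
        |(√|i.err α|)⁻¹ - i.den * √(approxLim β)| ≤ C₁ ∧
        4 * (4 + C₁) ≤ c * √(approxLim β) * i.den) ∧
      (∀ᶠ i in cofinite, i ∉ T → 0 < approxErr β (f i) → i.quot α ≤ θ * approxLim β) ∧
      ∀ i ∈ T, ∀ j ∈ T, i ≠ j → c * i.den ≤ |(i.den : ℝ) - j.den| := by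
  obtain ⟨S, C, θ, c, hS, hC, hθ0, hθ1, hc, hval, hoff, hsep⟩ := hβ.exists_extremal_set
  have hL := hβ.approxLim_pos
  set L := approxLim β
  have hsL := Real.sqrt_pos.2 hL
  have hquot : ∀ i, 0 < approxErr β (f i) → i.quot α = approxQuot β (f i) := by
    intro i hi
    rw [Idx.quot, approxQuot_eq, ← herr, abs_of_pos hi, hden]
  set C₁ := C / √L with hC₁
  -- Two requirements on the denominator: it must absorb the perturbation of the frequencies, and
  -- make extremal errors smaller than `1/2` so that every such pair comes from an index.
  obtain ⟨D₀, hD₀⟩ := exists_nat_gt (max (4 * (4 + C₁) / (c * √L)) ((L / 2)⁻¹ * 2))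
  have hD₁ := (le_max_left _ _).trans_lt hD₀
  have hD₂ := (le_max_right _ _).trans_lt hD₀
  rw [div_lt_iff₀ (by positivity)] at hD₁
  refine ⟨{i | f i ∈ S ∧ D₀ ≤ i.den}, C₁, θ, c, ?_, by positivity, hθ0, hθ1, hc, ?_, ?_, ?_⟩
  · intro hfin
    refine hS (((hfin.image f).union (finite_le_approxQuot β (half_pos hL) D₀)).subset
      fun p hp => ?_)
    rcases le_total (p.1 : ℕ) D₀ with h | h
    · exact Or.inr ⟨(hval p hp).1, h⟩
    · left
      have hx := approxErr_of_le_approxQuot (half_pos hL) (hval p hp).1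
      have hD := one_le_pnat p.1
      have hDr : (D₀ : ℝ) ≤ (p.1 : ℕ) := by exact_mod_cast h
      have hlt : |approxErr β p| < 1 / 2 := by
        rw [abs_of_pos hx.1]
        refine hx.2.1.trans_lt ?_
        rw [div_lt_iff₀ (by positivity)]
        have : ((p.1 : ℕ) : ℝ) ≤ ((p.1 : ℕ) : ℝ) ^ 2 := le_self_pow₀ hD two_ne_zero
        linarith
      obtain ⟨i, rfl⟩ := hrange p hlt
      exact ⟨i, ⟨hp, by rw [← hden]; exact h⟩, rfl⟩
  · rintro i ⟨hi, hiD⟩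
    obtain ⟨h1, h2⟩ := hval _ hi
    have hpos := (approxErr_of_le_approxQuot (half_pos hL) h1).1
    have hD := i.one_le_den
    have hDr : (D₀ : ℝ) ≤ i.den := by exact_mod_cast hiD
    have hq := hquot i hpos
    refine ⟨hpos, by rw [hq]; exact h1, ?_, ?_⟩
    -- The quality is `L + O(n⁻²)` on extremal pairs, so `n √quot - n √L` is even `O(1/n)`.
    · rw [i.inv_sqrt_abs_err, ← mul_sub, abs_mul, abs_of_pos (by positivity : (0 : ℝ) < i.den)]
      have h3 := abs_sqrt_sub_sqrt_le (a := i.quot α) (b := L)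
        (by rw [hq]; linarith) hL
      rw [hden] at h2
      calc (i.den : ℝ) * |√(i.quot α) - √L| ≤ i.den * (|i.quot α - L| / √L) := by gcongr
        _ ≤ i.den * ((C / (i.den : ℝ) ^ 2) / √L) := by gcongr; rw [hq]; exact h2
        _ = C₁ / i.den := by rw [hC₁]; field_simp
        _ ≤ C₁ := div_le_self (by positivity) hD
    · calc 4 * (4 + C₁) ≤ D₀ * (c * √L) := hD₁.le
        _ ≤ i.den * (c * √L) := by gcongr
        _ = _ := mul_comm _ _
  · have hfin := finite_le_approxQuot β (half_pos hL) D₀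
    have h1 : ∀ᶠ p in cofinite, ¬(L / 2 ≤ approxQuot β p ∧ (p.1 : ℕ) ≤ D₀) :=
      hfin.eventually_cofinite_notMem
    filter_upwards [hinj.tendsto_cofinite.eventually (hoff.and h1)] with i hi hiT hpos
    rw [hquot i hpos]
    apply hi.1
    intro hiS
    apply hiT
    refine ⟨hiS, ?_⟩
    by_contra hcon
    exact hi.2 ⟨(hval _ hiS).1, by rw [hden]; omega⟩
  · rintro i ⟨hi, -⟩ j ⟨hj, -⟩ hne
    have := hsep _ hi _ hj (hinj.ne hne)
    rwa [hden, hden] at this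

theorem approxErr_toPairNeg (α : ℝ) (i : Idx) : approxErr (-α) (i.toPairNeg α) = -i.err α := by
  simp only [approxErr, Idx.toPairNeg, Idx.err]
  push_cast
  ring

theorem exists_toPairNeg_eq {α : ℝ} {p : ℕ+ × ℤ} (hp : |approxErr (-α) p| < 1 / 2) :
    ∃ i : Idx, i.toPairNeg α = p := by
  have h : |approxErr α (p.1, -p.2)| < 1 / 2 := by
    have e : approxErr α (p.1, -p.2) = -approxErr (-α) p := by
      simp only [approxErr]
      push_cast
      ring
    rwa [e, abs_neg]
  obtain ⟨i, hi⟩ := Idx.exists_toPair_eq h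
  refine ⟨i, ?_⟩
  rw [Idx.toPairNeg, hi]
  simp

/-! ### Edges and corners of the rectangle -/

section

variable {α h : ℝ} {z : ℂ}

/-- A uniform summable bound for families of terms of the Borel transform. -/
theorem IsQuadraticIrrational.exists_summable_bound (hα : IsQuadraticIrrational α)
    (hz : ‖z‖ = Real.exp (-h)) {P : Idx → Prop} {k₁ k₂ A B : ℝ}
    (hA : 0 ≤ A) (hB : 0 ≤ B) (hAh : A * √k₁ < h) (hBh : B * √k₂ < h)
    (e₁ : ∀ᶠ i : Idx in cofinite, P i → 0 < i.err α → i.quot α ≤ k₁)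
    (e₂ : ∀ᶠ i : Idx in cofinite, P i → i.err α < 0 → i.quot α ≤ k₂) :
    ∃ ρ : Idx → ℝ, Summable ρ ∧ ∀ ζ : ℂ, |ζ.re| ≤ A → |ζ.im| ≤ B → ∀ i, P i →
      ‖rotTerm α z ζ i‖ ≤ ρ i := by
  obtain ⟨K, h', hK, hh', hcosh⟩ := exists_norm_cosh_le hα.1 hA hB hAh hBh e₁ e₂
  obtain ⟨C, hC, hcoeff⟩ := hα.exists_norm_coeff_le
  refine ⟨fun i => C * K * ((i.den : ℝ) ^ 1 * Real.exp ((h' - h) * i.den)),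
    (summable_exp_mul_den (by linarith) 1).mul_left _, fun ζ hre him i hi => ?_⟩
  rw [rotTerm, norm_mul, norm_mul, norm_pow, hz, ← Real.exp_nat_mul]
  calc ‖i.coeff α‖ * Real.exp (i.den * -h) * ‖Complex.cosh (ζ * freq (i.err α))‖
      ≤ (C * i.den) * Real.exp (i.den * -h) * (K * Real.exp (h' * i.den)) := by
        gcongr
        · exact hcoeff i
        · exact hcosh i hi ζ hre him
    _ = C * K * (i.den * (Real.exp (i.den * -h) * Real.exp (h' * i.den))) := by ring
    _ = _ := by simp only [pow_one]; rw [← Real.exp_add]; ring_nf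

theorem IsQuadraticIrrational.summable_rotTerm (hα : IsQuadraticIrrational α)
    (hz : ‖z‖ = Real.exp (-h)) {ζ : ℂ} (hre : |ζ.re| < kappaPlus α * h)
    (him : |ζ.im| < kappaMinus α * h) : Summable (rotTerm α z ζ) := by
  rw [kappaPlus_eq] at hre
  rw [kappaMinus_eq] at him
  obtain ⟨k₁, hk₁, h₁⟩ := exists_gt_mul_sqrt_lt hα.approxLim_pos hre
  obtain ⟨k₂, hk₂, h₂⟩ := exists_gt_mul_sqrt_lt hα.neg.approxLim_pos him
  obtain ⟨ρ, hρ, hb⟩ := hα.exists_summable_bound hz (P := fun _ => True) (abs_nonneg _)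
    (abs_nonneg _) h₁ h₂ ((hα.eventually_quot_le_of_pos hk₁).mono fun i hi _ => hi)
    ((hα.eventually_quot_le_of_neg hk₂).mono fun i hi _ => hi)
  exact Summable.of_norm_bounded hρ fun i => hb ζ le_rfl le_rfl i trivial

theorem exists_radius {A B ε₀ : ℝ} {ζ₀ : ℂ} (hε₀ : 0 < ε₀) (hA : |ζ₀.re| < A) (hB : |ζ₀.im| < B) :
    ∃ ε, 0 < ε ∧ ε ≤ ε₀ ∧ ∀ ζ : ℂ, ‖ζ - ζ₀‖ < ε → |ζ.re| < A ∧ |ζ.im| < B := by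
  refine ⟨min ε₀ (min (A - |ζ₀.re|) (B - |ζ₀.im|)), by
    refine lt_min hε₀ (lt_min ?_ ?_) <;> linarith, min_le_left _ _, fun ζ hζ => ?_⟩
  have h1 : ‖ζ - ζ₀‖ < A - |ζ₀.re| := hζ.trans_le ((min_le_right _ _).trans (min_le_left _ _))
  have h2 : ‖ζ - ζ₀‖ < B - |ζ₀.im| := hζ.trans_le ((min_le_right _ _).trans (min_le_right _ _))
  have h3 := Complex.abs_re_le_norm (ζ - ζ₀)
  have h4 := Complex.abs_im_le_norm (ζ - ζ₀)
  rw [Complex.sub_re] at h3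
  rw [Complex.sub_im] at h4
  have h5 := abs_sub_abs_le_abs_sub ζ.re ζ₀.re
  have h6 := abs_sub_abs_le_abs_sub ζ.im ζ₀.im
  constructor <;> linarith

/-- The gap `θ < 1` leaves a strip beyond the edge in which the non-extremal terms still converge.
-/
theorem exists_between_of_lt_one {θ L h : ℝ} (hL : 0 < L) (hθ0 : 0 < θ) (hθ1 : θ < 1) (hh : 0 < h) :
    ∃ A, (√L)⁻¹ * h < A ∧ A * √(θ * L) < h := by
  have hsL := Real.sqrt_pos.2 hL
  have hsθ := Real.sqrt_pos.2 hθ0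
  have hsθ1 : √θ < 1 := by rw [Real.sqrt_lt' one_pos]; linarith
  obtain ⟨A, hA1, hA2⟩ := exists_between (a₁ := (√L)⁻¹ * h) (a₂ := (√L)⁻¹ * h / √θ) (by
    rw [lt_div_iff₀ hsθ]
    exact mul_lt_of_lt_one_right (by positivity) hsθ1)
  refine ⟨A, hA1, ?_⟩
  rw [Real.sqrt_mul hθ0.le]
  calc A * (√θ * √L) < (√L)⁻¹ * h / √θ * (√θ * √L) := by gcongr
    _ = h := by field_simp

theorem IsQuadraticIrrational.right_edge_unbounded (hα : IsQuadraticIrrational α) (hh : 0 < h)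
    (hz : ‖z‖ = Real.exp (-h)) {ζ₀ : ℂ} (hre : ζ₀.re = kappaPlus α * h)
    (him : |ζ₀.im| < kappaMinus α * h) {ε R : ℝ} (hε : 0 < ε)
    (hR : ∀ ζ, ‖ζ - ζ₀‖ < ε → |ζ.re| < kappaPlus α * h → |ζ.im| < kappaMinus α * h →
      ‖∑' i, rotTerm α z ζ i‖ ≤ R) : False := by
  have hL := hα.approxLim_pos
  have hsL := Real.sqrt_pos.2 hL
  obtain ⟨T, C₁, θ, c, hT, hC₁, hθ0, hθ1, hc, hval, hoff, hsep⟩ :=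
    hα.exists_extremal_idx (α := α) (Idx.toPair_injective α) (fun i => i.toPair_fst α)
      (fun p hp => Idx.exists_toPair_eq hp) (fun i => rfl)
  obtain ⟨A, hA1, hA2⟩ := exists_between_of_lt_one hL hθ0 hθ1 hh
  obtain ⟨B, hB1, hB2⟩ := exists_between him
  rw [kappaMinus_eq] at hB2
  obtain ⟨k₂, hk₂, hBk⟩ := exists_gt_mul_sqrt_lt hα.neg.approxLim_pos hB2
  rw [← kappaMinus_eq] at hB2
  have hκ : 0 < kappaPlus α := by rw [kappaPlus_eq]; positivity
  have hre0 : 0 < ζ₀.re := by rw [hre]; positivity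
  have hreA : |ζ₀.re| < A := by rw [abs_of_pos hre0, hre, kappaPlus_eq]; exact hA1
  obtain ⟨ρ, hρ, hb⟩ := hα.exists_summable_bound hz (P := fun i => i ∉ T)
    ((abs_nonneg _).trans hreA.le) ((abs_nonneg _).trans hB1.le) hA2 hBk hoff
    ((hα.eventually_quot_le_of_neg hk₂).mono fun i hi _ => hi)
  obtain ⟨ε', hε', hle, hrad⟩ := exists_radius (lt_min hε hre0) hreA hB1
  have hin : ∀ ζ, ‖ζ - ζ₀‖ < ε' → (1 * ζ).re < (1 * ζ₀).re →
      |ζ.re| < kappaPlus α * h ∧ |ζ.im| < kappaMinus α * h := by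
    intro ζ hζ hlt
    rw [one_mul, one_mul] at hlt
    refine ⟨?_, (hrad ζ hζ).2.trans hB2⟩
    have h1 := Complex.abs_re_le_norm (ζ - ζ₀)
    rw [Complex.sub_re] at h1
    have h2 := (abs_le.1 h1).1
    have h3 := hle.trans (min_le_right _ _)
    rw [← hre, abs_of_pos (by linarith)]
    exact hlt
  refine edge_unbounded (v := 1) (ζ₀ := ζ₀) (z := z) (R := R) (ρ := ρ) hα hT hL hc hC₁ hh hz
    norm_one (fun i hi => ?_) (fun i hi => (hval i hi).2.1) (fun i hi => (hval i hi).2.2.1) hsep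
    (fun i hi => (hval i hi).2.2.2) ?_ hε' hρ
    (fun ζ hζ i hi => hb ζ (hrad ζ hζ).1.le (hrad ζ hζ).2.le i hi)
    (fun ζ hζ hlt => hα.summable_rotTerm hz (hin ζ hζ hlt).1 (hin ζ hζ hlt).2)
    (fun ζ hζ hlt => hR ζ (hζ.trans_le (hle.trans (min_le_left _ _))) (hin ζ hζ hlt).1
      (hin ζ hζ hlt).2)
  · have : 0 < i.err α := (hval i hi).1
    rw [freq, if_pos this, one_mul]
  · rw [one_mul, hre, kappaPlus_eq]
    field_simp

/-- The counterpart of the right edge for approximations from below: the extremal set is that of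
`-α`, and `v = -i` makes the imaginary part play the role of the real part. -/
theorem IsQuadraticIrrational.upper_edge_unbounded (hα : IsQuadraticIrrational α) (hh : 0 < h)
    (hz : ‖z‖ = Real.exp (-h)) {ζ₀ : ℂ} (hre : |ζ₀.re| < kappaPlus α * h)
    (him : ζ₀.im = kappaMinus α * h) {ε R : ℝ} (hε : 0 < ε)
    (hR : ∀ ζ, ‖ζ - ζ₀‖ < ε → |ζ.re| < kappaPlus α * h → |ζ.im| < kappaMinus α * h →
      ‖∑' i, rotTerm α z ζ i‖ ≤ R) : False := by
  have hL := hα.neg.approxLim_pos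
  have hsL := Real.sqrt_pos.2 hL
  obtain ⟨T, C₁, θ, c, hT, hC₁, hθ0, hθ1, hc, hval, hoff, hsep⟩ :=
    hα.neg.exists_extremal_idx (α := α) (Idx.toPairNeg_injective α) (fun i => i.toPair_fst α)
      (fun p hp => exists_toPairNeg_eq hp) (fun i => by rw [approxErr_toPairNeg, abs_neg])
  simp only [approxErr_toPairNeg, neg_pos] at hval hoff
  obtain ⟨B, hB1, hB2⟩ := exists_between_of_lt_one hL hθ0 hθ1 hh
  obtain ⟨A, hA1, hA2⟩ := exists_between hre
  rw [kappaPlus_eq] at hA2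
  obtain ⟨k₁, hk₁, hAk⟩ := exists_gt_mul_sqrt_lt hα.approxLim_pos hA2
  rw [← kappaPlus_eq] at hA2
  have hκ : 0 < kappaMinus α := by rw [kappaMinus_eq]; positivity
  have him0 : 0 < ζ₀.im := by rw [him]; positivity
  have himB : |ζ₀.im| < B := by rw [abs_of_pos him0, him, kappaMinus_eq]; exact hB1
  obtain ⟨ρ, hρ, hb⟩ := hα.exists_summable_bound hz (P := fun i => i ∉ T)
    ((abs_nonneg _).trans hA1.le) ((abs_nonneg _).trans himB.le) hAk hB2
    ((hα.eventually_quot_le_of_pos hk₁).mono fun i hi _ => hi) hoff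
  obtain ⟨ε', hε', hle, hrad⟩ := exists_radius (lt_min hε him0) hA1 himB
  have hmul : ∀ ζ : ℂ, (-Complex.I * ζ).re = ζ.im := fun ζ => by simp
  have hin : ∀ ζ, ‖ζ - ζ₀‖ < ε' → (-Complex.I * ζ).re < (-Complex.I * ζ₀).re →
      |ζ.re| < kappaPlus α * h ∧ |ζ.im| < kappaMinus α * h := by
    intro ζ hζ hlt
    rw [hmul, hmul] at hlt
    refine ⟨(hrad ζ hζ).1.trans hA2, ?_⟩
    have h1 := Complex.abs_im_le_norm (ζ - ζ₀)
    rw [Complex.sub_im] at h1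
    have h2 := (abs_le.1 h1).1
    have h3 := hle.trans (min_le_right _ _)
    rw [← him, abs_of_pos (by linarith)]
    exact hlt
  refine edge_unbounded (v := -Complex.I) (ζ₀ := ζ₀) (z := z) (R := R) (ρ := ρ) hα hT hL hc hC₁ hh hz
    (by simp) (fun i hi => ?_) (fun i hi => (hval i hi).2.1) (fun i hi => (hval i hi).2.2.1) hsep
    (fun i hi => (hval i hi).2.2.2) ?_ hε' hρ
    (fun ζ hζ i hi => hb ζ (hrad ζ hζ).1.le (hrad ζ hζ).2.le i hi)
    (fun ζ hζ hlt => hα.summable_rotTerm hz (hin ζ hζ hlt).1 (hin ζ hζ hlt).2)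
    (fun ζ hζ hlt => hR ζ (hζ.trans_le (hle.trans (min_le_left _ _))) (hin ζ hζ hlt).1
      (hin ζ hζ hlt).2)
  · have : i.err α < 0 := (hval i hi).1
    rw [freq, if_neg (not_lt.2 this.le)]
  · rw [hmul, him, kappaMinus_eq]
    field_simp

/-- The Borel transform is unbounded near every boundary point of the rectangle. -/
theorem IsQuadraticIrrational.boundary_unbounded (hα : IsQuadraticIrrational α) (hh : 0 < h)
    (hz : ‖z‖ = Real.exp (-h)) {ζ₀ : ℂ} (hre : |ζ₀.re| ≤ kappaPlus α * h)
    (him : |ζ₀.im| ≤ kappaMinus α * h)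
    (hbd : |ζ₀.re| = kappaPlus α * h ∨ |ζ₀.im| = kappaMinus α * h) {ε R : ℝ} (hε : 0 < ε)
    (hR : ∀ ζ, ‖ζ - ζ₀‖ < ε → |ζ.re| < kappaPlus α * h → |ζ.im| < kappaMinus α * h →
      ‖∑' i, rotTerm α z ζ i‖ ≤ R) : False := by
  have hκ : 0 < kappaPlus α := by
    rw [kappaPlus_eq]; exact inv_pos.2 (Real.sqrt_pos.2 hα.approxLim_pos)
  have hκ' : 0 < kappaMinus α := by
    rw [kappaMinus_eq]; exact inv_pos.2 (Real.sqrt_pos.2 hα.neg.approxLim_pos)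
  -- Contracting the coordinate along the edge by `1 - t` moves a possible corner to a point
  -- interior to the edge, at distance less than `ε / 2`.
  obtain ⟨t, ht0, ht1, htε⟩ : ∃ t : ℝ, 0 < t ∧ t < 1 ∧ t * ‖ζ₀‖ < ε / 2 := by
    refine ⟨min (1 / 2) (ε / (4 * (‖ζ₀‖ + 1))), by positivity, (min_le_left _ _).trans_lt (by norm_num),
      ?_⟩
    calc min (1 / 2) (ε / (4 * (‖ζ₀‖ + 1))) * ‖ζ₀‖ ≤ ε / (4 * (‖ζ₀‖ + 1)) * (‖ζ₀‖ + 1) := by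
          gcongr
          · exact min_le_right _ _
          · linarith
      _ = ε / 4 := by field_simp
      _ < ε / 2 := by linarith
  have shrink : ∀ {x κ : ℝ}, |x| ≤ κ * h → 0 < κ → |(1 - t) * x| < κ * h := by
    intro x κ hx hκ
    rw [abs_mul, abs_of_pos (by linarith)]
    have : 0 < κ * h := by positivity
    nlinarith [abs_nonneg x]
  have hR' : ∀ s ζ₁ : ℂ, (s = 1 ∨ s = -1) → ‖s * ζ₁ - ζ₀‖ < ε / 2 → ∀ ζ, ‖ζ - ζ₁‖ < ε / 2 →
      |ζ.re| < kappaPlus α * h → |ζ.im| < kappaMinus α * h → ‖∑' i, rotTerm α z ζ i‖ ≤ R := by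
    intro s ζ₁ hs h1 ζ hζ h2 h3
    have hsn : ‖s‖ = 1 := by rcases hs with rfl | rfl <;> simp
    have hlt : ‖s * ζ - ζ₀‖ < ε := by
      calc ‖s * ζ - ζ₀‖ = ‖s * (ζ - ζ₁) + (s * ζ₁ - ζ₀)‖ := by congr 1; ring
        _ ≤ ‖s * (ζ - ζ₁)‖ + ‖s * ζ₁ - ζ₀‖ := norm_add_le _ _
        _ < ε := by rw [norm_mul, hsn, one_mul]; linarith
    rcases hs with rfl | rfl
    · rw [one_mul] at hlt
      exact hR ζ hlt h2 h3
    · rw [neg_one_mul] at hlt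
      have := hR (-ζ) hlt (by rwa [Complex.neg_re, abs_neg]) (by rwa [Complex.neg_im, abs_neg])
      rwa [rotTerm_neg] at this
  -- All terms are even in `ζ`, so a global sign change reduces the left and lower edges to the
  -- right and upper ones.
  have hs : ∀ x : ℝ, ∃ s : ℝ, (s = 1 ∨ s = -1) ∧ s * x = |x| ∧ s * s = 1 := by
    intro x
    rcases le_total 0 x with hx | hx
    · exact ⟨1, Or.inl rfl, by rw [abs_of_nonneg hx, one_mul], by norm_num⟩
    · exact ⟨-1, Or.inr rfl, by rw [abs_of_nonpos hx, neg_one_mul], by norm_num⟩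
  have himle : |ζ₀.im| ≤ ‖ζ₀‖ := Complex.abs_im_le_norm _
  have hrele : |ζ₀.re| ≤ ‖ζ₀‖ := Complex.abs_re_le_norm _
  rcases hbd with h1 | h1
  · obtain ⟨s, hs1, hs2, hs3⟩ := hs ζ₀.re
    have hsabs : |s| = 1 := by rcases hs1 with rfl | rfl <;> simp
    refine hα.right_edge_unbounded hh hz (ζ₀ := ⟨s * ζ₀.re, s * ((1 - t) * ζ₀.im)⟩) (ε := ε / 2)
      (R := R) (by simp only; rw [hs2, h1])
      (by simp only; rw [abs_mul, hsabs, one_mul]; exact shrink him hκ') (by positivity)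
      (hR' s _ (by rcases hs1 with rfl | rfl <;> simp) ?_)
    have e : (s : ℂ) * ⟨s * ζ₀.re, s * ((1 - t) * ζ₀.im)⟩ - ζ₀ = (-(t * ζ₀.im) : ℝ) * Complex.I := by
      apply Complex.ext
      · simp only [Complex.sub_re, Complex.re_ofReal_mul, Complex.I_re]
        linear_combination ζ₀.re * hs3
      · simp only [Complex.sub_im, Complex.im_ofReal_mul, Complex.I_im]
        linear_combination (1 - t) * ζ₀.im * hs3
    rw [e, norm_mul, Complex.norm_I, mul_one, Complex.norm_real, Real.norm_eq_abs, abs_neg, abs_mul,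
      abs_of_pos ht0]
    exact (mul_le_mul_of_nonneg_left himle ht0.le).trans_lt htε
  · obtain ⟨s, hs1, hs2, hs3⟩ := hs ζ₀.im
    have hsabs : |s| = 1 := by rcases hs1 with rfl | rfl <;> simp
    refine hα.upper_edge_unbounded hh hz (ζ₀ := ⟨s * ((1 - t) * ζ₀.re), s * ζ₀.im⟩) (ε := ε / 2)
      (R := R) (by simp only; rw [abs_mul, hsabs, one_mul]; exact shrink hre hκ)
      (by simp only; rw [hs2, h1]) (by positivity)
      (hR' s _ (by rcases hs1 with rfl | rfl <;> simp) ?_)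
    have e : (s : ℂ) * ⟨s * ((1 - t) * ζ₀.re), s * ζ₀.im⟩ - ζ₀ = (-(t * ζ₀.re) : ℝ) := by
      apply Complex.ext
      · simp only [Complex.sub_re, Complex.re_ofReal_mul, Complex.ofReal_re]
        linear_combination (1 - t) * ζ₀.re * hs3
      · simp only [Complex.sub_im, Complex.im_ofReal_mul, Complex.ofReal_im]
        linear_combination ζ₀.im * hs3
    rw [e, Complex.norm_real, Real.norm_eq_abs, abs_neg, abs_mul, abs_of_pos ht0]
    exact (mul_le_mul_of_nonneg_left hrele ht0.le).trans_lt htε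

end

/-- An analytic continuation would be bounded on a compact disk around the boundary point, whereas
the sum is unbounded near it inside the rectangle. -/
theorem IsQuadraticIrrational.hasNaturalBoundary {α : ℝ} (hα : IsQuadraticIrrational α) {z : ℂ}
    (hz : ‖z‖ < 1) : HasNaturalBoundary (fun ξ => borelSum α (ξ, z)) (REC α z) := by
  refine ⟨fun ξ hξ => ?_, fun w hw ε hε => ?_⟩
  · exact AnalyticAt.fun_comp (g := borelSum α) (f := fun ξ : ℂ => (ξ, z))
      (hα.analyticAt_borelSum (p := (ξ, z)) hξ) (analyticAt_id.prod analyticAt_const)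
  by_cases h0 : z = 0
  · have : REC α z = Set.univ := Set.eq_univ_of_forall fun ξ => Or.inl h0
    rw [this, frontier_univ] at hw
    exact absurd hw (Set.notMem_empty w)
  rintro ⟨g, hg, hgf⟩
  have hzp := norm_pos_iff.2 h0
  set h := Real.log (1 / ‖z‖) with hh
  have hh0 : 0 < h := Real.log_pos (by rw [lt_div_iff₀ hzp]; linarith)
  have hzh : ‖z‖ = Real.exp (-h) := by
    rw [hh, one_div, Real.log_inv, neg_neg, Real.exp_log hzp]
  have hREC : REC α z = {ξ | |(rotFactor α * ξ).re| < kappaPlus α * h ∧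
      |(rotFactor α * ξ).im| < kappaMinus α * h} := by
    ext ξ
    exact ⟨fun hξ => hξ.resolve_left h0, fun hξ => Or.inr hξ⟩
  have c1 : Continuous fun ξ : ℂ => |(rotFactor α * ξ).re| := by fun_prop
  have c2 : Continuous fun ξ : ℂ => |(rotFactor α * ξ).im| := by fun_prop
  have hopen : IsOpen (REC α z) := by
    rw [hREC]
    exact (isOpen_lt c1 continuous_const).inter (isOpen_lt c2 continuous_const)
  rw [hopen.frontier_eq] at hw
  have hcl : |(rotFactor α * w).re| ≤ kappaPlus α * h ∧ |(rotFactor α * w).im| ≤ kappaMinus α * h := by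
    have hclosed : IsClosed {ξ | |(rotFactor α * ξ).re| ≤ kappaPlus α * h ∧
        |(rotFactor α * ξ).im| ≤ kappaMinus α * h} :=
      (isClosed_le c1 continuous_const).inter (isClosed_le c2 continuous_const)
    refine closure_minimal ?_ hclosed hw.1
    rw [hREC]
    exact fun ξ hξ => ⟨hξ.1.le, hξ.2.le⟩
  have hbd : |(rotFactor α * w).re| = kappaPlus α * h ∨
      |(rotFactor α * w).im| = kappaMinus α * h := by
    by_contra hcon
    push Not at hcon
    apply hw.2
    rw [hREC]
    exact ⟨lt_of_le_of_ne hcl.1 hcon.1, lt_of_le_of_ne hcl.2 hcon.2⟩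
  have hcont : ContinuousOn g (closedBall w (ε / 2)) :=
    hg.continuousOn.mono (closedBall_subset_ball (by linarith))
  obtain ⟨R, hR⟩ := (isCompact_closedBall w (ε / 2)).exists_bound_of_continuousOn hcont
  have hc := rotFactor_ne_zero α
  have hcn := norm_pos_iff.2 hc
  refine hα.boundary_unbounded hh0 hzh hcl.1 hcl.2 hbd (ε := ε / 2 * ‖rotFactor α‖) (R := R)
    (by positivity) fun ζ hζ h1 h2 => ?_
  set ξ := (rotFactor α)⁻¹ * ζ with hξ
  have hζξ : rotFactor α * ξ = ζ := by rw [hξ, mul_inv_cancel_left₀ hc]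
  have hdist : ‖ξ - w‖ < ε / 2 := by
    rw [← hζξ, ← mul_sub, norm_mul, mul_comm] at hζ
    exact lt_of_mul_lt_mul_right hζ hcn.le
  have hmem : ξ ∈ REC α z := by
    rw [hREC]
    change |(rotFactor α * ξ).re| < _ ∧ |(rotFactor α * ξ).im| < _
    rw [hζξ]
    exact ⟨h1, h2⟩
  have h3 := hR ξ (by rw [mem_closedBall, dist_eq_norm]; exact hdist.le)
  rw [hgf ⟨by rw [mem_ball, dist_eq_norm]; linarith, hmem⟩] at h3
  simp only [borelSum_eq_tsum_rotTerm, hζξ] at h3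
  exact h3

/-! ### Lower bounds for the asymptotic coefficients -/

/-- Cauchy's estimate on circles of radius `s < r`, then `s → r`, because elements of `Br r` are
controlled only in the open disk. -/
theorem norm_coeff_mul_pow_le {r : ℝ} (hr0 : 0 < r) {F : Br r} {c : ℕ → ℂ}
    (h : ∀ z : ball (0 : ℂ) r,
      HasSum (fun n : ℕ => c n * (z : ℂ) ^ (n + 1)) ((F : ball (0 : ℂ) r →ᵇ ℂ) z)) (n : ℕ) :
    ‖c n‖ * r ^ (n + 1) ≤ ‖F‖ := by
  obtain ⟨⟨g, hg, hgF⟩, -⟩ := F.2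
  -- The given series starts at `z^1`, so the Taylor coefficients are `c` shifted by one, with value
  -- `0` at index `0`.
  let d : ℕ → ℂ := fun n => Nat.casesOn n 0 c
  have hgb : ∀ z ∈ ball (0 : ℂ) r, ‖g z‖ ≤ ‖F‖ := fun z hz => by
    rw [← hgF ⟨z, hz⟩]
    exact BoundedContinuousFunction.norm_coe_le_norm (F : ball (0 : ℂ) r →ᵇ ℂ) ⟨z, hz⟩
  have hp : HasFPowerSeriesAt g (FormalMultilinearSeries.ofScalars ℂ d) 0 := by
    rw [hasFPowerSeriesAt_iff]
    filter_upwards [ball_mem_nhds (0 : ℂ) hr0] with z hz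
    rw [zero_add, ← hgF ⟨z, hz⟩]
    refine (hasSum_nat_add_iff' 1).1 ?_
    have := h ⟨z, hz⟩
    simp only [FormalMultilinearSeries.coeff_ofScalars, smul_eq_mul, Finset.sum_range_one]
    rw [show d 0 = 0 from rfl, mul_zero, sub_zero]
    exact this.congr_fun_eq fun n => mul_comm _ _
  have han : AnalyticAt ℂ g 0 := hp.analyticAt
  have heq := hp.eq_formalMultilinearSeries han.hasFPowerSeriesAt
  have hcoeff : c n = iteratedDeriv (n + 1) g 0 / ((n + 1).factorial : ℂ) := by
    have := congrArg (fun p => FormalMultilinearSeries.coeff p (n + 1)) heq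
    simpa only [FormalMultilinearSeries.coeff_ofScalars, d] using this
  have hs : ∀ s ∈ Set.Ioo 0 r, ‖c n‖ * s ^ (n + 1) ≤ ‖F‖ := by
    intro s hs
    have hsub : closedBall (0 : ℂ) s ⊆ ball 0 r := closedBall_subset_ball hs.2
    have hd : DiffContOnCl ℂ g (ball 0 s) :=
      (hg.mono (by rw [closure_ball _ hs.1.ne']; exact hsub)).diffContOnCl
    have := Complex.norm_iteratedDeriv_le_of_forall_mem_sphere_norm_le (n + 1) hs.1 hd
      fun z hz => hgb z (hsub (sphere_subset_closedBall hz))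
    rw [hcoeff, norm_div, Complex.norm_natCast]
    have hs0 := hs.1
    have hf : (0 : ℝ) < (n + 1).factorial := by positivity
    rw [div_mul_eq_mul_div, div_le_iff₀ hf]
    rw [le_div_iff₀ (by positivity)] at this
    linarith
  have ht : Tendsto (fun s : ℝ => ‖c n‖ * s ^ (n + 1)) (nhdsWithin r (Set.Iio r))
      (nhds (‖c n‖ * r ^ (n + 1))) :=
    ((continuous_const.mul (continuous_pow (n + 1))).tendsto r).mono_left nhdsWithin_le_nhds
  refine le_of_tendsto ht ?_
  filter_upwards [Ioo_mem_nhdsLT hr0] with s h using hs s h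

section

variable {α r : ℝ}

theorem IsQuadraticIrrational.norm_sum_expCoeff_mul_pow_le (hα : IsQuadraticIrrational α)
    (hr0 : 0 < r) (hr1 : r < 1) (m n : ℕ) :
    ‖∑ k : Fin (n + 1), expCoeff α m ⟨n, k⟩‖ * r ^ (n + 1) ≤ ‖asympCoeff α r m‖ := by
  refine norm_coeff_mul_pow_le hr0 (c := fun n => ∑ k : Fin (n + 1), expCoeff α m ⟨n, k⟩)
    (fun z => ?_) n
  refine (hα.hasSum_asympCoeff_apply hr0 hr1 m z).sigma fun n => ?_
  rw [Finset.sum_mul]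
  exact hasSum_fintype _

theorem norm_expCoeff (m : ℕ) (i : Idx) :
    ‖expCoeff α m i‖ = (i.den : ℝ)⁻¹ * ‖i.root - circlePt α‖⁻¹ ^ (m + 1) := by
  rw [expCoeff, norm_neg, norm_mul, norm_mul, i.norm_root, norm_inv, norm_inv,
    norm_pow, Complex.norm_natCast, one_mul, ← inv_pow]

/-- A root of unity of order `n + 1` much closer to `circlePt α` than `1 / (n + 1)` dominates the
other ones. -/
theorem le_norm_sum_expCoeff (hα : Irrational α) {m n Q : ℕ} (j : Fin (n + 1)) (hnQ : n + 1 ≤ Q)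
    (hj : (n + 1 : ℝ) * |Idx.err α ⟨n, j⟩| ≤ 1 / (Q + 1)) (hm : 1 ≤ m) (hQ : 20 ≤ Q) :
    2⁻¹ * ((n + 1 : ℝ)⁻¹ * ((n + 1) * (Q + 1) / (2 * Real.pi)) ^ (m + 1)) ≤
      ‖∑ k : Fin (n + 1), expCoeff α m ⟨n, k⟩‖ := by
  have hpi := Real.pi_pos
  have hQ' : (20 : ℝ) ≤ Q := by exact_mod_cast hQ
  have hnQ' : (n : ℝ) + 1 ≤ Q := by exact_mod_cast hnQ
  have hn0 : (0 : ℝ) < n + 1 := by positivity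
  have hden : ∀ k : Fin (n + 1), ((Idx.den ⟨n, k⟩ : ℕ) : ℝ) = n + 1 := fun k => by
    simp [Idx.den]
  -- `X Y` bounds the inverse distance of the close root from below. The numerators of the other
  -- roots differ from that of the close one by at least `1`, so their inverse distances are at most
  -- `X`.
  set X : ℝ := ((n : ℝ) + 1) / 2 with hX
  set Y : ℝ := ((Q : ℝ) + 1) / Real.pi with hY
  have hX0 : 0 < X := by positivity
  have hY0 : 0 < Y := by positivity
  have hmain : (n + 1 : ℝ)⁻¹ * (X * Y) ^ (m + 1) ≤ ‖expCoeff α m ⟨n, j⟩‖ := by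
    rw [norm_expCoeff, hden]
    have h0 := norm_pos_iff.2 (Idx.root_sub_ne_zero hα ⟨n, j⟩)
    gcongr
    rw [le_inv_comm₀ (by positivity) h0]
    refine (Idx.norm_root_sub_le α ⟨n, j⟩).trans ?_
    rw [hX, hY]
    have h2 : |Idx.err α ⟨n, j⟩| ≤ 1 / (Q + 1) / (n + 1) := by
      rw [le_div_iff₀ hn0]; linarith
    calc 2 * Real.pi * |Idx.err α ⟨n, j⟩| ≤ 2 * Real.pi * (1 / (Q + 1) / (n + 1)) := by gcongr
      _ = _ := by field_simp
  have hother : ∀ k ∈ Finset.univ.erase j, ‖expCoeff α m ⟨n, k⟩‖ ≤ (n + 1 : ℝ)⁻¹ * X ^ (m + 1) := by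
    intro k hk
    rw [Finset.mem_erase] at hk
    rw [norm_expCoeff, hden]
    have h0 := norm_pos_iff.2 (Idx.root_sub_ne_zero hα ⟨n, k⟩)
    gcongr
    rw [inv_le_comm₀ h0 hX0]
    refine le_trans ?_ (Idx.le_norm_root_sub α ⟨n, k⟩)
    have hne : (Idx.toPair α ⟨n, k⟩).2 ≠ (Idx.toPair α ⟨n, j⟩).2 := by
      intro he
      have : Idx.toPair α ⟨n, k⟩ = Idx.toPair α ⟨n, j⟩ := Prod.ext rfl he
      have := Idx.toPair_injective α this
      simp only [Sigma.mk.injEq, heq_eq_eq, true_and] at this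
      exact hk.1 this
    have h1 : (1 : ℝ) ≤ |((Idx.toPair α ⟨n, k⟩).2 : ℝ) - (Idx.toPair α ⟨n, j⟩).2| := by
      have := Int.one_le_abs (sub_ne_zero.2 hne)
      exact_mod_cast this
    have h2 : ((Idx.toPair α ⟨n, k⟩).2 : ℝ) - (Idx.toPair α ⟨n, j⟩).2 =
        (n + 1) * Idx.err α ⟨n, k⟩ - (n + 1) * Idx.err α ⟨n, j⟩ := by
      simp only [Idx.err, approxErr, Idx.toPair_fst, hden]
      field_simp
      ring
    have h3 : (1 : ℝ) / (Q + 1) ≤ 1 / 2 := by gcongr; linarith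
    have h4 := abs_sub ((n + 1) * Idx.err α ⟨n, k⟩) ((n + 1) * Idx.err α ⟨n, j⟩)
    rw [h2] at h1
    rw [abs_mul, abs_mul, abs_of_pos hn0] at h4
    have h5 : 1 / 2 ≤ (n + 1) * |Idx.err α ⟨n, k⟩| := by linarith
    rw [hX, inv_div, div_le_iff₀ hn0]
    linarith
  -- Here `Q ≥ 20` is used, through `2 Q π² ≤ (Q + 1)²` and `π² < 10`, and `m ≥ 1` makes the
  -- exponent at least `2`. The other roots then contribute at most half of the main term.
  have hratio : 2 * (n + 1) ≤ Y ^ (m + 1) := by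
    have hpi4 : Real.pi ^ 2 < 10 := by nlinarith [Real.pi_lt_d2]
    have hY1 : 1 ≤ Y := by rw [hY, le_div_iff₀ hpi]; linarith [Real.pi_lt_d2]
    calc 2 * ((n : ℝ) + 1) ≤ 2 * Q := by linarith
      _ ≤ Y ^ 2 := by
        rw [hY, div_pow, le_div_iff₀ (by positivity)]
        nlinarith
      _ ≤ _ := pow_le_pow_right₀ hY1 (by omega)
  have hsum : ‖∑ k ∈ Finset.univ.erase j, expCoeff α m ⟨n, k⟩‖ ≤ X ^ (m + 1) := by
    refine (norm_sum_le _ _).trans ((Finset.sum_le_card_nsmul _ _ _ hother).trans ?_)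
    rw [nsmul_eq_mul]
    have hc : ((Finset.univ.erase j).card : ℝ) ≤ n + 1 := by
      have := Finset.card_le_univ (Finset.univ.erase j)
      rw [Fintype.card_fin] at this
      exact_mod_cast this
    calc ((Finset.univ.erase j).card : ℝ) * ((n + 1 : ℝ)⁻¹ * X ^ (m + 1))
        ≤ (n + 1) * ((n + 1 : ℝ)⁻¹ * X ^ (m + 1)) := by gcongr
      _ = _ := by field_simp
  have hsplit := Finset.add_sum_erase Finset.univ (fun k => expCoeff α m ⟨n, k⟩) (Finset.mem_univ j)
  have htri : ‖expCoeff α m ⟨n, j⟩‖ - ‖∑ k ∈ Finset.univ.erase j, expCoeff α m ⟨n, k⟩‖ ≤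
      ‖∑ k : Fin (n + 1), expCoeff α m ⟨n, k⟩‖ := by
    rw [← hsplit]
    exact norm_sub_le_norm_add _ _
  have hxy : X ^ (m + 1) ≤ 2⁻¹ * ((n + 1 : ℝ)⁻¹ * (X * Y) ^ (m + 1)) := by
    calc X ^ (m + 1) = 2⁻¹ * ((n + 1 : ℝ)⁻¹ * (X ^ (m + 1) * (2 * (n + 1)))) := by field_simp
      _ ≤ 2⁻¹ * ((n + 1 : ℝ)⁻¹ * (X ^ (m + 1) * Y ^ (m + 1))) := by gcongr
      _ = _ := by rw [mul_pow]
  have he : (n + 1 : ℝ) * (Q + 1) / (2 * Real.pi) = X * Y := by rw [hX, hY]; field_simp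
  rw [he]
  linarith

/-- Dirichlet's theorem with `Q = m + 20` yields an order at most `Q`, and bad approximability
bounds it below by `c (Q + 1)`. The dominant root thus contributes about `Q^(2m) r^Q` up to
geometric factors; `Q` comparable to `m` gives `(2m)!`, and the `20` serves `le_norm_sum_expCoeff`.
-/
theorem IsQuadraticIrrational.exists_le_norm_asympCoeff (hα : IsQuadraticIrrational α)
    (hr0 : 0 < r) (hr1 : r < 1) : ∃ A b : ℝ, 0 < A ∧ 0 < b ∧ ∀ m : ℕ, 1 ≤ m →
      A * b ^ m * (2 * m).factorial ≤ ‖asympCoeff α r m‖ := by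
  obtain ⟨c, hc0, hc1, hc⟩ := hα.exists_le_abs_sub
  have hpi := Real.pi_pos
  refine ⟨2⁻¹ * (c / (2 * Real.pi)) * r ^ 20, c / (2 * Real.pi) * r / 4, by positivity,
    by positivity, fun m hm => ?_⟩
  obtain ⟨D, hD0, hDQ, hD⟩ := Real.exists_nat_abs_mul_sub_round_le α (n := m + 20) (by omega)
  obtain ⟨n, rfl⟩ : ∃ n, D = n + 1 := ⟨D - 1, by omega⟩
  set Q : ℕ := m + 20 with hQ
  set N : ℤ := round (((n + 1 : ℕ) : ℝ) * α) with hN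
  have hn0 : (0 : ℝ) < n + 1 := by positivity
  have hm1 : (1 : ℝ) ≤ m := by exact_mod_cast hm
  have hQr : (Q : ℝ) = m + 20 := by rw [hQ]; push_cast; ring
  have hn1 : (1 : ℝ) ≤ n + 1 := by linarith [(Nat.cast_nonneg n : (0 : ℝ) ≤ n)]
  have herr : (n + 1 : ℝ) * |approxErr α (n.succPNat, N)| = |((n + 1 : ℕ) : ℝ) * α - N| := by
    rw [abs_sub_comm, show (n + 1 : ℝ) * |approxErr α (n.succPNat, N)| =
      |(n + 1 : ℝ) * approxErr α (n.succPNat, N)| by rw [abs_mul, abs_of_pos hn0]]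
    congr 1
    simp only [approxErr, Nat.succPNat_coe, Nat.succ_eq_add_one]
    push_cast
    field_simp
  have hsmall : |approxErr α (n.succPNat, N)| < 1 / 2 := by
    have h1 : (1 : ℝ) / (Q + 1) < 1 / 2 := by
      apply one_div_lt_one_div_of_lt <;> linarith
    have h2 := abs_nonneg (approxErr α (n.succPNat, N))
    nlinarith
  obtain ⟨⟨n', j⟩, hi⟩ := Idx.exists_toPair_eq hsmall
  obtain rfl : n' = n := by
    have := congrArg (fun p => (p.1 : ℕ)) hi
    simp only [Idx.toPair_fst, Nat.succPNat_coe, Idx.den] at this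
    omega
  have hj : (n' + 1 : ℝ) * |Idx.err α ⟨n', j⟩| ≤ 1 / (Q + 1) := by
    rw [Idx.err, hi, herr]
    exact hD
  have hlow := le_norm_sum_expCoeff hα.1 (m := m) j hDQ hj hm (by omega)
  have hup := hα.norm_sum_expCoeff_mul_pow_le hr0 hr1 m n'
  have hcQ : c * (Q + 1) ≤ n' + 1 := by
    have h1 := hc (n' + 1) N (by omega)
    rw [abs_sub_comm] at h1
    have h2 : c ≤ (n' + 1 : ℝ) * (1 / (Q + 1)) := by
      refine h1.trans ?_
      push_cast at hD ⊢
      gcongr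
    rw [mul_one_div, le_div_iff₀ (by positivity)] at h2
    exact h2
  have hnQ : (n' + 1 : ℝ) ≤ Q := by exact_mod_cast hDQ
  have hfac : ((2 * m).factorial : ℝ) ≤ 4 ^ m * ((Q : ℝ) + 1) ^ (2 * m) := by
    have h1 : ((2 * m).factorial : ℝ) ≤ ((2 * m : ℕ) : ℝ) ^ (2 * m) := by
      exact_mod_cast Nat.factorial_le_pow (2 * m)
    refine h1.trans ?_
    rw [show (4 : ℝ) = 2 ^ 2 by norm_num, ← pow_mul, ← mul_pow]
    push_cast
    gcongr
    linarith
  have hr : r ^ (m + 20) ≤ r ^ (n' + 1) := pow_le_pow_of_le_one hr0.le hr1.le hDQ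
  refine le_trans ?_ ((mul_le_mul_of_nonneg_right hlow (by positivity)).trans hup)
  calc 2⁻¹ * (c / (2 * Real.pi)) * r ^ 20 * (c / (2 * Real.pi) * r / 4) ^ m * (2 * m).factorial
      ≤ 2⁻¹ * (c / (2 * Real.pi)) * r ^ 20 * (c / (2 * Real.pi) * r / 4) ^ m *
        (4 ^ m * ((Q : ℝ) + 1) ^ (2 * m)) := by gcongr
    _ = 2⁻¹ * ((c / (2 * Real.pi)) ^ (m + 1) * ((Q : ℝ) + 1) ^ (2 * m)) * r ^ (m + 20) := by
      rw [div_pow (c / (2 * Real.pi) * r), mul_pow, pow_succ (c / (2 * Real.pi)) m, pow_add r m]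
      field_simp
    _ ≤ 2⁻¹ * ((n' + 1 : ℝ)⁻¹ * ((n' + 1) * (Q + 1) / (2 * Real.pi)) ^ (m + 1)) *
        r ^ (n' + 1) := by
      gcongr 2⁻¹ * ?_ * ?_
      rw [inv_mul_eq_div, le_div_iff₀ hn0]
      calc (c / (2 * Real.pi)) ^ (m + 1) * ((Q : ℝ) + 1) ^ (2 * m) * (n' + 1)
          ≤ (c / (2 * Real.pi)) ^ (m + 1) * ((Q : ℝ) + 1) ^ (2 * m) * (Q + 1) ^ 2 := by
            gcongr
            nlinarith
        _ = (c * (Q + 1) * (Q + 1) / (2 * Real.pi)) ^ (m + 1) := by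
            generalize (Q : ℝ) + 1 = x
            ring
        _ ≤ _ := by gcongr

end

/-! ### Flat functions -/

/-- The square root takes the right half-plane into the sector `|Im y| ≤ Re y`. -/
theorem norm_le_two_mul_re_cpow_half {w : ℂ} (hw : 0 < w.re) :
    ‖w ^ (1 / 2 : ℂ)‖ ^ 2 = ‖w‖ ∧ ‖w ^ (1 / 2 : ℂ)‖ ≤ 2 * (w ^ (1 / 2 : ℂ)).re := by
  have hw0 : w ≠ 0 := fun h => by simp [h] at hw
  set y := w ^ (1 / 2 : ℂ) with hy
  have hsq : y ^ 2 = w := by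
    rw [hy, ← Complex.cpow_nat_mul]
    norm_num
  have hre : 0 ≤ y.re := by
    rw [hy, Complex.cpow_def_of_ne_zero hw0, Complex.exp_re]
    refine mul_nonneg (Real.exp_pos _).le (Real.cos_nonneg_of_mem_Icc ?_)
    have h1 := Complex.neg_pi_lt_arg w
    have h2 := Complex.arg_le_pi w
    have : (Complex.log w * (1 / 2)).im = w.arg / 2 := by
      rw [show (1 / 2 : ℂ) = ((1 / 2 : ℝ) : ℂ) by push_cast; ring, Complex.im_mul_ofReal,
        Complex.log_im]
      ring
    rw [this]
    constructor <;> linarith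
  refine ⟨by rw [← norm_pow, hsq], ?_⟩
  have h1 : w.re = y.re ^ 2 - y.im ^ 2 := by rw [← hsq, sq, Complex.mul_re]; ring
  refine le_of_sq_le_sq ?_ (by linarith)
  rw [Complex.sq_norm, Complex.normSq_apply]
  nlinarith [sq_nonneg y.re]

/-- With `y = v^(-1/2)` in the sector `|Im y| ≤ Re y`, the left side is at most `exp (-‖y‖/2)`.
Comparison with the `2N`th term of the exponential series gives the factorial, and `4^N = 2^(2N)`
comes from the rate `1/2`. -/
theorem norm_exp_neg_cpow_half_le {v : ℂ} (hv : 0 < v.re) (N : ℕ) :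
    ‖Complex.exp (-(v⁻¹ ^ (1 / 2 : ℂ)))‖ ≤ 4 ^ N * (2 * N).factorial * ‖v‖ ^ N := by
  have hv0 : v ≠ 0 := fun h => by simp [h] at hv
  have hw : 0 < (v⁻¹).re := by
    rw [Complex.inv_re]
    exact div_pos hv (Complex.normSq_pos.2 hv0)
  obtain ⟨h1, h2⟩ := norm_le_two_mul_re_cpow_half hw
  set y := v⁻¹ ^ (1 / 2 : ℂ)
  have h3 := pow_le_factorial_mul_exp (by norm_num : (0 : ℝ) < 1 / 2) (norm_nonneg y) (2 * N)
  rw [pow_mul, h1, norm_inv] at h3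
  have hvn := norm_pos_iff.2 hv0
  rw [Complex.norm_exp, Complex.neg_re]
  have h4 : Real.exp (-y.re) ≤ Real.exp (-(1 / 2 * ‖y‖)) := Real.exp_le_exp.2 (by linarith)
  refine h4.trans ?_
  rw [Real.exp_neg, inv_le_iff_one_le_mul₀ (Real.exp_pos _)]
  have h5 : 1 ≤ ‖v‖ ^ N * ((2 * N).factorial / (1 / 2) ^ (2 * N) * Real.exp (1 / 2 * ‖y‖)) := by
    calc (1 : ℝ) = ‖v‖ ^ N * ‖v‖⁻¹ ^ N := by rw [← mul_pow, mul_inv_cancel₀ hvn.ne', one_pow]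
      _ ≤ _ := by gcongr
  refine h5.trans_eq ?_
  rw [pow_mul, show ((1 : ℝ) / 2) ^ 2 = 1 / 4 by norm_num, div_pow, one_pow]
  field_simp

theorem exists_tangentDisk_re_pos (σ : Side) {lam : ℂ} (hlam : ‖lam‖ = 1) :
    ∃ s : ℂ, ‖s‖ = 1 ∧ ∃ Δ ∈ tangentDisks σ lam, ∀ q ∈ Δ, 0 < (s * (q - lam)).re := by
  have hlam0 : lam ≠ 0 := fun h => by simp [h] at hlam
  have hinv : ‖lam⁻¹‖ = 1 := by rw [norm_inv, hlam, inv_one]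
  have key : ∀ v : ℂ, ‖v - ((1 / 2 : ℝ) : ℂ)‖ < 1 / 2 → 0 < v.re := by
    intro v hv
    have := (Complex.abs_re_le_norm _).trans_lt hv
    rw [Complex.sub_re, Complex.ofReal_re] at this
    linarith [(abs_lt.1 this).1]
  cases σ with
  | minus =>
    refine ⟨-lam⁻¹, by rw [norm_neg, hinv], _, ⟨1 / 2, by norm_num, by norm_num, rfl⟩,
      fun q hq => key _ ?_⟩
    rw [mem_ball, dist_eq_norm] at hq
    rw [show -lam⁻¹ * (q - lam) - ((1 / 2 : ℝ) : ℂ) =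
      -lam⁻¹ * (q - (1 - ((1 / 2 : ℝ) : ℂ)) * lam) by field_simp; ring, norm_mul, norm_neg, hinv,
      one_mul]
    exact hq
  | plus =>
    refine ⟨lam⁻¹, hinv, _, ⟨1 / 2, by norm_num, rfl⟩, fun q hq => key _ ?_⟩
    rw [mem_ball, dist_eq_norm] at hq
    rw [show lam⁻¹ * (q - lam) - ((1 / 2 : ℝ) : ℂ) =
      lam⁻¹ * (q - (1 + ((1 / 2 : ℝ) : ℂ)) * lam) by field_simp; ring, norm_mul, hinv, one_mul]
    exact hq

/-- A Carleman class that contains the Gevrey-2 class is not quasianalytic. -/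
theorem not_isQuasianalytic {B : Type*} [NormedAddCommGroup B] [NormedSpace ℂ B] {e : B}
    (he : e ≠ 0) (σ : Side) {lam : ℂ} (hlam : ‖lam‖ = 1) {M : ℕ → ℝ} {A b : ℝ} (hA : 0 < A)
    (hb : 0 < b) (hM : ∀ n, A * b ^ n * (2 * n).factorial ≤ M n) :
    ¬ IsQuasianalytic σ lam M B := by
  intro hqa
  obtain ⟨s, hs, Δ, hΔ, hpos⟩ := exists_tangentDisk_re_pos σ hlam
  have hM0 : ∀ n, 0 ≤ M n := fun n => le_trans (by positivity) (hM n)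
  have he0 := norm_pos_iff.2 he
  -- The factor `s` maps the tangent disk into the right half-plane, where the principal root is
  -- holomorphic; `f` is flat at `lam` and vanishes nowhere.
  let f : ℂ → B := fun q => Complex.exp (-((s * (q - lam))⁻¹ ^ (1 / 2 : ℂ))) • e
  have hf : HasCarlemanExpansion σ lam M f 0 := by
    refine ⟨Δ, hΔ, ?_, ‖e‖ / A, 4 / b, by positivity, by positivity, fun N q hq => ?_⟩
    · refine DifferentiableOn.smul_const (DifferentiableOn.cexp (DifferentiableOn.neg ?_)) e
      refine DifferentiableOn.cpow_const (DifferentiableOn.inv (by fun_prop) fun q hq h => ?_)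
        fun q hq => Or.inl ?_
      · have := hpos q hq
        simp [h] at this
      · rw [Complex.inv_re]
        refine div_pos (hpos q hq) (Complex.normSq_pos.2 fun h => ?_)
        have := hpos q hq
        simp [h] at this
    · simp only [Pi.zero_apply, smul_zero, Finset.sum_const_zero, sub_zero]
      have h1 := norm_exp_neg_cpow_half_le (hpos q hq) N
      rw [norm_mul, hs, one_mul] at h1
      calc ‖f q‖ = ‖Complex.exp (-((s * (q - lam))⁻¹ ^ (1 / 2 : ℂ)))‖ * ‖e‖ := norm_smul _ _
        _ ≤ 4 ^ N * (2 * N).factorial * ‖q - lam‖ ^ N * ‖e‖ := by gcongr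
        _ = ‖e‖ / A * (4 / b) ^ N * (A * b ^ N * (2 * N).factorial) * ‖q - lam‖ ^ N := by
          rw [div_pow]
          field_simp
        _ ≤ _ := by gcongr; exact hM N
  have hz : HasCarlemanExpansion σ lam M (fun _ => (0 : B)) 0 := by
    refine ⟨Δ, hΔ, differentiableOn_const 0, 1, 1, one_pos, one_pos, fun N q _ => ?_⟩
    have := hM0 N
    simp only [Pi.zero_apply, smul_zero, Finset.sum_const_zero, sub_zero, norm_zero]
    positivity
  obtain ⟨Δ', hΔ', heq⟩ := hqa _ _ _ hf hz
  obtain ⟨t, ht⟩ := (eventually_normalPt_mem hlam hΔ').exists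
  exact smul_ne_zero (Complex.exp_ne_zero _) he (heq ht)

theorem monomial_ne_zero {r : ℝ} (hr0 : 0 < r) (n : ℕ) : monomial r n ≠ 0 := by
  intro h
  have hmem : ((r / 2 : ℝ) : ℂ) ∈ ball (0 : ℂ) r := by
    rw [mem_ball_zero_iff, Complex.norm_real, Real.norm_of_nonneg (by positivity)]
    linarith
  have h1 : (monomial r n : ball (0 : ℂ) r →ᵇ ℂ) ⟨_, hmem⟩ = 0 := by rw [h]; rfl
  have h2 : (((r / 2 : ℝ) : ℂ)) ^ (n + 1) = 0 := h1
  have h3 := eq_zero_of_pow_eq_zero h2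
  rw [Complex.ofReal_eq_zero] at h3
  linarith

/-- By uniqueness the expansion in the given class is the Gevrey one, so upper and lower bounds for
its coefficients together force `M` to dominate `(2n)!` up to geometric factors. The side of
membership plays no further role, whence an arbitrary side `τ`. The minimum with `M 0` covers `n =
0`, where no lower bound for the coefficients is available. -/
theorem IsQuadraticIrrational.not_isQuasianalytic_of_mem {α r : ℝ} (hα : IsQuadraticIrrational α)
    (hr0 : 0 < r) (hr1 : r < 1) {M : ℕ → ℝ} (hM : ∀ n, 0 < M n) {σ : Side}
    (hf : fdelta r ∈ CarlemanClass σ (circlePt α) M (Br r)) (τ : Side) :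
    ¬ IsQuasianalytic τ (circlePt α) M (Br r) := by
  obtain ⟨a, ha⟩ := hf
  obtain rfl : a = asympCoeff α r := ha.unique (norm_circlePt α) (hα.hasCarlemanExpansion hr0 hr1 σ)
  obtain ⟨c₀, c₁, h0, h1, hle⟩ := ha.exists_norm_le (norm_circlePt α)
  obtain ⟨A, b, hA, hb, hlow⟩ := hα.exists_le_norm_asympCoeff hr0 hr1
  refine not_isQuasianalytic (monomial_ne_zero hr0 0) τ (norm_circlePt α)
    (A := min (A / c₀) (M 0)) (b := b / c₁) (lt_min (by positivity) (hM 0)) (by positivity)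
    fun n => ?_
  rcases Nat.eq_zero_or_pos n with rfl | hn
  · simp
  · have h2 := (hlow n hn).trans (hle n)
    calc min (A / c₀) (M 0) * (b / c₁) ^ n * (2 * n).factorial
        ≤ A / c₀ * (b / c₁) ^ n * (2 * n).factorial := by gcongr; exact min_le_left _ _
      _ = A * b ^ n * (2 * n).factorial / (c₀ * c₁ ^ n) := by rw [div_pow]; field_simp
      _ ≤ M n := by rw [div_le_iff₀ (by positivity)]; linarith

end Monogenic

end

theorem theorem3p4 (α : ℝ) (hα : Monogenic.IsQuadraticIrrational α)
    (r : ℝ) (hr0 : 0 < r) (hr1 : r < 1) :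
    (∃! F : ℕ → Monogenic.Br r,
      Monogenic.HasGevreyExpansion 2 (Monogenic.circlePt α) (Monogenic.fdelta r) F) ∧
    (∀ F : ℕ → Monogenic.Br r,
      Monogenic.HasGevreyExpansion 2 (Monogenic.circlePt α) (Monogenic.fdelta r) F →
      Monogenic.IsFormalGevrey 2 F ∧
      ∃ Fhat : ℂ × ℂ → ℂ,
        Monogenic.ExtendsBorel F Fhat ∧
        AnalyticOnNhd ℂ Fhat (Monogenic.recDomain α r) ∧
        ∀ z ∈ Metric.ball (0 : ℂ) r,
          Monogenic.HasNaturalBoundary (fun ξ => Fhat (ξ, z)) (Monogenic.REC α z)) ∧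
    (∀ M : ℕ → ℝ, (∀ n, 0 < M n) → Monotone M →
      (Monogenic.fdelta r ∈
          Monogenic.CarlemanClass .minus (Monogenic.circlePt α) M (Monogenic.Br r) ∨
        Monogenic.fdelta r ∈
          Monogenic.CarlemanClass .plus (Monogenic.circlePt α) M (Monogenic.Br r)) →
      ¬ Monogenic.IsQuasianalytic .minus (Monogenic.circlePt α) M (Monogenic.Br r) ∧
        ¬ Monogenic.IsQuasianalytic .plus (Monogenic.circlePt α) M (Monogenic.Br r)) := by
  have huniq : ∀ F : ℕ → Monogenic.Br r,
      Monogenic.HasGevreyExpansion 2 (Monogenic.circlePt α) (Monogenic.fdelta r) F →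
      F = Monogenic.asympCoeff α r := fun F hF =>
    hF.1.unique (Monogenic.norm_circlePt α) (hα.hasCarlemanExpansion hr0 hr1 .minus)
  refine ⟨⟨_, hα.hasGevreyExpansion hr0 hr1, huniq⟩, fun F hF => ?_, fun M hM _ hf => ?_⟩
  · obtain rfl := huniq F hF
    refine ⟨hα.isFormalGevrey hr0 hr1, Monogenic.borelSum α, hα.extendsBorel hr0 hr1,
      fun p hp => hα.analyticAt_borelSum hp.2, fun z hz => ?_⟩
    exact hα.hasNaturalBoundary ((mem_ball_zero_iff.1 hz).trans hr1)
  · rcases hf with hf | hf <;>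
      exact ⟨hα.not_isQuasianalytic_of_mem hr0 hr1 hM hf _,
        hα.not_isQuasianalytic_of_mem hr0 hr1 hM hf _⟩
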